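/- Let $\zeta$ be the Riemann zeta-function. For $T\ge 1$ put $$J_{-1}(T)=\sum_{0<\gamma\le T}\frac{1}{|\zeta'(\rho)|^{2}}\in[0,\infty],$$ where $\rho$ runs over the zeros of $\zeta$ with imaginary part $\gamma\in(0,T]$, and where a multiple zero contributes $1/0=\infty$ (so that finiteness of $J_{-1}(T)$ for all $T$ includes the simplicity of these zeros). For an integer $k\ge 2$ let $$M_k(x)=\#\{1\le n\le x:\ n \text{ is not divisible by } p^k \text{ for any prime } p\}-\frac{x}{\zeta(k)} .$$ Assume the Riemann Hypothesis. Then the following two statements are equivalent. (i) For every $\varepsilon>0$ there is a constant $C_\varepsilon$ such that $J_{-1}(T)\le C_\varepsilon T^{1+\varepsilon}$ for all $T\ge 1$. (ii) For every integer $k\ge 2$ there is a constant $C_k$ such that $$\int_1^X\left(\frac{M_k(x)}{x^{1/(2k)}}\right)^2\frac{dx}{x}\le C_k\log X\qquad\text{for all } X\ge 1 .$$ -/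

import Mathlib

open scoped ENNReal

noncomputable section

/-- `n` is `k`-free: no `k`-th power of a prime divides it. -/
def IsKFree (k n : ℕ) : Prop := ∀ p : ℕ, p.Prime → ¬ p ^ k ∣ n

open Classical in
/-- The characteristic function of the `k`-free numbers. -/
def muK (k n : ℕ) : ℝ := if IsKFree k n then 1 else 0

/-- The number of positive `k`-free integers `n ≤ x`. -/
def kFreeCount (k : ℕ) (x : ℝ) : ℝ := ∑ n ∈ Finset.Icc 1 ⌊x⌋₊, muK k n

/-- The error term `M_k(x)`; for an integer `k ≥ 2` the value `ζ(k)` is real,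
so that taking its real part loses nothing. -/
def errM (k : ℕ) (x : ℝ) : ℝ := kFreeCount k x - x / (riemannZeta k).re

/-- The zeros of the Riemann zeta function with imaginary part in `(0, T]`. -/
def zetaZeros (T : ℝ) : Set ℂ := {ρ | riemannZeta ρ = 0 ∧ 0 < ρ.im ∧ ρ.im ≤ T}

/-- The sum of `1 / |ζ'(ρ)|²` over the zeros of zeta with imaginary part in `(0, T]`,
valued in `[0, ∞]`. A multiple zero contributes `1 / 0 = ∞`, so that a finite bound includes
the simplicity of the zeros that occur. -/
def Jneg1 (T : ℝ) : ℝ≥0∞ := ∑' ρ : zetaZeros T, (‖deriv riemannZeta (ρ : ℂ)‖ₑ ^ 2)⁻¹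

end

noncomputable section

open Complex Set MeasureTheory Filter Topology

open scoped ComplexConjugate FourierTransform

/-! ### Truncated Mellin transforms, and ζ on Re s > 0 -/

/-- The integral `∫_1^∞ g(x) x^{-s-1} dx`. -/
def tailMellin (g : ℝ → ℝ) (s : ℂ) : ℂ :=
  ∫ x in Ioi (1 : ℝ), (g x : ℂ) * (x : ℂ) ^ (-(s + 1))

lemma aestronglyMeasurable_cpow_Ioi (a : ℂ) :
    AEStronglyMeasurable (fun x : ℝ ↦ (x : ℂ) ^ a) (volume.restrict (Ioi 1)) := by
  refine ContinuousOn.aestronglyMeasurable (fun t ht ↦ ?_) measurableSet_Ioi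
  exact (Complex.continuousAt_ofReal_cpow_const _ _
    (Or.inr (zero_lt_one.trans ht).ne')).continuousWithinAt

lemma integrableOn_tailMellin {g : ℝ → ℝ} (hg : Measurable g) {s : ℂ}
    (h : IntegrableOn (fun x ↦ g x * x ^ (-(s.re + 1))) (Ioi 1)) :
    IntegrableOn (fun x : ℝ ↦ (g x : ℂ) * (x : ℂ) ^ (-(s + 1))) (Ioi 1) := by
  refine h.norm.mono' ?_ ?_
  · exact (Complex.measurable_ofReal.comp hg).aestronglyMeasurable.mul
      (aestronglyMeasurable_cpow_Ioi _)
  · filter_upwards [ae_restrict_mem measurableSet_Ioi] with x hx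
    have hx0 : (0 : ℝ) < x := zero_lt_one.trans hx
    rw [norm_mul, norm_mul, Complex.norm_cpow_eq_rpow_re_of_pos hx0, Complex.norm_real,
      Real.norm_of_nonneg (Real.rpow_nonneg hx0.le _)]
    simp

/-- The factor log x produced by differentiation costs only a small power of x. A third of the
distance from `s.re` to `σ₀` is spent on the disc around s and a third on log x, which leaves
integrability at `σ₀ + d`. -/
lemma differentiableAt_tailMellin {g : ℝ → ℝ} (hg : Measurable g) {σ₀ : ℝ}
    (h : ∀ σ, σ₀ < σ → IntegrableOn (fun x ↦ g x * x ^ (-(σ + 1))) (Ioi 1)) {s : ℂ}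
    (hs : σ₀ < s.re) : DifferentiableAt ℂ (tailMellin g) s := by
  set d := (s.re - σ₀) / 3 with hd
  have hd0 : 0 < d := by rw [hd]; linarith
  have key := hasDerivAt_integral_of_dominated_loc_of_deriv_le
    (μ := volume.restrict (Ioi (1 : ℝ)))
    (F := fun s x ↦ (g x : ℂ) * (x : ℂ) ^ (-(s + 1))) (x₀ := s) (s := Metric.ball s d)
    (F' := fun s x ↦ (g x : ℂ) * ((x : ℂ) ^ (-(s + 1)) * Complex.log x * (-1)))
    (bound := fun x ↦ ‖g x * x ^ (-((σ₀ + d) + 1))‖ / d)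
    (Metric.ball_mem_nhds s hd0) ?_ ?_ ?_ ?_ ?_ ?_
  · exact key.2.differentiableAt
  · exact Eventually.of_forall fun z ↦
      (Complex.measurable_ofReal.comp hg).aestronglyMeasurable.mul (aestronglyMeasurable_cpow_Ioi _)
  · exact integrableOn_tailMellin hg (h _ hs)
  · refine (Complex.measurable_ofReal.comp hg).aestronglyMeasurable.mul
      (((aestronglyMeasurable_cpow_Ioi _).mul ?_).mul aestronglyMeasurable_const)
    exact (Complex.measurable_log.comp Complex.measurable_ofReal).aestronglyMeasurable
  · filter_upwards [ae_restrict_mem measurableSet_Ioi] with x hx z hz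
    have hx1 : (1 : ℝ) < x := hx
    have hx0 : (0 : ℝ) < x := zero_lt_one.trans hx
    have hzre : σ₀ + 2 * d < z.re := by
      have h1 : |(z - s).re| < d :=
        (Complex.abs_re_le_norm _).trans_lt (by simpa [dist_eq_norm] using hz)
      rw [Complex.sub_re] at h1
      have := (abs_lt.mp h1).1
      have : s.re = σ₀ + 3 * d := by rw [hd]; ring
      linarith
    rw [norm_mul, norm_mul, norm_mul, norm_mul, Complex.norm_cpow_eq_rpow_re_of_pos hx0,
      Complex.norm_real, ← Complex.ofReal_log hx0.le, Complex.norm_real, norm_neg, norm_one, mul_one,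
      mul_div_assoc, Real.norm_of_nonneg (Real.rpow_nonneg hx0.le _),
      Real.norm_of_nonneg (Real.log_nonneg hx1.le)]
    refine mul_le_mul_of_nonneg_left ?_ (norm_nonneg _)
    calc x ^ (-(z + 1)).re * Real.log x ≤ x ^ (-(σ₀ + 2 * d + 1)) * (x ^ d / d) := by
          refine mul_le_mul ?_ (Real.log_le_rpow_div hx0.le hd0) (Real.log_nonneg hx1.le)
            (Real.rpow_nonneg hx0.le _)
          refine Real.rpow_le_rpow_of_exponent_le hx1.le ?_
          simp only [Complex.neg_re, Complex.add_re, Complex.one_re]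
          linarith
      _ = x ^ (-(σ₀ + d + 1)) / d := by
          rw [← mul_div_assoc, ← Real.rpow_add hx0]; ring_nf
  · exact (h (σ₀ + d) (by linarith)).norm.div_const d
  · filter_upwards [ae_restrict_mem measurableSet_Ioi] with x hx z _
    have hx0 : (x : ℂ) ≠ 0 := Complex.ofReal_ne_zero.mpr (zero_lt_one.trans hx).ne'
    have h1 : HasDerivAt (fun s : ℂ ↦ -(s + 1)) (-1) z := by
      exact ((hasDerivAt_id z).add_const (1 : ℂ)).neg
    exact (h1.const_cpow (Or.inl hx0)).const_mul _

lemma integrableOn_of_abs_le_rpow {g : ℝ → ℝ} (hg : Measurable g) {C r σ : ℝ}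
    (hb : ∀ x, 1 < x → |g x| ≤ C * x ^ r) (hσ : r < σ) :
    IntegrableOn (fun x ↦ g x * x ^ (-(σ + 1))) (Ioi 1) := by
  have h1 : IntegrableOn (fun x : ℝ ↦ C * x ^ (r - σ - 1)) (Ioi 1) :=
    (integrableOn_Ioi_rpow_of_lt (by linarith) one_pos).const_mul C
  refine h1.mono' ?_ ?_
  · exact (hg.mul (measurable_id.pow_const _)).aestronglyMeasurable
  · filter_upwards [ae_restrict_mem measurableSet_Ioi] with x hx
    have hx0 : (0 : ℝ) < x := zero_lt_one.trans hx
    rw [norm_mul, Real.norm_eq_abs, Real.norm_of_nonneg (Real.rpow_nonneg hx0.le _)]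
    calc |g x| * x ^ (-(σ + 1)) ≤ C * x ^ r * x ^ (-(σ + 1)) := by
          gcongr; exact hb x hx
      _ = C * x ^ (r - σ - 1) := by
          rw [mul_assoc, ← Real.rpow_add hx0]; ring_nf

lemma abs_fract_le_rpow (x : ℝ) (_ : 1 < x) : |Int.fract x| ≤ 1 * x ^ (0 : ℝ) := by
  rw [abs_of_nonneg (Int.fract_nonneg x)]
  simpa using (Int.fract_lt_one x).le

lemma tailMellin_id {s : ℂ} (hs : 1 < s.re) : tailMellin (fun x ↦ x) s = 1 / (s - 1) := by
  have hs1 : s ≠ 1 := by rintro rfl; simp at hs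
  have : ∀ x ∈ Ioi (1 : ℝ), (x : ℂ) * (x : ℂ) ^ (-(s + 1)) = (x : ℂ) ^ (-s) := by
    intro x hx
    have hx0 : (x : ℂ) ≠ 0 := Complex.ofReal_ne_zero.mpr (zero_lt_one.trans hx).ne'
    rw [show -s = 1 + -(s + 1) by ring, Complex.cpow_add _ _ hx0, Complex.cpow_one]
  rw [tailMellin, setIntegral_congr_fun measurableSet_Ioi this,
    integral_Ioi_cpow_of_lt (by simpa using hs) one_pos]
  have : -s + 1 ≠ 0 := by
    intro h; apply hs1; linear_combination -h
  have h2 : s - 1 ≠ 0 := sub_ne_zero.mpr hs1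
  rw [Complex.ofReal_one, Complex.one_cpow]
  rw [show -s + 1 = -(s - 1) by ring, neg_div_neg_eq]

/-- Partial summation of Σ n^(-s) with ⌊x⌋ = x - {x}. The term x produces the pole at 1, which
`riemannZeta₁` does not have. -/
lemma riemannZeta₁_eq_of_one_lt {s : ℂ} (hs : 1 < s.re) :
    riemannZeta₁ s = s - s * (s - 1) * tailMellin Int.fract s := by
  have hs1 : s ≠ 1 := by rintro rfl; simp at hs
  have hs2 : s - 1 ≠ 0 := sub_ne_zero.mpr hs1
  have hz := LSeries_eq_mul_integral_of_nonneg (fun _ ↦ (1 : ℝ)) zero_le_one hs ?_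
    (fun _ ↦ zero_le_one)
  · have hone : LSeries (fun _ ↦ ((1 : ℝ) : ℂ)) s = riemannZeta s := by
      rw [← LSeries_one_eq_riemannZeta hs]; congr 1
    rw [hone] at hz
    have hint : ∫ t in Ioi (1 : ℝ), (∑ k ∈ Finset.Icc 1 ⌊t⌋₊, ((1 : ℝ) : ℂ)) * (t : ℂ) ^ (-(s + 1))
        = tailMellin (fun x ↦ x) s - tailMellin Int.fract s := by
      rw [tailMellin, tailMellin, ← integral_sub]
      · refine setIntegral_congr_fun measurableSet_Ioi fun x hx ↦ ?_
        have hx0 : (0 : ℝ) ≤ x := (zero_lt_one.trans hx).le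
        have : (⌊x⌋₊ : ℝ) = x - Int.fract x := by
          rw [natCast_floor_eq_intCast_floor hx0, Int.self_sub_fract]
        have h2 : (⌊x⌋₊ : ℂ) = (x : ℂ) - ((Int.fract x : ℝ) : ℂ) := by
          rw [← Complex.ofReal_sub, ← this]; simp
        simp only [Complex.ofReal_one, Finset.sum_const, Nat.card_Icc, add_tsub_cancel_right,
          nsmul_eq_mul, mul_one]
        rw [h2]; ring
      · refine integrableOn_tailMellin measurable_id ?_
        exact integrableOn_of_abs_le_rpow (C := 1) (r := 1) measurable_id (fun x hx ↦ by
          rw [abs_of_pos (by simpa using zero_lt_one.trans hx)]; simp) hs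
      · refine integrableOn_tailMellin measurable_fract ?_
        exact integrableOn_of_abs_le_rpow measurable_fract abs_fract_le_rpow (by linarith)
    rw [hint, tailMellin_id hs] at hz
    have := riemannZeta_eq_inv_sub_mul hs1
    rw [hz] at this
    field_simp at this ⊢
    linear_combination -this
  · refine Asymptotics.isBigO_of_le _ fun n ↦ ?_
    simp

lemma isPreconnected_re_gt (c : ℝ) : IsPreconnected {s : ℂ | c < s.re} :=
  (convex_halfSpace_re_gt c).isPreconnected

/-- Since {x} is bounded, both sides are holomorphic on Re s > 0, and they agree on Re s > 1. -/
lemma riemannZeta₁_eq {s : ℂ} (hs : 0 < s.re) :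
    riemannZeta₁ s = s - s * (s - 1) * tailMellin Int.fract s := by
  have hopen : IsOpen {s : ℂ | 0 < s.re} := isOpen_lt continuous_const Complex.continuous_re
  have hI : ∀ s : ℂ, 0 < s.re → DifferentiableAt ℂ (tailMellin Int.fract) s := fun s hs ↦
    differentiableAt_tailMellin measurable_fract (σ₀ := 0)
      (fun σ hσ ↦ integrableOn_of_abs_le_rpow measurable_fract abs_fract_le_rpow hσ) hs
  refine AnalyticOnNhd.eqOn_of_preconnected_of_eventuallyEq (𝕜 := ℂ) (U := {s : ℂ | 0 < s.re})
    (f := riemannZeta₁) (g := fun s ↦ s - s * (s - 1) * tailMellin Int.fract s) (z₀ := 2)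
    ?_ ?_ (isPreconnected_re_gt 0) (by simp) ?_ hs
  · exact differentiable_riemannZeta₁.differentiableOn.analyticOnNhd hopen
  · refine DifferentiableOn.analyticOnNhd (fun z hz ↦ ?_) hopen
    have := hI z hz
    exact (by fun_prop : DifferentiableAt ℂ
      (fun s ↦ s - s * (s - 1) * tailMellin Int.fract s) z).differentiableWithinAt
  · filter_upwards [(isOpen_lt continuous_const Complex.continuous_re).mem_nhds
      (show (1 : ℝ) < (2 : ℂ).re by simp)] with z hz using riemannZeta₁_eq_of_one_lt hz

lemma norm_tailMellin_fract_le {s : ℂ} (hs : 0 < s.re) : ‖tailMellin Int.fract s‖ ≤ 1 / s.re := by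
  have h1 : ∫ x in Ioi (1 : ℝ), x ^ (-(s.re + 1)) = 1 / s.re := by
    rw [integral_Ioi_rpow_of_lt (by linarith) one_pos]
    simp only [Real.one_rpow]
    rw [show -(s.re + 1) + 1 = -s.re by ring, neg_div_neg_eq]
  rw [tailMellin, ← h1]
  refine norm_integral_le_of_norm_le (integrableOn_Ioi_rpow_of_lt (by linarith) one_pos) ?_
  filter_upwards [ae_restrict_mem measurableSet_Ioi] with x hx
  have hx0 : (0 : ℝ) < x := zero_lt_one.trans hx
  rw [norm_mul, Complex.norm_cpow_eq_rpow_re_of_pos hx0, Complex.norm_real,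
    Real.norm_of_nonneg (Int.fract_nonneg x)]
  simp only [Complex.neg_re, Complex.add_re, Complex.one_re]
  exact mul_le_of_le_one_left (Real.rpow_nonneg hx0.le _) (Int.fract_lt_one x).le

lemma riemannZeta_eq_sub_tailMellin {s : ℂ} (hs : 0 < s.re) (hs1 : s ≠ 1) :
    riemannZeta s = s / (s - 1) - s * tailMellin Int.fract s := by
  have h2 : s - 1 ≠ 0 := sub_ne_zero.mpr hs1
  rw [riemannZeta_eq_inv_sub_mul hs1, riemannZeta₁_eq hs]
  field_simp

/-- This crude growth is all that the Borel–Carathéodory and Jensen arguments need: log |ζ| is at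
most a multiple of log |t|. -/
lemma norm_riemannZeta_le {s : ℂ} (hs : 0 < s.re) (hs1 : 1 ≤ |s.im|) :
    ‖riemannZeta s‖ ≤ 2 + ‖s‖ / s.re := by
  have hn : 1 ≤ ‖s - 1‖ := hs1.trans (by simpa using Complex.abs_im_le_norm (s - 1))
  have hne : s ≠ 1 := by rintro rfl; simp at hs1; linarith
  have h2 : s - 1 ≠ 0 := sub_ne_zero.mpr hne
  rw [riemannZeta_eq_sub_tailMellin hs hne]
  refine (norm_sub_le _ _).trans (add_le_add ?_ ?_)
  · have : s / (s - 1) = 1 + 1 / (s - 1) := by field_simp; ring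
    rw [this]
    refine (norm_add_le _ _).trans ?_
    rw [norm_one, norm_div, norm_one]
    have : 1 / ‖s - 1‖ ≤ 1 := by rw [div_le_one (by linarith)]; exact hn
    linarith
  · rw [norm_mul, div_eq_mul_one_div]
    exact mul_le_mul_of_nonneg_left (norm_tailMellin_fract_le hs) (norm_nonneg _)

/-- At 1/2 the formula reads -1 minus half the integral of a nonnegative function, so the value is
negative. The sum J_{-1} only sees zeros off the real axis, so the real point of the critical line
has to be treated separately. -/
lemma riemannZeta_one_half_ne_zero : riemannZeta (1 / 2) ≠ 0 := by
  have hre : (0 : ℝ) < (1 / 2 : ℂ).re := by norm_num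
  have hne : (1 / 2 : ℂ) ≠ 1 := by norm_num
  rw [riemannZeta_eq_sub_tailMellin hre hne]
  have : tailMellin Int.fract (1 / 2) =
      ((∫ x in Ioi (1 : ℝ), Int.fract x * x ^ (-(3 / 2 : ℝ)) : ℝ) : ℂ) := by
    rw [tailMellin, ← integral_complex_ofReal]
    refine setIntegral_congr_fun measurableSet_Ioi fun x hx ↦ ?_
    have hx0 : (0 : ℝ) ≤ x := (zero_lt_one.trans hx).le
    rw [Complex.ofReal_mul, Complex.ofReal_cpow hx0]
    norm_num
  rw [this]
  have hnn : 0 ≤ ∫ x in Ioi (1 : ℝ), Int.fract x * x ^ (-(3 / 2 : ℝ)) := by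
    refine setIntegral_nonneg measurableSet_Ioi fun x hx ↦ ?_
    exact mul_nonneg (Int.fract_nonneg x) (Real.rpow_nonneg (zero_lt_one.trans hx).le _)
  intro h
  have := congrArg Complex.re h
  simp at this
  norm_num at this
  linarith

lemma RiemannHypothesis.riemannZeta_ne_zero (hRH : RiemannHypothesis) {s : ℂ} (hs : 0 < s.re)
    (hs2 : s.re ≠ 1 / 2) : riemannZeta s ≠ 0 := by
  intro h
  by_cases h1 : s = 1
  · exact riemannZeta_one_ne_zero (h1 ▸ h)
  refine hs2 (hRH s h ?_ h1)
  rintro ⟨n, rfl⟩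
  simp at hs
  linarith [(Nat.cast_nonneg n : (0 : ℝ) ≤ n)]

lemma RiemannHypothesis.re_eq (hRH : RiemannHypothesis) {s : ℂ} (hs : riemannZeta s = 0)
    (him : s.im ≠ 0) : s.re = 1 / 2 := by
  refine hRH s hs ?_ ?_
  · rintro ⟨n, rfl⟩
    simp at him
  · rintro rfl
    simp at him

/-! ### Bounds for ζ and 1/ζ under the Riemann Hypothesis -/

/-- A nonvanishing holomorphic function on a disc has a holomorphic logarithm. -/
lemma exists_log_ball {f : ℂ → ℂ} {c : ℂ} {R : ℝ} (hf : DifferentiableOn ℂ f (Metric.ball c R))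
    (h0 : ∀ z ∈ Metric.ball c R, f z ≠ 0) (hR : 0 < R) :
    ∃ L : ℂ → ℂ, DifferentiableOn ℂ L (Metric.ball c R) ∧ L c = Complex.log (f c) ∧
      ∀ z ∈ Metric.ball c R, Complex.exp (L z) = f z := by
  have hd : DifferentiableOn ℂ (fun z ↦ deriv f z / f z) (Metric.ball c R) :=
    (hf.deriv Metric.isOpen_ball).div hf h0
  obtain ⟨g, hg⟩ := hd.isExactOn_ball
  have hc : c ∈ Metric.ball c R := Metric.mem_ball_self hR
  refine ⟨fun z ↦ g z - g c + Complex.log (f c), ?_, by simp, fun z hz ↦ ?_⟩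
  · intro z hz
    exact (((hg z hz).differentiableAt.sub_const _).add_const _).differentiableWithinAt
  -- Since g' = f'/f, the product f exp(-(g - g(c))) has derivative zero and keeps its value f(c).
  · have hconst : ∀ w ∈ Metric.ball c R,
        HasDerivAt (fun z ↦ f z * Complex.exp (-(g z - g c))) 0 w := by
      intro w hw
      have h1 := (hf.differentiableAt (Metric.isOpen_ball.mem_nhds hw)).hasDerivAt
      have h2 := ((hg w hw).sub_const (g c)).neg.cexp
      refine (h1.mul h2).congr_deriv ?_
      have := h0 w hw
      dsimp only [Pi.neg_apply]
      field_simp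
      ring
    have heq := (convex_ball c R).is_const_of_fderivWithin_eq_zero (𝕜 := ℂ)
      (f := fun z ↦ f z * Complex.exp (-(g z - g c)))
      (fun w hw ↦ (hconst w hw).differentiableAt.differentiableWithinAt)
      (fun w hw ↦ by
        rw [fderivWithin_of_isOpen Metric.isOpen_ball hw]
        rw [(hconst w hw).hasFDerivAt.fderiv]; ext; simp) hc hz
    simp only [sub_self, neg_zero, Complex.exp_zero, mul_one] at heq
    rw [Complex.exp_add, Complex.exp_log (h0 c hc), heq, mul_comm, mul_assoc, ← Complex.exp_add]
    simp

/-- Hadamard's three circles theorem, for concentric closed discs. -/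
lemma three_circles {L : ℂ → ℂ} {c : ℂ} {R r₁ r₂ a b : ℝ}
    (hL : DifferentiableOn ℂ L (Metric.ball c R)) (h1 : 0 < r₁) (h12 : r₁ < r₂) (h2 : r₂ < R)
    (ha : ∀ z, ‖z - c‖ = r₁ → ‖L z‖ ≤ a) (hb : ∀ z, ‖z - c‖ ≤ r₂ → ‖L z‖ ≤ b) {z : ℂ}
    (hz1 : r₁ ≤ ‖z - c‖) (hz2 : ‖z - c‖ ≤ r₂) :
    ‖L z‖ ≤ a ^ (1 - (Real.log ‖z - c‖ - Real.log r₁) / (Real.log r₂ - Real.log r₁)) *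
      b ^ ((Real.log ‖z - c‖ - Real.log r₁) / (Real.log r₂ - Real.log r₁)) := by
  have hzne : z - c ≠ 0 := norm_pos_iff.mp (h1.trans_le hz1)
  have hr2 : 0 < r₂ := h1.trans h12
  have hlog : Real.log r₁ < Real.log r₂ := Real.log_lt_log h1 h12
  have hmem : ∀ w : ℂ, w.re ≤ Real.log r₂ → ‖c + Complex.exp w - c‖ ≤ r₂ := by
    intro w hw
    rw [add_sub_cancel_left, Complex.norm_exp, ← Real.exp_log hr2]
    simpa using hw
  have hdiff : ∀ w : ℂ, w.re ≤ Real.log r₂ →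
      DifferentiableAt ℂ (fun w ↦ L (c + Complex.exp w)) w := by
    intro w hw
    have h3 : c + Complex.exp w ∈ Metric.ball c R := by
      rw [Metric.mem_ball, dist_eq_norm]; exact (hmem w hw).trans_lt h2
    have h4 := hL.differentiableAt (Metric.isOpen_ball.mem_nhds h3)
    exact DifferentiableAt.comp w h4 (by fun_prop)
  -- The map w ↦ c + exp w carries the strip log r₁ ≤ Re w ≤ log r₂ onto the annulus, so the three
  -- lines theorem applies.
  have key := Complex.HadamardThreeLines.norm_le_interp_of_mem_verticalClosedStrip'
    (f := fun w ↦ L (c + Complex.exp w)) (z := Complex.log (z - c)) (a := a) (b := b) hlog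
    ?_ ?_ ?_ ?_ ?_
  · rw [Complex.log_re, Complex.exp_log hzne, add_sub_cancel] at key
    exact key
  · rw [Complex.HadamardThreeLines.verticalClosedStrip, mem_preimage, Complex.log_re, mem_Icc]
    exact ⟨Real.log_le_log h1 hz1, Real.log_le_log (h1.trans_le hz1) hz2⟩
  · refine ⟨fun w hw ↦ (hdiff w hw.2.le).differentiableWithinAt, fun w hw ↦ ?_⟩
    have : closure (Complex.HadamardThreeLines.verticalStrip (Real.log r₁) (Real.log r₂)) ⊆
        {w : ℂ | w.re ≤ Real.log r₂} :=
      closure_minimal (fun w hw ↦ hw.2.le) (isClosed_le Complex.continuous_re continuous_const)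
    exact (hdiff w (this hw)).continuousAt.continuousWithinAt
  · refine ⟨b, ?_⟩
    rintro _ ⟨w, hw, rfl⟩
    exact hb _ (hmem w hw.2)
  · intro w hw
    refine ha _ ?_
    rw [add_sub_cancel_left, Complex.norm_exp, mem_singleton_iff.mp hw, Real.exp_log h1]
  · intro w hw
    exact hb _ (hmem w (mem_singleton_iff.mp hw).le)

/-- Either ε x already dominates x^θ, or x lies below the threshold ε^(-1/(1-θ)). This turns (log
t)^θ into ε log t + O(1). -/
lemma rpow_le_mul_add {θ ε : ℝ} (hθ : θ < 1) (hε : 0 < ε) {x : ℝ} (hx : 1 ≤ x) :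
    x ^ θ ≤ ε * x + ε ^ (-1 / (1 - θ)) := by
  have hx0 : 0 < x := by linarith
  have hC : 0 < ε ^ (-1 / (1 - θ)) := Real.rpow_pos_of_pos hε _
  have h1θ : 0 < 1 - θ := by linarith
  by_cases h : x ^ θ ≤ ε * x
  · linarith
  · push Not at h
    have h1 : x ^ (1 - θ) ≤ ε⁻¹ := by
      rw [Real.rpow_sub hx0, Real.rpow_one, div_le_iff₀ (Real.rpow_pos_of_pos hx0 _),
        le_inv_mul_iff₀ hε]
      exact h.le
    have h2 : x ≤ ε ^ (-1 / (1 - θ)) := by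
      have := Real.rpow_le_rpow (Real.rpow_nonneg hx0.le _) h1 (inv_nonneg.mpr h1θ.le)
      rw [← Real.rpow_mul hx0.le, mul_inv_cancel₀ h1θ.ne', Real.rpow_one, Real.inv_rpow hε.le,
        ← Real.rpow_neg hε.le] at this
      rwa [show -1 / (1 - θ) = -(1 - θ)⁻¹ by rw [neg_div, one_div]]
    calc x ^ θ ≤ x ^ (1 : ℝ) := Real.rpow_le_rpow_of_exponent_le hx hθ.le
      _ = x := Real.rpow_one x
      _ ≤ _ := by nlinarith

lemma norm_LSeries_le_of_norm_le_one {f : ℕ → ℂ} (hf : ∀ n, ‖f n‖ ≤ 1) {σ : ℝ} (hσ : 1 < σ) {s : ℂ}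
    (hs : σ ≤ s.re) : ‖LSeries f s‖ ≤ ∑' n : ℕ, 1 / (n : ℝ) ^ σ := by
  refine tsum_of_norm_bounded (Real.summable_one_div_nat_rpow.mpr hσ).hasSum fun n ↦ ?_
  rcases eq_or_ne n 0 with rfl | hn
  · simp [LSeries.term]; positivity
  · rw [LSeries.term_of_ne_zero hn, norm_div, Complex.norm_natCast_cpow_of_pos
      (Nat.pos_of_ne_zero hn)]
    have hn1 : (1 : ℝ) ≤ n := by exact_mod_cast Nat.one_le_iff_ne_zero.mpr hn
    gcongr
    exact hf n

lemma norm_riemannZeta_le_tsum {σ : ℝ} (hσ : 1 < σ) {s : ℂ} (hs : σ ≤ s.re) :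
    ‖riemannZeta s‖ ≤ ∑' n : ℕ, 1 / (n : ℝ) ^ σ ∧
      ‖(riemannZeta s)⁻¹‖ ≤ ∑' n : ℕ, 1 / (n : ℝ) ^ σ := by
  have hs1 : 1 < s.re := hσ.trans_le hs
  constructor
  · rw [← LSeries_one_eq_riemannZeta hs1]
    exact norm_LSeries_le_of_norm_le_one (by simp) hσ hs
  · have h := ArithmeticFunction.LSeries_zeta_mul_Lseries_moebius hs1
    rw [ArithmeticFunction.LSeries_zeta_eq_riemannZeta hs1] at h
    rw [inv_eq_of_mul_eq_one_right h]
    refine norm_LSeries_le_of_norm_le_one (fun n ↦ ?_) hσ hs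
    rw [Complex.norm_intCast]
    exact_mod_cast ArithmeticFunction.abs_moebius_le_one

/-- Bounds for a holomorphic function on a disc that is nonvanishing, bounded by `exp M`, and
whose value at the centre is not small. -/
lemma norm_log_le_of_norm_le {f L : ℂ → ℂ} {c : ℂ} {R M : ℝ} (hR : 0 < R) (hM : 0 < M)
    (hL : DifferentiableOn ℂ L (Metric.ball c R))
    (hexp : ∀ z ∈ Metric.ball c R, Complex.exp (L z) = f z)
    (hf : ∀ z ∈ Metric.ball c R, ‖f z‖ ≤ Real.exp M) {z : ℂ} {r : ℝ} (hr : r < R)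
    (hz : ‖z - c‖ ≤ r) :
    ‖L z‖ ≤ (2 * M * R + ‖L c‖ * (2 * R)) / (R - r) := by
  have hmaps : ∀ w ∈ Metric.ball (0 : ℂ) R, c + w ∈ Metric.ball c R := by
    intro w hw; simpa [dist_eq_norm] using hw
  have hzb : z - c ∈ Metric.ball (0 : ℂ) R := by simpa using hz.trans_lt hr
  -- The real part of L is log |f| ≤ M, and Borel–Carathéodory bounds the modulus by the real part
  -- on a smaller disc.
  have key := Complex.borelCaratheodory (f := fun w ↦ L (c + w)) (z := z - c) hM ?_ ?_ hR hzb
  · simp only [add_sub_cancel, add_zero] at key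
    refine key.trans ?_
    rw [← add_div]
    gcongr
    · linarith
    · linarith
  · intro w hw
    have := hL.differentiableAt (Metric.isOpen_ball.mem_nhds (hmaps w hw))
    exact (DifferentiableAt.comp w this (by fun_prop)).differentiableWithinAt
  · intro w hw
    have h1 := hf _ (hmaps w hw)
    rw [← hexp _ (hmaps w hw), Complex.norm_exp, Real.exp_le_exp] at h1
    exact h1

lemma norm_log_le {z : ℂ} {C : ℝ} (h1 : ‖z‖ ≤ C) (h2 : ‖z⁻¹‖ ≤ C) (hz : z ≠ 0) :
    ‖Complex.log z‖ ≤ Real.log C + Real.pi := by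
  have hzp : 0 < ‖z‖ := norm_pos_iff.mpr hz
  refine (Complex.norm_le_abs_re_add_abs_im _).trans (add_le_add ?_ ?_)
  · rw [Complex.log_re, abs_le]
    constructor
    · rw [norm_inv] at h2
      have := Real.log_le_log (inv_pos.mpr hzp) h2
      rw [Real.log_inv] at this
      linarith
    · exact Real.log_le_log hzp h1
  · rw [Complex.log_im]; exact Complex.abs_arg_le_pi z

-- Littlewood's argument. Under RH a logarithm of ζ exists on the disc of radius 3/2 about 2 + it.
-- It is O(1) on a small concentric disc, where the Dirichlet series converges absolutely, and O(log
-- t) up to distance η/2 from the critical line, by Borel–Carathéodory. The three circles theorem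
-- gives O((log t)^θ) with θ < 1 up to distance η from the line, which is at most ε log t + O(1).
set_option maxHeartbeats 1000000 in
lemma RiemannHypothesis.log_riemannZeta_bound (hRH : RiemannHypothesis) {η ε : ℝ} (hη : 0 < η)
    (hε : 0 < ε) : ∃ C : ℝ, ∀ s : ℂ, 1 / 2 + η ≤ s.re → s.re ≤ 2 → 3 ≤ s.im →
      ∃ w : ℂ, Complex.exp w = riemannZeta s ∧ ‖w‖ ≤ ε * Real.log s.im + C := by
  wlog hη1 : η ≤ 1 / 4 generalizing η
  · obtain ⟨C, hC⟩ := this (η := 1 / 4) (by norm_num) le_rfl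
    exact ⟨C, fun s hs ↦ hC s (by linarith)⟩
  set D := ∑' n : ℕ, 1 / (n : ℝ) ^ (3 / 2 : ℝ) with hD
  have hDb := fun {s : ℂ} (hs : (3 / 2 : ℝ) ≤ s.re) ↦
    norm_riemannZeta_le_tsum (by norm_num : (1 : ℝ) < 3 / 2) hs
  rw [← hD] at hDb
  have hD1 : 1 ≤ D := by
    have hsum := Real.summable_one_div_nat_rpow.mpr (by norm_num : (1 : ℝ) < 3 / 2)
    have := hsum.le_tsum 1 (fun n _ ↦ by positivity)
    simpa [hD] using this
  set A := Real.log D + Real.pi with hA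
  have hA0 : 0 < A := add_pos_of_nonneg_of_pos (Real.log_nonneg hD1) Real.pi_pos
  set r₂ := 3 / 2 - η / 2 with hr2
  set r := 3 / 2 - η with hr
  have hlog14 : Real.log (1 / 4) < Real.log r := Real.log_lt_log (by norm_num) (by linarith)
  have hlogr : Real.log r < Real.log r₂ := Real.log_lt_log (by linarith) (by linarith)
  set θ := (Real.log r - Real.log (1 / 4)) / (Real.log r₂ - Real.log (1 / 4)) with hθ
  have hθ1 : θ < 1 := by rw [hθ, div_lt_one (by linarith)]; linarith
  have hθ0 : 0 < θ := by rw [hθ]; exact div_pos (by linarith) (by linarith)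
  -- bound on the small circle
  set a := (2 * (Real.log D + 1) * (1 / 2) + A * (2 * (1 / 2))) / (1 / 2 - 1 / 4) with ha
  have ha1 : 1 ≤ a := by
    have := Real.log_nonneg hD1
    rw [ha, le_div_iff₀ (by norm_num)]
    nlinarith
  have ha0 : 0 < a := by linarith
  -- bound on the large circle
  set B := (2 * 4 * (3 / 2) + A * (2 * (3 / 2))) / (η / 2) with hB
  have hB1 : 1 ≤ B := by
    rw [hB, le_div_iff₀ (by linarith)]; nlinarith
  -- With this κ the term a κ (B log t) at the end is exactly ε log t.
  set κ := ε / (a * B) with hκ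
  have hκ0 : 0 < κ := by positivity
  refine ⟨a * κ ^ (-1 / (1 - θ)) + a, fun s hs1 hs2 hs3 ↦ ?_⟩
  set t := s.im with ht
  set c : ℂ := ⟨2, t⟩ with hc
  have hlogt : 1 ≤ Real.log t := by
    rw [Real.le_log_iff_exp_le (by linarith)]
    linarith [Real.exp_one_lt_d9]
  have hre : ∀ z ∈ Metric.ball c (3 / 2), 1 / 2 < z.re ∧ 1 < z.im ∧ ‖z‖ ≤ t + 4 := by
    intro z hz
    rw [Metric.mem_ball, dist_eq_norm] at hz
    have h1 := (Complex.abs_re_le_norm (z - c)).trans_lt hz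
    have h2 := (Complex.abs_im_le_norm (z - c)).trans_lt hz
    simp only [hc, Complex.sub_re, Complex.sub_im] at h1 h2
    rw [abs_lt] at h1 h2
    refine ⟨by linarith, by linarith, ?_⟩
    have h3 : ‖c‖ ≤ 2 + t := by
      refine (Complex.norm_le_abs_re_add_abs_im c).trans ?_
      simp [hc, abs_of_nonneg (by linarith : (0 : ℝ) ≤ t)]
    have := norm_le_norm_add_norm_sub' z c
    linarith
  have hne : ∀ z ∈ Metric.ball c (3 / 2), riemannZeta z ≠ 0 := fun z hz ↦
    hRH.riemannZeta_ne_zero (by linarith [(hre z hz).1]) (hre z hz).1.ne'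
  have hdiff : DifferentiableOn ℂ riemannZeta (Metric.ball c (3 / 2)) := by
    intro z hz
    refine (differentiableAt_riemannZeta ?_).differentiableWithinAt
    rintro rfl
    have := (hre 1 hz).2.1
    simp at this
    linarith
  obtain ⟨L, hLd, hLc, hLe⟩ := exists_log_ball hdiff hne (by norm_num)
  have hcre : (3 / 2 : ℝ) ≤ c.re := by simp [hc]; norm_num
  have hcA : ‖L c‖ ≤ A := by
    rw [hLc]
    exact norm_log_le (hDb hcre).1 (hDb hcre).2 (hne c (Metric.mem_ball_self (by norm_num)))
  have hsmall : ∀ z, ‖z - c‖ ≤ 1 / 4 → ‖L z‖ ≤ a := by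
    intro z hz
    have hsub : Metric.ball c (1 / 2) ⊆ Metric.ball c (3 / 2) :=
      Metric.ball_subset_ball (by norm_num)
    refine (norm_log_le_of_norm_le (R := 1 / 2) (M := Real.log D + 1) (by norm_num)
      (by linarith [Real.log_nonneg hD1]) (hLd.mono hsub) (fun z hz ↦ hLe z (hsub hz)) ?_
      (by norm_num : (1 / 4 : ℝ) < 1 / 2) hz).trans ?_
    · intro w hw
      rw [Metric.mem_ball, dist_eq_norm] at hw
      have h1 := (abs_lt.mp ((Complex.abs_re_le_norm (w - c)).trans_lt hw)).1
      simp only [hc, Complex.sub_re] at h1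
      refine (hDb (by linarith)).1.trans ?_
      rw [Real.exp_add, Real.exp_log (by linarith)]
      have : (1 : ℝ) ≤ Real.exp 1 := Real.one_le_exp zero_le_one
      nlinarith
    · rw [ha]
      gcongr
  have hlarge : ∀ z, ‖z - c‖ ≤ r₂ → ‖L z‖ ≤ B * Real.log t := by
    intro z hz
    -- The linear bound for ζ on this disc is at most 27 t, hence at most t⁴ as t ≥ 3; this is M = 4
    -- log t.
    refine (norm_log_le_of_norm_le (R := 3 / 2) (M := 4 * Real.log t) (by norm_num)
      (by linarith) hLd hLe ?_ (by linarith : r₂ < 3 / 2) hz).trans ?_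
    · intro w hw
      obtain ⟨h1, h2, h3⟩ := hre w hw
      have h4 := norm_riemannZeta_le (s := w) (by linarith) (by rw [abs_of_pos] <;> linarith)
      have h5 : ‖w‖ / w.re ≤ 2 * (t + 4) := by
        rw [div_le_iff₀ (by linarith)]
        nlinarith
      have h6 : Real.exp (4 * Real.log t) = t ^ 4 := by
        rw [mul_comm, Real.exp_mul, Real.exp_log (by linarith)]
        norm_cast
      rw [h6]
      have : 27 * t ≤ t ^ 4 := by
        have : (27 : ℝ) ≤ t ^ 3 := by
          calc (27 : ℝ) = 3 ^ 3 := by norm_num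
            _ ≤ t ^ 3 := by gcongr
        nlinarith
      linarith
    · rw [hB, hr2, show (3 / 2 : ℝ) - (3 / 2 - η / 2) = η / 2 by ring, div_mul_eq_mul_div]
      refine div_le_div_of_nonneg_right ?_ (by linarith)
      have := mul_le_mul hcA hlogt zero_le_one hA0.le
      linarith
  have hzc : s - c = ((s.re - 2 : ℝ) : ℂ) := by
    apply Complex.ext <;> simp [hc, ht]
  have hnorm : ‖s - c‖ = 2 - s.re := by
    rw [hzc, Complex.norm_real, Real.norm_eq_abs, abs_of_nonpos (by linarith)]; ring
  have hsb : s ∈ Metric.ball c (3 / 2) := by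
    rw [Metric.mem_ball, dist_eq_norm, hnorm]; linarith
  refine ⟨L s, hLe s hsb, ?_⟩
  by_cases hcase : ‖s - c‖ ≤ 1 / 4
  · refine (hsmall s hcase).trans ?_
    have : 0 ≤ ε * Real.log t + a * κ ^ (-1 / (1 - θ)) := by positivity
    linarith
  · push Not at hcase
    have hsr : ‖s - c‖ ≤ r := by rw [hnorm]; linarith
    have h3 := three_circles hLd (by norm_num : (0 : ℝ) < 1 / 4) (by linarith : 1 / 4 < r₂)
      (by linarith : r₂ < 3 / 2) (fun z hz ↦ hsmall z hz.le) hlarge hcase.le (by linarith)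
    set θ' := (Real.log ‖s - c‖ - Real.log (1 / 4)) / (Real.log r₂ - Real.log (1 / 4)) with hθ'
    have hθθ : θ' ≤ θ := by
      rw [hθ', hθ]
      have := Real.log_le_log (by linarith) hsr
      gcongr
      linarith
    have hθ'0 : 0 ≤ θ' := by
      have := Real.log_le_log (by norm_num) hcase.le
      exact div_nonneg (by linarith) (by linarith)
    have hBt : 1 ≤ B * Real.log t := by nlinarith
    calc ‖L s‖ ≤ _ := h3
      _ ≤ a * (B * Real.log t) ^ θ := by
          gcongr
          · calc a ^ (1 - θ') ≤ a ^ (1 : ℝ) :=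
                  Real.rpow_le_rpow_of_exponent_le ha1 (by linarith)
              _ = a := Real.rpow_one a
      _ ≤ a * (κ * (B * Real.log t) + κ ^ (-1 / (1 - θ))) := by
          gcongr
          exact rpow_le_mul_add hθ1 hκ0 hBt
      _ = ε * Real.log t + a * κ ^ (-1 / (1 - θ)) := by
          rw [hκ]; field_simp
      _ ≤ _ := by linarith

/-- Under the Riemann Hypothesis `ζ(s)` and `1/ζ(s)` are `O(|t|^ε)`, uniformly to the right of
any line `Re s = 1/2 + η`. -/
theorem RiemannHypothesis.norm_riemannZeta_le_rpow (hRH : RiemannHypothesis) {η ε : ℝ} (hη : 0 < η)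
    (hε : 0 < ε) : ∃ C : ℝ, 0 < C ∧ ∀ s : ℂ, 1 / 2 + η ≤ s.re → 3 ≤ |s.im| →
      ‖riemannZeta s‖ ≤ C * |s.im| ^ ε ∧ ‖(riemannZeta s)⁻¹‖ ≤ C * |s.im| ^ ε := by
  obtain ⟨C, hC⟩ := hRH.log_riemannZeta_bound hη hε
  set D := ∑' n : ℕ, 1 / (n : ℝ) ^ (2 : ℝ) with hD
  have hD0 : 0 ≤ D := tsum_nonneg fun n ↦ by positivity
  have hpos : ∀ s : ℂ, 1 / 2 + η ≤ s.re → 3 ≤ s.im →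
      ‖riemannZeta s‖ ≤ (Real.exp C + D) * s.im ^ ε ∧
      ‖(riemannZeta s)⁻¹‖ ≤ (Real.exp C + D) * s.im ^ ε := by
    intro s hs hst
    have ht1 : 1 ≤ s.im ^ ε := Real.one_le_rpow (by linarith) hε.le
    by_cases h2 : s.re ≤ 2
    · obtain ⟨w, hw, hwn⟩ := hC s hs h2 hst
      have hexp : Real.exp (ε * Real.log s.im + C) ≤ (Real.exp C + D) * s.im ^ ε := by
        rw [Real.exp_add, mul_comm ε, Real.exp_mul, Real.exp_log (by linarith), mul_comm]
        gcongr
        linarith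
      rw [← hw, ← Complex.exp_neg, Complex.norm_exp, Complex.norm_exp]
      have h3 := (abs_le.mp (Complex.abs_re_le_norm w))
      constructor
      · exact (Real.exp_le_exp.mpr (by linarith)).trans hexp
      · refine (Real.exp_le_exp.mpr ?_).trans hexp
        rw [Complex.neg_re]; linarith
    · push Not at h2
      have h3 := norm_riemannZeta_le_tsum (by norm_num : (1 : ℝ) < 2) h2.le
      have h4 : D ≤ (Real.exp C + D) * s.im ^ ε := by
        nlinarith [Real.exp_pos C]
      exact ⟨h3.1.trans h4, h3.2.trans h4⟩
  refine ⟨Real.exp C + D, by positivity, fun s hs hst ↦ ?_⟩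
  rcases le_total 0 s.im with h | h
  · rw [abs_of_nonneg h] at hst ⊢
    exact hpos s hs hst
  · rw [abs_of_nonpos h] at hst ⊢
    have := hpos ((starRingEnd ℂ) s) (by simpa using hs) (by simpa using hst)
    rw [riemannZeta_conj, ← map_inv₀, Complex.norm_conj, Complex.norm_conj] at this
    simpa using this

/-! ### The functional equation as a comparison of sizes -/

/-- The integral is cut at 1 - 1/t. Beyond the cut absolute values suffice. Before it one
integration by parts gains 1/|s| ≤ 1/t against the total variation t^(1-a) - 1 of (1-x)^(a-1). Both
pieces have size t^(-a), up to the factor 1/a. -/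
lemma norm_betaIntegral_le {s : ℂ} (hs : 0 < s.re) {t : ℝ} (ht : 2 ≤ t) (hst : t ≤ ‖s‖) {a : ℝ}
    (ha : 0 < a) (ha1 : a ≤ 1) :
    ‖Complex.betaIntegral s a‖ ≤ 4 * t ^ (-a) / a := by
  have ht0 : 0 < t := by linarith
  set b := 1 - 1 / t with hb
  have hb0 : 1 / 2 ≤ b := by
    have : 1 / t ≤ 1 / 2 := by gcongr
    linarith
  have hb1 : b < 1 := by
    have : 0 < 1 / t := by positivity
    linarith
  have h1b : 1 - b = t⁻¹ := by rw [hb]; ring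
  have hs0 : s ≠ 0 := by rintro rfl; simp at hs
  have hspos : 0 < ‖s‖ := norm_pos_iff.mpr hs0
  have hint : IntervalIntegrable (fun x : ℝ ↦ (x : ℂ) ^ (s - 1) * (1 - (x : ℂ)) ^ ((a : ℂ) - 1))
      volume 0 1 := Complex.betaIntegral_convergent hs (by simpa using ha)
  have hI1 : IntervalIntegrable (fun x : ℝ ↦ (x : ℂ) ^ (s - 1) * (1 - (x : ℂ)) ^ ((a : ℂ) - 1))
      volume 0 b := hint.mono_set (by
        rw [uIcc_of_le (by linarith), uIcc_of_le zero_le_one]; exact Icc_subset_Icc le_rfl hb1.le)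
  have hI2 : IntervalIntegrable (fun x : ℝ ↦ (x : ℂ) ^ (s - 1) * (1 - (x : ℂ)) ^ ((a : ℂ) - 1))
      volume b 1 := hint.mono_set (by
        rw [uIcc_of_le hb1.le, uIcc_of_le zero_le_one]; exact Icc_subset_Icc (by linarith) le_rfl)
  have hcast : ∀ x : ℝ, x ≤ 1 → (1 - (x : ℂ)) ^ ((a : ℂ) - 1) = (((1 - x) ^ (a - 1) : ℝ) : ℂ) := by
    intro x hx
    rw [Complex.ofReal_cpow (by linarith)]; simp
  -- the part near `1`
  have hpart1 : ‖∫ x in b..1, (x : ℂ) ^ (s - 1) * (1 - (x : ℂ)) ^ ((a : ℂ) - 1)‖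
      ≤ 2 * t ^ (-a) / a := by
    have hev : ∫ x in b..1, 2 * (1 - x) ^ (a - 1) = 2 * t ^ (-a) / a := by
      rw [intervalIntegral.integral_const_mul,
        intervalIntegral.integral_comp_sub_left (fun x ↦ x ^ (a - 1)) 1, sub_self, h1b,
        integral_rpow (Or.inl (by linarith)), sub_add_cancel, Real.zero_rpow ha.ne', sub_zero,
        Real.inv_rpow ht0.le, Real.rpow_neg ht0.le]
      ring
    rw [← hev]
    refine intervalIntegral.norm_integral_le_of_norm_le hb1.le ?_ ?_
    · refine Eventually.of_forall fun x hx ↦ ?_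
      have hx0 : 0 < x := by linarith [hx.1]
      rw [hcast x hx.2, norm_mul, Complex.norm_cpow_eq_rpow_re_of_pos hx0, Complex.norm_real,
        Real.norm_of_nonneg (Real.rpow_nonneg (by linarith [hx.2]) _)]
      gcongr
      · exact Real.rpow_nonneg (by linarith [hx.2]) _
      · calc x ^ (s - 1).re ≤ x ^ (-1 : ℝ) := by
              refine Real.rpow_le_rpow_of_exponent_ge hx0 hx.2 ?_
              simp only [Complex.sub_re, Complex.one_re]; linarith
          _ = x⁻¹ := Real.rpow_neg_one x
          _ ≤ 2 := by
              rw [inv_le_comm₀ hx0 (by norm_num)]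
              linarith [hx.1]
    · have := (intervalIntegral.intervalIntegrable_rpow' (a := 0) (b := t⁻¹)
        (by linarith : -1 < a - 1)).comp_sub_left 1
      rw [sub_zero, ← h1b, sub_sub_cancel] at this
      exact this.symm.const_mul 2
  -- the main part, by integration by parts
  have hpart2 : ‖∫ x in (0 : ℝ)..b, (x : ℂ) ^ (s - 1) * (1 - (x : ℂ)) ^ ((a : ℂ) - 1)‖
      ≤ 2 * t ^ (-a) := by
    have hIcc : uIcc 0 b = Icc 0 b := uIcc_of_le (by linarith)
    have hud : ∀ x ∈ Icc 0 b, HasDerivAt (fun x : ℝ ↦ (1 - x) ^ (a - 1))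
        ((1 - a) * (1 - x) ^ (a - 2)) x := by
      intro x hx
      have h1 : HasDerivAt (fun x : ℝ ↦ 1 - x) (-1) x := by
        simpa using (hasDerivAt_id x).const_sub 1
      refine (h1.rpow_const (p := a - 1) (Or.inl (by linarith [hx.2]))).congr_deriv ?_
      rw [show a - 1 - 1 = a - 2 by ring]
      ring
    have hu'c : ContinuousOn (fun x : ℝ ↦ (1 - a) * (1 - x) ^ (a - 2)) (Icc 0 b) := by
      intro x hx
      have : ContinuousAt (fun x : ℝ ↦ (1 - x) ^ (a - 2)) x :=
        ContinuousAt.rpow_const (by fun_prop) (Or.inl (by linarith [hx.2]))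
      exact (continuousAt_const.mul this).continuousWithinAt
    have hu'i : IntervalIntegrable (fun x : ℝ ↦ (1 - a) * (1 - x) ^ (a - 2)) volume 0 b :=
      ContinuousOn.intervalIntegrable (hIcc ▸ hu'c)
    have hFTC : ∫ x in (0 : ℝ)..b, (1 - a) * (1 - x) ^ (a - 2) = t ^ (1 - a) - 1 := by
      rw [intervalIntegral.integral_eq_sub_of_hasDerivAt (fun x hx ↦ hud x (hIcc ▸ hx)) hu'i, h1b]
      rw [Real.inv_rpow ht0.le, ← Real.rpow_neg ht0.le]
      simp
    have hparts := intervalIntegral.integral_mul_deriv_eq_deriv_mul_of_hasDeriv_right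
      (a := 0) (b := b) (u := fun x : ℝ ↦ (((1 - x) ^ (a - 1) : ℝ) : ℂ))
      (u' := fun x : ℝ ↦ (((1 - a) * (1 - x) ^ (a - 2) : ℝ) : ℂ))
      (v := fun x : ℝ ↦ (x : ℂ) ^ s / s) (v' := fun x : ℝ ↦ (x : ℂ) ^ (s - 1)) ?_ ?_ ?_ ?_ ?_ ?_
    · have heq : ∫ x in (0 : ℝ)..b, (x : ℂ) ^ (s - 1) * (1 - (x : ℂ)) ^ ((a : ℂ) - 1)
          = ∫ x in (0 : ℝ)..b, (((1 - x) ^ (a - 1) : ℝ) : ℂ) * (x : ℂ) ^ (s - 1) := by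
        refine intervalIntegral.integral_congr fun x hx ↦ ?_
        rw [hIcc] at hx
        rw [hcast x (by linarith [hx.2]), mul_comm]
      have hv : ∀ x ∈ Ioc 0 b, ‖(x : ℂ) ^ s / s‖ ≤ t⁻¹ := by
        intro x hx
        rw [norm_div, Complex.norm_cpow_eq_rpow_re_of_pos hx.1, ← one_div]
        have : x ^ s.re ≤ 1 := Real.rpow_le_one hx.1.le (by linarith [hx.2]) hs.le
        gcongr
      have htpow : t ^ (1 - a) * t⁻¹ = t ^ (-a) := by
        rw [← Real.rpow_neg_one t, ← Real.rpow_add ht0]; ring_nf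
      rw [heq, hparts]
      simp only [Complex.ofReal_zero, Complex.zero_cpow hs0, zero_div, mul_zero, sub_zero]
      refine (norm_sub_le _ _).trans ?_
      have hA : ‖(((1 - b) ^ (a - 1) : ℝ) : ℂ) * ((b : ℂ) ^ s / s)‖ ≤ t ^ (-a) := by
        rw [norm_mul, Complex.norm_real, Real.norm_of_nonneg (Real.rpow_nonneg (by linarith) _),
          h1b, Real.inv_rpow ht0.le, ← Real.rpow_neg ht0.le, neg_sub, ← htpow]
        gcongr
        exact hv b ⟨by linarith, le_rfl⟩
      have hB : ‖∫ x in (0 : ℝ)..b, (((1 - a) * (1 - x) ^ (a - 2) : ℝ) : ℂ) * ((x : ℂ) ^ s / s)‖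
          ≤ t ^ (-a) := by
        calc _ ≤ ∫ x in (0 : ℝ)..b, (1 - a) * (1 - x) ^ (a - 2) * t⁻¹ := by
              refine intervalIntegral.norm_integral_le_of_norm_le (by linarith) ?_
                (hu'i.mul_const _)
              refine Eventually.of_forall fun x hx ↦ ?_
              have h1 : 0 ≤ (1 - a) * (1 - x) ^ (a - 2) :=
                mul_nonneg (by linarith) (Real.rpow_nonneg (by linarith [hx.2]) _)
              rw [norm_mul, Complex.norm_real, Real.norm_of_nonneg h1]
              exact mul_le_mul_of_nonneg_left (hv x hx) h1
          _ = (t ^ (1 - a) - 1) * t⁻¹ := by rw [intervalIntegral.integral_mul_const, hFTC]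
          _ ≤ t ^ (1 - a) * t⁻¹ := by
              have := inv_pos.mpr ht0
              nlinarith
          _ = _ := htpow
      linarith
    · rw [hIcc]
      exact Complex.continuous_ofReal.comp_continuousOn
        fun x hx ↦ (hud x hx).continuousAt.continuousWithinAt
    · refine Continuous.continuousOn ?_
      exact (Complex.continuous_ofReal_cpow_const hs).div_const s
    · intro x hx
      rw [min_eq_left (by linarith), max_eq_right (by linarith)] at hx
      exact (hud x (Ioo_subset_Icc_self hx)).ofReal_comp.hasDerivWithinAt
    · intro x hx
      rw [min_eq_left (by linarith), max_eq_right (by linarith)] at hx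
      have := (hasDerivAt_ofReal_cpow_const (x := x) (r := s) hx.1.ne' hs0).div_const s
      rw [mul_div_cancel_left₀ _ hs0] at this
      exact this.hasDerivWithinAt
    · exact ContinuousOn.intervalIntegrable
        (Complex.continuous_ofReal.comp_continuousOn (hIcc ▸ hu'c))
    · exact intervalIntegral.intervalIntegrable_cpow' (by simpa using hs)
  rw [Complex.betaIntegral, ← intervalIntegral.integral_add_adjacent_intervals hI1 hI2]
  refine (norm_add_le _ _).trans ((add_le_add hpart2 hpart1).trans ?_)
  have : 2 * t ^ (-a) ≤ 2 * t ^ (-a) / a := by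
    rw [le_div_iff₀ ha]
    have : 0 < t ^ (-a) := Real.rpow_pos_of_pos ht0 _
    nlinarith
  calc _ ≤ 2 * t ^ (-a) / a + 2 * t ^ (-a) / a := by linarith
    _ = _ := by ring

/-- A substitute for Stirling's formula from Γ(s) Γ(a) = Γ(s+a) B(s, a). The factor 1/a in the bound
for the beta integral is absorbed by a Γ(a) = Γ(a+1), which is bounded below, so the constant is
uniform as a tends to 0. -/
lemma exists_norm_Gamma_le : ∃ C : ℝ, 0 < C ∧ ∀ (s : ℂ) (a : ℝ), 0 < s.re → 2 ≤ |s.im| →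
    0 ≤ a → a ≤ 1 → ‖Complex.Gamma s‖ ≤ C * |s.im| ^ (-a) * ‖Complex.Gamma (s + a)‖ := by
  obtain ⟨x₀, hx₀, hmin⟩ := (isCompact_Icc (a := (1 : ℝ)) (b := 2)).exists_isMinOn
    (nonempty_Icc.mpr (by norm_num)) (f := Real.Gamma) (fun x hx ↦
      (Real.differentiableAt_Gamma fun m ↦ by
        have := hx.1; have hm : (0 : ℝ) ≤ m := Nat.cast_nonneg m
        intro h; linarith).continuousAt.continuousWithinAt)
  have hm : 0 < Real.Gamma x₀ := Real.Gamma_pos_of_pos (by linarith [hx₀.1])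
  refine ⟨max 1 (4 / Real.Gamma x₀), by positivity, fun s a hs ht ha ha1 ↦ ?_⟩
  rcases ha.eq_or_lt with rfl | ha0
  · simp only [neg_zero, Real.rpow_zero, mul_one, Complex.ofReal_zero, add_zero]
    exact le_mul_of_one_le_left (norm_nonneg _) (le_max_left _ _)
  have hG : 0 < Real.Gamma a := Real.Gamma_pos_of_pos ha0
  have hmul := congrArg norm
    (Complex.Gamma_mul_Gamma_eq_betaIntegral hs (t := a) (by simpa using ha0))
  rw [norm_mul, norm_mul, Complex.Gamma_ofReal, Complex.norm_real, Real.norm_of_nonneg hG.le]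
    at hmul
  have hB := norm_betaIntegral_le hs ht (Complex.abs_im_le_norm s) ha0 ha1
  have haG : Real.Gamma x₀ ≤ a * Real.Gamma a := by
    rw [← Real.Gamma_add_one ha0.ne']
    exact hmin ⟨by linarith, by linarith⟩
  have htp : 0 < |s.im| ^ (-a) := Real.rpow_pos_of_pos (by linarith) _
  have h1 : ‖Complex.Gamma s‖ * Real.Gamma a ≤
      ‖Complex.Gamma (s + a)‖ * (4 * |s.im| ^ (-a) / a) := by
    rw [hmul]; gcongr
  calc ‖Complex.Gamma s‖ = ‖Complex.Gamma s‖ * Real.Gamma a / Real.Gamma a := by field_simp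
    _ ≤ ‖Complex.Gamma (s + a)‖ * (4 * |s.im| ^ (-a) / a) / Real.Gamma a := by gcongr
    _ = 4 / (a * Real.Gamma a) * |s.im| ^ (-a) * ‖Complex.Gamma (s + a)‖ := by field_simp
    _ ≤ 4 / Real.Gamma x₀ * |s.im| ^ (-a) * ‖Complex.Gamma (s + a)‖ := by gcongr
    _ ≤ _ := by gcongr; exact le_max_right _ _

lemma norm_Gamma_one_half_add_sq (t : ℝ) :
    ‖Complex.Gamma (1 / 2 + t * I)‖ ^ 2 = Real.pi / Real.cosh (Real.pi * t) := by
  have h := Complex.Gamma_mul_Gamma_one_sub (1 / 2 + t * I)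
  have hc : (1 : ℂ) - (1 / 2 + t * I) = (starRingEnd ℂ) (1 / 2 + t * I) := by
    apply Complex.ext <;> simp; norm_num
  rw [hc, Complex.Gamma_conj, Complex.mul_conj, Complex.normSq_eq_norm_sq] at h
  have hsin : Complex.sin (Real.pi * (1 / 2 + t * I)) = ((Real.cosh (Real.pi * t) : ℝ) : ℂ) := by
    rw [show (Real.pi : ℂ) * (1 / 2 + t * I) = ((Real.pi * t : ℝ) : ℂ) * I + Real.pi / 2 by
      push_cast; ring, Complex.sin_add_pi_div_two, Complex.cos_mul_I, Complex.ofReal_cosh]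
  rw [hsin] at h
  exact_mod_cast h

lemma norm_cos_le_cosh (z : ℂ) : ‖Complex.cos z‖ ≤ Real.cosh z.im ∧
    |Real.sinh z.im| ≤ ‖Complex.cos z‖ := by
  have h1 : ‖Complex.exp (z * I)‖ = Real.exp (-z.im) := by rw [Complex.norm_exp]; simp
  have h2 : ‖Complex.exp (-z * I)‖ = Real.exp z.im := by rw [Complex.norm_exp]; simp
  rw [Complex.cos, norm_div, Complex.norm_ofNat, Real.cosh_eq, Real.sinh_eq, abs_div,
    abs_of_pos (by norm_num : (0 : ℝ) < 2)]
  constructor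
  · gcongr
    refine (norm_add_le _ _).trans ?_
    rw [h1, h2]; linarith
  · gcongr
    have := abs_norm_sub_norm_le (Complex.exp (-z * I)) (-Complex.exp (z * I))
    rw [norm_neg, h1, h2, sub_neg_eq_add, add_comm] at this
    exact this

lemma two_le_cosh_pi_mul {τ : ℝ} (hτ : 2 ≤ |τ|) : 2 ≤ Real.cosh (Real.pi * τ) := by
  rw [← Real.cosh_abs, abs_mul, abs_of_pos Real.pi_pos, Real.cosh_eq]
  have h1 : 6 ≤ Real.pi * |τ| := by nlinarith [Real.pi_gt_three]
  have h2 := Real.add_one_le_exp (Real.pi * |τ|)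
  have h3 := Real.exp_pos (-(Real.pi * |τ|))
  linarith

/-- The squared modulus of the cosine lies between sinh² and cosh² of πτ/2, whatever Re w is. As
cosh(πτ) ≥ 2, both bounds are comparable with cosh(πτ), which cancels the decay of |Γ|². -/
lemma norm_Gamma_mul_cos_bounds {τ : ℝ} (hτ : 2 ≤ |τ|) {w : ℂ} (hw : w.im = Real.pi * τ / 2) :
    ‖Complex.Gamma (1 / 2 + τ * I)‖ * ‖Complex.cos w‖ ≤ 2 ∧
      1 / 2 ≤ ‖Complex.Gamma (1 / 2 + τ * I)‖ * ‖Complex.cos w‖ := by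
  set G := ‖Complex.Gamma (1 / 2 + τ * I)‖
  set K := ‖Complex.cos w‖
  have hG : G ^ 2 = Real.pi / Real.cosh (Real.pi * τ) := norm_Gamma_one_half_add_sq τ
  have hc2 := two_le_cosh_pi_mul hτ
  obtain ⟨hK1, hK2⟩ := norm_cos_le_cosh w
  rw [hw] at hK1 hK2
  have h2 : Real.cosh (Real.pi * τ) =
      Real.cosh (Real.pi * τ / 2) ^ 2 + Real.sinh (Real.pi * τ / 2) ^ 2 := by
    rw [← Real.cosh_two_mul]; ring_nf
  have h3 := Real.cosh_sq (Real.pi * τ / 2)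
  have hKu : K ^ 2 ≤ Real.cosh (Real.pi * τ) := by
    have := pow_le_pow_left₀ (norm_nonneg _) hK1 2
    nlinarith [sq_nonneg (Real.sinh (Real.pi * τ / 2))]
  have hKl : Real.cosh (Real.pi * τ) / 4 ≤ K ^ 2 := by
    have := pow_le_pow_left₀ (abs_nonneg _) hK2 2
    rw [sq_abs] at this
    linarith
  have hGK : (G * K) ^ 2 = Real.pi / Real.cosh (Real.pi * τ) * K ^ 2 := by rw [mul_pow, hG]
  have hpos : 0 ≤ Real.pi / Real.cosh (Real.pi * τ) := by positivity
  have hcpos : 0 < Real.cosh (Real.pi * τ) := by linarith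
  have hu : (G * K) ^ 2 ≤ 2 ^ 2 := by
    rw [hGK]
    calc _ ≤ Real.pi / Real.cosh (Real.pi * τ) * Real.cosh (Real.pi * τ) := by gcongr
      _ = Real.pi := by field_simp
      _ ≤ 2 ^ 2 := by linarith [Real.pi_le_four]
  have hl : (1 / 2) ^ 2 ≤ (G * K) ^ 2 := by
    rw [hGK]
    calc (1 / 2 : ℝ) ^ 2 ≤ Real.pi / 4 := by linarith [Real.pi_gt_three]
      _ = Real.pi / Real.cosh (Real.pi * τ) * (Real.cosh (Real.pi * τ) / 4) := by field_simp
      _ ≤ _ := by gcongr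
  have hnn : 0 ≤ G * K := by positivity
  exact ⟨le_of_sq_le_sq hu (by norm_num), le_of_sq_le_sq hl hnn⟩

/-- The functional equation, as a comparison of absolute values. -/
theorem exists_norm_riemannZeta_one_sub_bounds : ∃ C : ℝ, 0 < C ∧ ∀ s : ℂ, 0 ≤ s.re →
    s.re ≤ 1 / 2 → 2 ≤ |s.im| →
    ‖riemannZeta s‖ ≤ C * |s.im| ^ (1 / 2 - s.re) * ‖riemannZeta (1 - s)‖ ∧
    |s.im| ^ (1 / 2 - s.re) * ‖riemannZeta (1 - s)‖ ≤ C * ‖riemannZeta s‖ := by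
  obtain ⟨C, hC, hΓ⟩ := exists_norm_Gamma_le
  refine ⟨8 * C, by positivity, fun s hs0 hs1 ht ↦ ?_⟩
  set T := |s.im| with hT
  set a := 1 / 2 - s.re with ha
  set τ := -s.im with hτ
  have hτT : |τ| = T := by rw [hτ, abs_neg]
  have hT0 : 0 < T := by linarith
  have hz : (1 : ℂ) - s = (1 / 2 + τ * I) + a := by
    apply Complex.ext <;> simp [ha, hτ]
    ring
  have hwre : (1 / 2 + τ * I : ℂ).re = 1 / 2 := by simp
  have hwim : (1 / 2 + τ * I : ℂ).im = τ := by simp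
  have hTa : 0 < T ^ a := Real.rpow_pos_of_pos hT0 _
  -- lower and upper bounds for the Gamma factor
  have hlow := hΓ (1 / 2 + τ * I) a (by rw [hwre]; norm_num) (by rw [hwim, hτT]; exact ht)
    (by linarith) (by linarith)
  rw [← hz, hwim, hτT] at hlow
  -- Raising 1 - s by 1 - a lands at 3/2 + iτ, and the recursion for Γ leads back to 1/2 + iτ. The
  -- same comparison, used with a and with 1 - a, thus bounds |Γ(1 - s)| from both sides.
  have hup := hΓ (1 - s) (1 - a) (by simp; linarith) (by simpa using ht)
    (by linarith) (by linarith)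
  have him1 : |(1 - s).im| = T := by simp [hT]
  have hsum : (1 - s) + ((1 - a : ℝ) : ℂ) = (1 / 2 + τ * I) + 1 := by rw [hz]; push_cast; ring
  have hne : (1 / 2 + τ * I : ℂ) ≠ 0 := by
    intro h; have := congrArg Complex.re h; simp at this
  rw [him1, hsum, Complex.Gamma_add_one _ hne, norm_mul, neg_sub] at hup
  have hnorm : ‖(1 / 2 + τ * I : ℂ)‖ ≤ 2 * T := by
    refine (norm_add_le _ _).trans ?_
    simp only [norm_mul, Complex.norm_I, Complex.norm_real, Real.norm_eq_abs, hτT, mul_one]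
    norm_num
    linarith
  set G := ‖Complex.Gamma (1 / 2 + τ * I)‖ with hG
  set Γz := ‖Complex.Gamma (1 - s)‖ with hΓz
  have hup' : Γz ≤ 2 * C * T ^ a * G := by
    calc Γz ≤ C * T ^ (a - 1) * (2 * T * G) := by
          refine hup.trans ?_; gcongr
      _ = 2 * C * (T ^ (a - 1) * T) * G := by ring
      _ = 2 * C * T ^ a * G := by rw [Real.rpow_sub_one hT0.ne']; field_simp
  have hlow' : T ^ a * G ≤ C * Γz := by
    calc T ^ a * G ≤ T ^ a * (C * T ^ (-a) * Γz) := by gcongr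
      _ = C * Γz * (T ^ a * T ^ (-a)) := by ring
      _ = C * Γz := by rw [← Real.rpow_add hT0]; simp
  have hcos := norm_Gamma_mul_cos_bounds (τ := τ) (by rw [hτT]; exact ht)
    (w := Real.pi * (1 - s) / 2) (by
      rw [show (Real.pi : ℂ) * (1 - s) / 2 = ((Real.pi / 2 : ℝ) : ℂ) * (1 - s) by push_cast; ring,
        Complex.im_ofReal_mul, Complex.sub_im, Complex.one_im, hτ]
      ring)
  rw [← hG] at hcos
  set K := ‖Complex.cos (Real.pi * (1 - s) / 2)‖ with hK
  have hfe := riemannZeta_one_sub (s := 1 - s) ?_ ?_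
  · rw [sub_sub_cancel] at hfe
    have hfe' := congrArg norm hfe
    have hpi : ‖(2 * (Real.pi : ℂ)) ^ (-(1 - s))‖ = (2 * Real.pi) ^ (-(1 - s.re)) := by
      rw [show (2 * (Real.pi : ℂ)) = ((2 * Real.pi : ℝ) : ℂ) by push_cast; ring,
        Complex.norm_cpow_eq_rpow_re_of_pos (by positivity)]
      simp
    rw [norm_mul, norm_mul, norm_mul, norm_mul, hpi, Complex.norm_ofNat, ← hΓz, ← hK] at hfe'
    set P := (2 * Real.pi) ^ (-(1 - s.re)) with hP
    have h2pi : (1 : ℝ) ≤ 2 * Real.pi := by linarith [Real.pi_gt_three]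
    have hP1 : P ≤ 1 := Real.rpow_le_one_of_one_le_of_nonpos h2pi (by linarith)
    have hP2 : 1 / 8 ≤ P := by
      calc (1 : ℝ) / 8 ≤ (2 * Real.pi)⁻¹ := by
            rw [one_div]; gcongr; linarith [Real.pi_le_four]
        _ = (2 * Real.pi) ^ (-1 : ℝ) := (Real.rpow_neg_one _).symm
        _ ≤ P := Real.rpow_le_rpow_of_exponent_le h2pi (by linarith)
    set Z := ‖riemannZeta (1 - s)‖ with hZ
    have hZ0 : 0 ≤ Z := norm_nonneg _
    have hK0 : 0 ≤ K := norm_nonneg _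
    have hΓ0 : 0 ≤ Γz := norm_nonneg _
    rw [hfe']
    constructor
    · calc 2 * P * Γz * K * Z ≤ 2 * 1 * (2 * C * T ^ a * G) * K * Z := by gcongr
        _ = 4 * C * T ^ a * (G * K) * Z := by ring
        _ ≤ 4 * C * T ^ a * 2 * Z := by gcongr; exact hcos.1
        _ = _ := by ring
    · calc T ^ a * Z = 2 * (T ^ a * (1 / 2) * Z) := by ring
        _ ≤ 2 * (T ^ a * (G * K) * Z) := by gcongr; exact hcos.2
        _ = 2 * ((T ^ a * G) * K * Z) := by ring
        _ ≤ 2 * ((C * Γz) * K * Z) := by gcongr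
        _ = 8 * C * (2 * (1 / 8) * Γz * K * Z) := by ring
        _ ≤ 8 * C * (2 * P * Γz * K * Z) := by gcongr
  · intro n h
    have := congrArg Complex.im h
    simp at this
    rw [this] at hT
    simp at hT
    linarith
  · intro h
    have := congrArg Complex.im h
    simp at this
    rw [this] at hT
    simp at hT
    linarith

/-! ### k-free numbers and the Mellin transform of M_k -/

lemma muK_nonneg (k n : ℕ) : 0 ≤ muK k n := by unfold muK; split_ifs <;> norm_num

lemma muK_le_one (k n : ℕ) : muK k n ≤ 1 := by unfold muK; split_ifs <;> norm_num

lemma muK_zero (k : ℕ) : muK k 0 = 0 := by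
  rw [muK, if_neg]
  exact fun h ↦ h 2 Nat.prime_two (dvd_zero _)

lemma muK_one {k : ℕ} (hk : k ≠ 0) : muK k 1 = 1 := by
  rw [muK, if_pos]
  intro p hp h
  have := (Nat.pow_eq_one.mp (Nat.dvd_one.mp h)).resolve_right hk
  exact hp.one_lt.ne' this

lemma isKFree_mul {k m n : ℕ} (hk : k ≠ 0) (h : m.Coprime n) :
    IsKFree k (m * n) ↔ IsKFree k m ∧ IsKFree k n := by
  constructor
  · exact fun H ↦ ⟨fun p hp hd ↦ H p hp (hd.mul_right n), fun p hp hd ↦ H p hp (hd.mul_left m)⟩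
  · rintro ⟨H1, H2⟩ p hp hd
    rcases (h.isPrimePow_dvd_mul (hp.isPrimePow.pow hk)).mp hd with h | h
    exacts [H1 p hp h, H2 p hp h]

lemma muK_mul {k m n : ℕ} (hk : k ≠ 0) (h : m.Coprime n) : muK k (m * n) = muK k m * muK k n := by
  unfold muK
  have := isKFree_mul hk h
  split_ifs <;> simp_all

lemma re_natCast_mul (k : ℕ) (s : ℂ) : ((k : ℂ) * s).re = k * s.re := by simp

lemma muK_prime_pow {k p : ℕ} (hk : k ≠ 0) (hp : p.Prime) (e : ℕ) :
    muK k (p ^ e) = if e < k then 1 else 0 := by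
  have : IsKFree k (p ^ e) ↔ e < k := ?_
  · unfold muK; simp only [this]
  constructor
  · intro H
    by_contra hlt
    exact H p hp (pow_dvd_pow p (not_lt.mp hlt))
  · intro hlt q hq hd
    have hqp : q = p :=
      (Nat.prime_dvd_prime_iff_eq hq hp).mp (hq.dvd_of_dvd_pow ((dvd_pow_self q hk).trans hd))
    rw [hqp, Nat.pow_dvd_pow_iff_le_right hp.one_lt] at hd
    exact absurd hlt (not_lt.mpr hd)

/-- Euler products: with x = p^(-s) the factor at p is 1 + x + ... + x^(k-1) = (1 - x^k)/(1 - x). -/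
lemma LSeries_muK_mul {k : ℕ} (hk : k ≠ 0) {s : ℂ} (hs : 1 < s.re) :
    LSeries (fun n ↦ (muK k n : ℂ)) s * riemannZeta (k * s) = riemannZeta s := by
  have hs0 : s ≠ 0 := by rintro rfl; simp at hs; linarith
  have hk1 : (1 : ℝ) ≤ k := by exact_mod_cast Nat.one_le_iff_ne_zero.mpr hk
  have hks : 1 < (k * s).re := by
    rw [re_natCast_mul]; nlinarith
  set f : ℕ → ℂ := fun n ↦ (muK k n : ℂ) * (n : ℂ) ^ (-s) with hf
  have hsum : Summable (‖f ·‖) := by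
    refine Summable.of_nonneg_of_le (fun _ ↦ norm_nonneg _) (fun n ↦ ?_)
      (summable_riemannZetaSummand hs)
    rw [hf, norm_mul]
    refine mul_le_of_le_one_left (norm_nonneg _) ?_
    rw [Complex.norm_real, Real.norm_of_nonneg (muK_nonneg k n)]
    exact muK_le_one k n
  have hprod := EulerProduct.eulerProduct_hasProd (f := f) (by simp [hf, muK_one hk])
    (fun {m n} h ↦ by
      simp only [hf, muK_mul hk h, Nat.cast_mul, Complex.ofReal_mul]
      rw [Complex.natCast_mul_natCast_cpow]; ring) hsum (by simp [hf, muK_zero])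
  have hL : ∑' n, f n = LSeries (fun n ↦ (muK k n : ℂ)) s := by
    rw [LSeries]
    refine tsum_congr fun n ↦ ?_
    rcases eq_or_ne n 0 with rfl | hn
    · simp [hf, muK_zero]
    · rw [LSeries.term_of_ne_zero hn, div_eq_mul_inv, ← Complex.cpow_neg]
  rw [hL] at hprod
  have hmul := hprod.mul (riemannZeta_eulerProduct_hasProd hks)
  refine hmul.unique ?_
  convert riemannZeta_eulerProduct_hasProd hs using 2 with p
  set x : ℂ := (p : ℂ) ^ (-s) with hx
  have hxn : ‖x‖ < 1 := by
    rw [hx, Complex.norm_natCast_cpow_of_pos p.prop.pos, Complex.neg_re]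
    exact Real.rpow_lt_one_of_one_lt_of_neg (by exact_mod_cast p.prop.one_lt) (by linarith)
  have hx1 : 1 - x ≠ 0 := by
    intro h
    rw [← sub_eq_zero.mp h] at hxn
    simp at hxn
  have hxk : 1 - x ^ k ≠ 0 := by
    intro h
    have h2 : ‖x ^ k‖ < 1 := by rw [norm_pow]; exact pow_lt_one₀ (norm_nonneg _) hxn hk
    rw [← sub_eq_zero.mp h] at h2
    simp at h2
  have hpk : (p : ℂ) ^ (-(k * s)) = x ^ k := by
    rw [hx, ← Complex.cpow_nat_mul]; ring_nf
  have hterm : ∀ e : ℕ, f ((p : ℕ) ^ e) = if e < k then x ^ e else 0 := by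
    intro e
    rw [hf]
    simp only [muK_prime_pow hk p.prop]
    split_ifs
    · rw [hx, Nat.cast_pow, ← Complex.natCast_cpow_natCast_mul]
      rw [← Complex.cpow_nat_mul]; simp
    · simp
  have hsumk : ∑' e, f ((p : ℕ) ^ e) = ∑ e ∈ Finset.range k, x ^ e := by
    rw [tsum_eq_sum (s := Finset.range k)]
    · exact Finset.sum_congr rfl fun e he ↦ by rw [hterm, if_pos (Finset.mem_range.mp he)]
    · intro e he
      rw [hterm, if_neg (by simpa using he)]
  rw [hsumk, hpk]
  have hgeom := mul_neg_geom_sum x k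
  field_simp
  linear_combination hgeom

lemma riemannZeta_natCast_re {k : ℕ} : ((riemannZeta k).re : ℂ) = riemannZeta k := by
  have := riemannZeta_conj (k : ℂ)
  rw [Complex.conj_natCast] at this
  exact Complex.conj_eq_iff_re.mp this.symm

lemma measurable_kFreeCount (k : ℕ) : Measurable (kFreeCount k) :=
  (measurable_from_nat (f := fun N ↦ ∑ n ∈ Finset.Icc 1 N, muK k n)).comp Nat.measurable_floor

lemma measurable_errM (k : ℕ) : Measurable (errM k) :=
  (measurable_kFreeCount k).sub (measurable_id.div_const _)

lemma kFreeCount_nonneg (k : ℕ) (x : ℝ) : 0 ≤ kFreeCount k x :=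
  Finset.sum_nonneg fun n _ ↦ muK_nonneg k n

lemma kFreeCount_le (k : ℕ) {x : ℝ} (hx : 0 ≤ x) : kFreeCount k x ≤ x := by
  calc kFreeCount k x ≤ ∑ n ∈ Finset.Icc 1 ⌊x⌋₊, (1 : ℝ) :=
        Finset.sum_le_sum fun n _ ↦ muK_le_one k n
    _ = ⌊x⌋₊ := by simp
    _ ≤ x := Nat.floor_le hx

/-- The constant in the trivial bound for `errM`. -/
def errMConst (k : ℕ) : ℝ := 1 + |(riemannZeta k).re|⁻¹

lemma abs_errM_le (k : ℕ) {x : ℝ} (hx : 0 ≤ x) : |errM k x| ≤ errMConst k * x := by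
  refine (abs_sub _ _).trans ?_
  rw [abs_of_nonneg (kFreeCount_nonneg k x), abs_div, abs_of_nonneg hx, errMConst, add_mul, one_mul,
    div_eq_inv_mul]
  gcongr
  exact kFreeCount_le k hx

lemma tailMellin_kFreeCount {k : ℕ} (hk : k ≠ 0) {s : ℂ} (hs : 1 < s.re) :
    tailMellin (kFreeCount k) s = riemannZeta s / (s * riemannZeta (k * s)) := by
  have hs0 : s ≠ 0 := by rintro rfl; simp at hs; linarith
  have hk1 : (1 : ℝ) ≤ k := by exact_mod_cast Nat.one_le_iff_ne_zero.mpr hk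
  have hks : 1 ≤ (k * s).re := by rw [re_natCast_mul]; nlinarith
  have hz := riemannZeta_ne_zero_of_one_le_re hks
  have hO : (fun n : ℕ ↦ ∑ j ∈ Finset.Icc 1 n, muK k j) =O[atTop] fun n ↦ (n : ℝ) ^ (1 : ℝ) := by
    refine Asymptotics.isBigO_of_le _ fun n ↦ ?_
    rw [Real.norm_of_nonneg (Finset.sum_nonneg fun j _ ↦ muK_nonneg k j), Real.rpow_one]
    simpa [kFreeCount] using kFreeCount_le k (Nat.cast_nonneg (α := ℝ) n)
  have h := LSeries_eq_mul_integral_of_nonneg (muK k) zero_le_one hs hO (muK_nonneg k)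
  have h2 : tailMellin (kFreeCount k) s = ∫ t in Ioi (1 : ℝ),
      (∑ j ∈ Finset.Icc 1 ⌊t⌋₊, (muK k j : ℂ)) * (t : ℂ) ^ (-(s + 1)) := by
    simp only [tailMellin, kFreeCount, Complex.ofReal_sum]
  rw [← h2] at h
  have h3 := LSeries_muK_mul hk hs
  rw [h] at h3
  rw [← h3, eq_div_iff (mul_ne_zero hs0 hz)]
  ring

/-- Partial summation for the k-free count, minus the transform of x/ζ(k). The subtracted term
cancels the pole of ζ(s)/(s ζ(ks)) at 1. -/
lemma tailMellin_errM {k : ℕ} (hk : k ≠ 0) {s : ℂ} (hs : 1 < s.re) :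
    tailMellin (errM k) s = riemannZeta s / (s * riemannZeta (k * s)) -
      1 / (riemannZeta k * (s - 1)) := by
  rw [← tailMellin_kFreeCount hk hs, one_div, mul_inv, ← one_div (s - 1), ← tailMellin_id hs]
  rw [tailMellin, tailMellin, tailMellin, ← integral_const_mul, ← integral_sub]
  · refine setIntegral_congr_fun measurableSet_Ioi fun x _ ↦ ?_
    simp only [errM]
    rw [Complex.ofReal_sub, Complex.ofReal_div, riemannZeta_natCast_re]
    ring
  · refine integrableOn_tailMellin (measurable_kFreeCount k) ?_
    refine integrableOn_of_abs_le_rpow (C := 1) (r := 1) (measurable_kFreeCount k) (fun x hx ↦ ?_) hs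
    rw [abs_of_nonneg (kFreeCount_nonneg k x), Real.rpow_one, one_mul]
    exact kFreeCount_le k (by linarith)
  · refine Integrable.const_mul ?_ _
    refine integrableOn_tailMellin measurable_id ?_
    exact integrableOn_of_abs_le_rpow (C := 1) (r := 1) measurable_id (fun x hx ↦ by
      rw [abs_of_pos (by simpa using zero_lt_one.trans hx)]; simp) hs

/-! ### The mean square bound implies the bound for J_{-1} -/

/-- Positivity of `‖u - ∑ b_i v_i‖²` in `L²`, written with integrals. -/
lemma two_mul_re_sum_integral_le {α ι : Type*} [MeasurableSpace α] {μ : Measure α} (S : Finset ι)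
    {u : α → ℂ} {v : ι → α → ℂ} (b : ι → ℂ) (hu : MemLp u 2 μ) (hv : ∀ i, MemLp (v i) 2 μ) :
    2 * (∑ i ∈ S, conj (b i) * ∫ x, u x * conj (v i x) ∂μ).re ≤
      ∫ x, ‖u x‖ ^ 2 ∂μ +
        (∑ i ∈ S, ∑ j ∈ S, conj (b i) * b j * ∫ x, v j x * conj (v i x) ∂μ).re := by
  set U := hu.toLp u
  set V := fun i ↦ (hv i).toLp (v i)
  have hUV : ∀ i, inner ℂ (V i) U = ∫ x, u x * conj (v i x) ∂μ := by
    intro i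
    rw [L2.inner_def]
    refine integral_congr_ae ?_
    filter_upwards [hu.coeFn_toLp, (hv i).coeFn_toLp] with x h1 h2
    rw [h1, h2, RCLike.inner_apply]
  have hVV : ∀ i j, inner ℂ (V i) (V j) = ∫ x, v j x * conj (v i x) ∂μ := by
    intro i j
    rw [L2.inner_def]
    refine integral_congr_ae ?_
    filter_upwards [(hv j).coeFn_toLp, (hv i).coeFn_toLp] with x h1 h2
    rw [h1, h2, RCLike.inner_apply]
  have hUU : ‖U‖ ^ 2 = ∫ x, ‖u x‖ ^ 2 ∂μ := by
    have h1 : (inner ℂ U U : ℂ) = ((∫ x, ‖u x‖ ^ 2 ∂μ : ℝ) : ℂ) := by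
      rw [L2.inner_def, ← integral_complex_ofReal]
      refine integral_congr_ae ?_
      filter_upwards [hu.coeFn_toLp] with x h1
      rw [h1, inner_self_eq_norm_sq_to_K]; simp
    rw [← inner_self_eq_norm_sq (𝕜 := ℂ), h1]
    simp
  have key := @norm_sub_sq ℂ _ _ _ _ U (∑ i ∈ S, b i • V i)
  have hcross : RCLike.re (inner ℂ U (∑ i ∈ S, b i • V i)) =
      (∑ i ∈ S, conj (b i) * ∫ x, u x * conj (v i x) ∂μ).re := by
    rw [← inner_conj_symm, RCLike.conj_re, sum_inner]
    simp only [inner_smul_left, hUV]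
    rfl
  have hsq : ‖∑ i ∈ S, b i • V i‖ ^ 2 =
      (∑ i ∈ S, ∑ j ∈ S, conj (b i) * b j * ∫ x, v j x * conj (v i x) ∂μ).re := by
    rw [← inner_self_eq_norm_sq (𝕜 := ℂ), sum_inner]
    simp only [inner_smul_left, inner_sum, inner_smul_right, hVV]
    exact congrArg Complex.re
      (Finset.sum_congr rfl fun i _ ↦ Finset.sum_congr rfl fun j _ ↦ by ring)
  rw [hcross, hsq, hUU] at key
  have := sq_nonneg ‖U - ∑ i ∈ S, b i • V i‖
  linarith

/-- Tonelli, with x^(-δ) written as the integral of δ y^(-δ-1) over y > x. The weighted integral is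
thereby seen to be monotone in the partial integrals over (1, y]. -/
lemma lintegral_Ioi_mul_rpow_eq {g : ℝ → ℝ≥0∞} (hg : Measurable g) {δ : ℝ} (hδ : 0 < δ) :
    ∫⁻ x in Ioi (1 : ℝ), g x * ENNReal.ofReal (x ^ (-δ)) =
      ∫⁻ y in Ioi (1 : ℝ), ENNReal.ofReal (δ * y ^ (-δ - 1)) * ∫⁻ x in Ioc 1 y, g x := by
  have hw : ∀ x ∈ Ioi (1 : ℝ), ENNReal.ofReal (x ^ (-δ)) =
      ∫⁻ y in Ioi (1 : ℝ), (Ici x).indicator (fun y ↦ ENNReal.ofReal (δ * y ^ (-δ - 1))) y := by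
    intro x hx
    have hx0 : 0 < x := zero_lt_one.trans hx
    rw [lintegral_indicator measurableSet_Ici, Measure.restrict_restrict measurableSet_Ici,
      inter_eq_left.mpr (Ici_subset_Ioi.mpr hx), setLIntegral_congr Ioi_ae_eq_Ici.symm,
      ← ofReal_integral_eq_lintegral_ofReal]
    · rw [integral_const_mul, integral_Ioi_rpow_of_lt (by linarith) hx0]
      congr 1
      rw [show -δ - 1 + 1 = -δ by ring]
      field_simp
    · exact (integrableOn_Ioi_rpow_of_lt (by linarith) hx0).const_mul δ
    · filter_upwards [ae_restrict_mem measurableSet_Ioi] with y hy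
      exact mul_nonneg hδ.le (Real.rpow_nonneg (hx0.trans hy).le _)
  have hwm : Measurable fun y : ℝ ↦ ENNReal.ofReal (δ * y ^ (-δ - 1)) := by fun_prop
  calc _ = ∫⁻ x in Ioi (1 : ℝ), ∫⁻ y in Ioi (1 : ℝ),
        g x * (Ici x).indicator (fun y ↦ ENNReal.ofReal (δ * y ^ (-δ - 1))) y := by
        refine setLIntegral_congr_fun measurableSet_Ioi fun x hx ↦ ?_
        rw [lintegral_const_mul _ (hwm.indicator measurableSet_Ici), hw x hx]
    _ = ∫⁻ y in Ioi (1 : ℝ), ∫⁻ x in Ioi (1 : ℝ),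
        g x * (Ici x).indicator (fun y ↦ ENNReal.ofReal (δ * y ^ (-δ - 1))) y := by
        refine lintegral_lintegral_swap (Measurable.aemeasurable ?_)
        have : (Function.uncurry fun x y : ℝ ↦
            g x * (Ici x).indicator (fun y ↦ ENNReal.ofReal (δ * y ^ (-δ - 1))) y) =
            fun p : ℝ × ℝ ↦ g p.1 * {p : ℝ × ℝ | p.1 ≤ p.2}.indicator
              (fun p ↦ ENNReal.ofReal (δ * p.2 ^ (-δ - 1))) p := by
          ext ⟨x, y⟩
          simp [indicator, Function.uncurry]
        rw [this]
        exact (hg.comp measurable_fst).mul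
          ((hwm.comp measurable_snd).indicator (measurableSet_le measurable_fst measurable_snd))
    _ = _ := by
        refine setLIntegral_congr_fun measurableSet_Ioi fun y hy ↦ ?_
        have : ∀ x, g x * (Ici x).indicator (fun y ↦ ENNReal.ofReal (δ * y ^ (-δ - 1))) y =
            ENNReal.ofReal (δ * y ^ (-δ - 1)) * (Iic y).indicator g x := by
          intro x
          simp only [indicator, mem_Ici, mem_Iic]
          split_ifs <;> simp [mul_comm]
        simp only [this]
        rw [lintegral_const_mul _ (hg.indicator measurableSet_Iic),
          lintegral_indicator measurableSet_Iic, Measure.restrict_restrict measurableSet_Iic,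
          inter_comm, Ioi_inter_Iic]

lemma lintegral_Ioi_mul_rpow_le {g h : ℝ → ℝ≥0∞} (hg : Measurable g) (hh : Measurable h) {δ : ℝ}
    (hδ : 0 < δ) (H : ∀ y, 1 < y → ∫⁻ x in Ioc 1 y, g x ≤ ∫⁻ x in Ioc 1 y, h x) :
    ∫⁻ x in Ioi (1 : ℝ), g x * ENNReal.ofReal (x ^ (-δ)) ≤
      ∫⁻ x in Ioi (1 : ℝ), h x * ENNReal.ofReal (x ^ (-δ)) := by
  rw [lintegral_Ioi_mul_rpow_eq hg hδ, lintegral_Ioi_mul_rpow_eq hh hδ]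
  refine setLIntegral_mono' measurableSet_Ioi fun y hy ↦ ?_
  exact mul_le_mul_right (H y hy) _

/-- The logarithmic mean square bound turns into a bound for the weighted integrals. -/
lemma weighted_integral_le_of_log_bound {f : ℝ → ℝ} (hf : Measurable f)
    (hfb : ∀ y : ℝ, 1 ≤ y → IntervalIntegrable (fun x ↦ f x ^ 2 / x) volume 1 y)
    {C : ℝ} (hC : 0 ≤ C) (H : ∀ X : ℝ, 1 ≤ X → ∫ x in (1 : ℝ)..X, f x ^ 2 / x ≤ C * Real.log X)
    {δ : ℝ} (hδ : 0 < δ) :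
    IntegrableOn (fun x ↦ f x ^ 2 * x ^ (-δ - 1)) (Ioi 1) ∧
      ∫ x in Ioi (1 : ℝ), f x ^ 2 * x ^ (-δ - 1) ≤ C / δ := by
  have hle : ∫⁻ x in Ioi (1 : ℝ), ENNReal.ofReal (f x ^ 2 * x ^ (-δ - 1)) ≤
      ENNReal.ofReal (C / δ) := by
    calc ∫⁻ x in Ioi (1 : ℝ), ENNReal.ofReal (f x ^ 2 * x ^ (-δ - 1))
        = ∫⁻ x in Ioi (1 : ℝ), ENNReal.ofReal (f x ^ 2 / x) * ENNReal.ofReal (x ^ (-δ)) := by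
          refine setLIntegral_congr_fun measurableSet_Ioi fun x hx ↦ ?_
          have hx0 : 0 < x := zero_lt_one.trans hx
          rw [← ENNReal.ofReal_mul (by positivity), Real.rpow_sub_one hx0.ne']
          congr 1; ring
      _ ≤ ∫⁻ x in Ioi (1 : ℝ), ENNReal.ofReal (C / x) * ENNReal.ofReal (x ^ (-δ)) := by
          -- The hypothesis compares partial integrals of f²/x with those of C/x, since the latter
          -- equal C log y.
          refine lintegral_Ioi_mul_rpow_le (by fun_prop) (by fun_prop) hδ fun y hy ↦ ?_
          rw [← ofReal_integral_eq_lintegral_ofReal, ← ofReal_integral_eq_lintegral_ofReal,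
            ← intervalIntegral.integral_of_le hy.le, ← intervalIntegral.integral_of_le hy.le]
          · refine ENNReal.ofReal_le_ofReal ((H y hy.le).trans_eq ?_)
            simp only [div_eq_mul_inv]
            rw [intervalIntegral.integral_const_mul, integral_inv_of_pos one_pos (by linarith),
              div_one]
          · have : IntervalIntegrable (fun x : ℝ ↦ C / x) volume 1 y := by
              refine ContinuousOn.intervalIntegrable fun x hx ↦ ?_
              rw [uIcc_of_le hy.le] at hx
              have : x ≠ 0 := by linarith [hx.1]
              exact (continuousAt_const.div continuousAt_id this).continuousWithinAt
            exact (intervalIntegrable_iff_integrableOn_Ioc_of_le hy.le).mp this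
          · filter_upwards [ae_restrict_mem measurableSet_Ioc] with x hx
            have : 0 < x := by linarith [hx.1]
            positivity
          · exact (intervalIntegrable_iff_integrableOn_Ioc_of_le hy.le).mp (hfb y hy.le)
          · filter_upwards [ae_restrict_mem measurableSet_Ioc] with x hx
            have : 0 < x := by linarith [hx.1]
            positivity
      _ = ∫⁻ x in Ioi (1 : ℝ), ENNReal.ofReal (C * x ^ (-δ - 1)) := by
          refine setLIntegral_congr_fun measurableSet_Ioi fun x hx ↦ ?_
          have hx0 : 0 < x := zero_lt_one.trans hx
          rw [← ENNReal.ofReal_mul (by positivity), Real.rpow_sub_one hx0.ne']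
          congr 1; ring
      _ = ENNReal.ofReal (C / δ) := by
          rw [← ofReal_integral_eq_lintegral_ofReal, integral_const_mul,
            integral_Ioi_rpow_of_lt (by linarith) one_pos]
          · congr 1
            rw [show -δ - 1 + 1 = -δ by ring, Real.one_rpow]
            field_simp
          · exact (integrableOn_Ioi_rpow_of_lt (by linarith) one_pos).const_mul C
          · filter_upwards [ae_restrict_mem measurableSet_Ioi] with y hy
            exact mul_nonneg hC (Real.rpow_nonneg (zero_lt_one.trans hy).le _)
  have hnn : 0 ≤ᵐ[volume.restrict (Ioi 1)] fun x ↦ f x ^ 2 * x ^ (-δ - 1) := by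
    filter_upwards [ae_restrict_mem measurableSet_Ioi] with y hy
    exact mul_nonneg (sq_nonneg _) (Real.rpow_nonneg (zero_lt_one.trans hy).le _)
  have hm : AEStronglyMeasurable (fun x ↦ f x ^ 2 * x ^ (-δ - 1)) (volume.restrict (Ioi 1)) :=
    (by fun_prop : Measurable fun x ↦ f x ^ 2 * x ^ (-δ - 1)).aestronglyMeasurable
  have hint : IntegrableOn (fun x ↦ f x ^ 2 * x ^ (-δ - 1)) (Ioi 1) := by
    refine ⟨hm, ?_⟩
    rw [hasFiniteIntegral_iff_ofReal hnn]
    exact hle.trans_lt ENNReal.ofReal_lt_top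
  refine ⟨hint, ?_⟩
  rw [integral_eq_lintegral_of_nonneg_ae hnn hm]
  exact ENNReal.toReal_le_of_le_ofReal (by positivity) hle

/-- The normalized error term `M_k(x) / x^{1/(2k)}`. -/
def normErr (k : ℕ) (x : ℝ) : ℝ := errM k x / x ^ (1 / (2 * (k : ℝ)))

lemma measurable_normErr (k : ℕ) : Measurable (normErr k) :=
  (measurable_errM k).div (measurable_id.pow_const _)

lemma abs_normErr_le (k : ℕ) {x : ℝ} (hx : 1 ≤ x) : |normErr k x| ≤ errMConst k * x := by
  rw [normErr, abs_div]
  have h1 : 1 ≤ |x ^ (1 / (2 * (k : ℝ)))| := by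
    rw [abs_of_nonneg (by positivity)]
    exact Real.one_le_rpow hx (by positivity)
  calc _ ≤ |errM k x| := div_le_self (abs_nonneg _) h1
    _ ≤ _ := abs_errM_le k (by linarith)

lemma normErr_sq_div_le (k : ℕ) {x y : ℝ} (hx : 1 ≤ x) (hy : x ≤ y) :
    normErr k x ^ 2 / x ≤ errMConst k ^ 2 * y := by
  have h := abs_normErr_le k hx
  have h2 := pow_le_pow_left₀ (abs_nonneg _) h 2
  rw [sq_abs] at h2
  rw [div_le_iff₀ (by linarith)]
  calc _ ≤ _ := h2
    _ = errMConst k ^ 2 * x * x := by ring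
    _ ≤ _ := by gcongr

lemma intervalIntegrable_normErr (k : ℕ) {y : ℝ} (hy : 1 ≤ y) :
    IntervalIntegrable (fun x ↦ normErr k x ^ 2 / x) volume 1 y := by
  rw [intervalIntegrable_iff_integrableOn_Ioc_of_le hy]
  refine Measure.integrableOn_of_bounded (M := errMConst k ^ 2 * y) (by simp) ?_ ?_
  · exact (((measurable_normErr k).pow_const 2).div measurable_id).aestronglyMeasurable
  · filter_upwards [ae_restrict_mem measurableSet_Ioc] with x hx
    have hx0 : 0 < x := by linarith [hx.1]
    rw [Real.norm_of_nonneg (by positivity)]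
    exact normErr_sq_div_le k hx.1.le hx.2

lemma errM_mul_rpow_eq (k : ℕ) {x : ℝ} (hx : 0 < x) (δ : ℝ) :
    errM k x * x ^ (-(1 / (2 * (k : ℝ)) + δ + 1)) =
      (normErr k x * x ^ (-(δ + 1) / 2)) * x ^ (-(δ + 1) / 2) := by
  rw [normErr, div_eq_mul_inv (errM k x), ← Real.rpow_neg hx.le, mul_assoc, mul_assoc, ← Real.rpow_add hx,
    ← Real.rpow_add hx]
  ring_nf

/-- The integrand is a product ab with a² and b² integrable, and |ab| ≤ a² + b². Consequently the
Mellin transform is holomorphic on Re s > 1/(2k). -/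
lemma integrableOn_errM {k : ℕ}
    (H : ∀ δ : ℝ, 0 < δ → IntegrableOn (fun x ↦ normErr k x ^ 2 * x ^ (-δ - 1)) (Ioi 1)) (σ : ℝ)
    (hσ : 1 / (2 * (k : ℝ)) < σ) : IntegrableOn (fun x ↦ errM k x * x ^ (-(σ + 1))) (Ioi 1) := by
  obtain ⟨δ, rfl⟩ : ∃ δ, σ = 1 / (2 * (k : ℝ)) + δ := ⟨σ - 1 / (2 * (k : ℝ)), by ring⟩
  have hδ : 0 < δ := by linarith
  have h2 : IntegrableOn (fun x : ℝ ↦ x ^ (-δ - 1)) (Ioi 1) :=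
    integrableOn_Ioi_rpow_of_lt (by linarith) one_pos
  refine ((H δ hδ).add h2).mono' ?_ ?_
  · exact ((measurable_errM k).mul (measurable_id.pow_const _)).aestronglyMeasurable
  · filter_upwards [ae_restrict_mem measurableSet_Ioi] with x hx
    have hx0 : (0 : ℝ) < x := zero_lt_one.trans hx
    rw [errM_mul_rpow_eq k hx0, Pi.add_apply]
    have hsq : x ^ (-δ - 1) = (x ^ (-(δ + 1) / 2)) ^ 2 := by
      rw [← Real.rpow_natCast, ← Real.rpow_mul hx0.le]; congr 1; push_cast; ring
    rw [hsq, ← mul_pow, Real.norm_eq_abs, abs_le]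
    constructor <;> nlinarith [sq_nonneg (normErr k x * x ^ (-(δ + 1) / 2) + x ^ (-(δ + 1) / 2)),
      sq_nonneg (normErr k x * x ^ (-(δ + 1) / 2) - x ^ (-(δ + 1) / 2)),
      sq_nonneg (normErr k x * x ^ (-(δ + 1) / 2)), sq_nonneg (x ^ (-(δ + 1) / 2))]

lemma memLp_of_integrable_norm_sq {u : ℝ → ℂ} {v : ℝ → ℝ}
    (hu : AEStronglyMeasurable u (volume.restrict (Ioi 1))) (hv : IntegrableOn v (Ioi 1))
    (h : ∀ x, 1 < x → ‖u x‖ ^ 2 = v x) : MemLp u 2 (volume.restrict (Ioi 1)) := by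
  rw [memLp_two_iff_integrable_sq_norm hu]
  refine hv.congr ?_
  filter_upwards [ae_restrict_mem measurableSet_Ioi] with x hx using (h x hx).symm

/-- Bessel's inequality in L²(1, ∞) for √δ x^(-(δ+1)/2) M_k(x) x^(-1/(2k)) against the functions √δ
x^(-(δ+1)/2 + i l). The inner products are δ times the Mellin transform at distance δ from its
critical line, and for distinct frequencies the Gram matrix tends to the identity as δ → 0. -/
lemma bessel_normErr {k : ℕ} {C : ℝ}
    (H : ∀ δ : ℝ, 0 < δ → IntegrableOn (fun x ↦ normErr k x ^ 2 * x ^ (-δ - 1)) (Ioi 1) ∧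
      ∫ x in Ioi (1 : ℝ), normErr k x ^ 2 * x ^ (-δ - 1) ≤ C / δ) {δ : ℝ} (hδ : 0 < δ)
    {ι : Type*} (S : Finset ι) (l : ι → ℝ) (b : ι → ℂ) :
    2 * (∑ i ∈ S, conj (b i) * (δ * tailMellin (errM k) (1 / (2 * (k : ℂ)) + l i * I + δ))).re ≤
      C + (∑ i ∈ S, ∑ j ∈ S, conj (b i) * b j * (δ / (δ - (l j - l i) * I))).re := by
  set u : ℝ → ℂ := fun x ↦ ((√δ * (normErr k x * x ^ (-(δ + 1) / 2)) : ℝ) : ℂ) with hu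
  set v : ι → ℝ → ℂ := fun i x ↦ (√δ : ℂ) * (x : ℂ) ^ (l i * I - (δ + 1) / 2) with hv
  have hsqδ : √δ ^ 2 = δ := Real.sq_sqrt hδ.le
  have hsq : ∀ x : ℝ, 0 < x → (x ^ (-(δ + 1) / 2)) ^ 2 = x ^ (-δ - 1) := by
    intro x hx0
    rw [← Real.rpow_natCast, ← Real.rpow_mul hx0.le]; congr 1; push_cast; ring
  have hun : ∀ x, 1 < x → ‖u x‖ ^ 2 = δ * (normErr k x ^ 2 * x ^ (-δ - 1)) := by
    intro x hx
    rw [hu, Complex.norm_real, Real.norm_eq_abs, sq_abs, mul_pow, mul_pow, hsqδ,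
      hsq x (by linarith)]
  have hure : ∀ i, ((l i * I - (δ + 1) / 2 : ℂ)).re = -(δ + 1) / 2 := by
    intro i
    have : (l i * I - (δ + 1) / 2 : ℂ) = l i * I + ((-(δ + 1) / 2 : ℝ) : ℂ) := by push_cast; ring
    rw [this]; simp
  have hvn : ∀ i x, 1 < x → ‖v i x‖ ^ 2 = δ * x ^ (-δ - 1) := by
    intro i x hx
    rw [hv, norm_mul, Complex.norm_cpow_eq_rpow_re_of_pos (by linarith), hure, mul_pow,
      Complex.norm_real, Real.norm_eq_abs, sq_abs, hsqδ, hsq x (by linarith)]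
  have hvint : IntegrableOn (fun x : ℝ ↦ δ * x ^ (-δ - 1)) (Ioi 1) :=
    (integrableOn_Ioi_rpow_of_lt (by linarith) one_pos).const_mul δ
  have hmu : MemLp u 2 (volume.restrict (Ioi 1)) := by
    refine memLp_of_integrable_norm_sq ?_ ((H δ hδ).1.const_mul δ) hun
    have h1 : Measurable fun x ↦ √δ * (normErr k x * x ^ (-(δ + 1) / 2)) :=
      ((measurable_normErr k).mul (measurable_id.pow_const _)).const_mul _
    exact (Complex.measurable_ofReal.comp h1).aestronglyMeasurable
  have hmv : ∀ i, MemLp (v i) 2 (volume.restrict (Ioi 1)) := fun i ↦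
    memLp_of_integrable_norm_sq (aestronglyMeasurable_const.mul (aestronglyMeasurable_cpow_Ioi _))
      hvint (hvn i)
  have key := two_mul_re_sum_integral_le S b hmu hmv
  have hconj : ∀ i, ∀ x : ℝ, 1 < x → conj (v i x) =
      (√δ : ℂ) * (x : ℂ) ^ (-(l i * I) - (δ + 1) / 2) := by
    intro i x hx
    have h1 := Complex.cpow_conj (x : ℂ) (l i * I - (δ + 1) / 2) (by
      rw [Complex.arg_ofReal_of_nonneg (by linarith)]
      exact Real.pi_pos.ne)
    rw [Complex.conj_ofReal] at h1
    rw [hv, map_mul, Complex.conj_ofReal, ← h1]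
    simp [Complex.conj_ofReal, map_ofNat]
  have hsqδc : (√δ : ℂ) * (√δ : ℂ) = δ := by
    rw [← Complex.ofReal_mul, Real.mul_self_sqrt hδ.le]
  have hI1 : ∀ i, ∫ x in Ioi (1 : ℝ), u x * conj (v i x) =
      δ * tailMellin (errM k) (1 / (2 * (k : ℂ)) + l i * I + δ) := by
    intro i
    rw [tailMellin, ← integral_const_mul]
    refine setIntegral_congr_fun measurableSet_Ioi fun x hx ↦ ?_
    have hx0 : (0 : ℝ) < x := zero_lt_one.trans hx
    have hxne : (x : ℂ) ≠ 0 := Complex.ofReal_ne_zero.mpr hx0.ne'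
    have hexp : (x : ℂ) ^ (-(1 / (2 * (k : ℂ)) + l i * I + δ + 1)) =
        ((x ^ (-(1 / (2 * (k : ℝ)) + δ + 1)) : ℝ) : ℂ) * (x : ℂ) ^ (-(l i * I)) := by
      rw [Complex.ofReal_cpow hx0.le, ← Complex.cpow_add _ _ hxne]
      congr 1; push_cast; ring
    have hexp2 : (x : ℂ) ^ (-(l i * I) - (δ + 1) / 2) =
        ((x ^ (-(δ + 1) / 2) : ℝ) : ℂ) * (x : ℂ) ^ (-(l i * I)) := by
      rw [Complex.ofReal_cpow hx0.le, ← Complex.cpow_add _ _ hxne]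
      congr 1; push_cast; ring
    have h3 : (errM k x : ℂ) * ((x ^ (-(1 / (2 * (k : ℝ)) + δ + 1)) : ℝ) : ℂ) =
        ((normErr k x * x ^ (-(δ + 1) / 2) : ℝ) : ℂ) * ((x ^ (-(δ + 1) / 2) : ℝ) : ℂ) := by
      rw [← Complex.ofReal_mul, errM_mul_rpow_eq k hx0, Complex.ofReal_mul]
    rw [hconj i x hx, hexp, hexp2, ← mul_assoc (errM k x : ℂ), h3, hu]
    simp only [Complex.ofReal_mul]
    linear_combination ((normErr k x : ℂ) * ((x ^ (-(δ + 1) / 2) : ℝ) : ℂ) *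
      ((x ^ (-(δ + 1) / 2) : ℝ) : ℂ) * (x : ℂ) ^ (-(l i * I))) * hsqδc
  have hI2 : ∀ i j, ∫ x in Ioi (1 : ℝ), v j x * conj (v i x) = δ / (δ - (l j - l i) * I) := by
    intro i j
    have h1 : ∀ x ∈ Ioi (1 : ℝ), v j x * conj (v i x) =
        δ * (x : ℂ) ^ ((l j - l i) * I - δ - 1) := by
      intro x hx
      have hxne : (x : ℂ) ≠ 0 := Complex.ofReal_ne_zero.mpr (zero_lt_one.trans hx).ne'
      have : (x : ℂ) ^ ((l j - l i) * I - δ - 1) =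
          (x : ℂ) ^ (l j * I - (δ + 1) / 2) * (x : ℂ) ^ (-(l i * I) - (δ + 1) / 2) := by
        rw [← Complex.cpow_add _ _ hxne]; congr 1; ring
      rw [hconj i x hx, this]
      simp only [hv]
      linear_combination ((x : ℂ) ^ (l j * I - (δ + 1) / 2) *
        (x : ℂ) ^ (-(l i * I) - (δ + 1) / 2)) * hsqδc
    rw [setIntegral_congr_fun measurableSet_Ioi h1, integral_const_mul,
      integral_Ioi_cpow_of_lt (by simp; linarith) one_pos]
    rw [Complex.ofReal_one, Complex.one_cpow,
      show (l j - l i) * I - δ - 1 + 1 = -(δ - (l j - l i) * I) by ring, neg_div_neg_eq]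
    ring
  simp only [hI1, hI2] at key
  refine key.trans (add_le_add_left ?_ _)
  calc ∫ x in Ioi (1 : ℝ), ‖u x‖ ^ 2 = δ * ∫ x in Ioi (1 : ℝ), normErr k x ^ 2 * x ^ (-δ - 1) := by
        rw [← integral_const_mul]
        exact setIntegral_congr_fun measurableSet_Ioi fun x hx ↦ hun x hx
    _ ≤ δ * (C / δ) := by gcongr; exact (H δ hδ).2
    _ = C := by field_simp

/-- The identity theorem continues the formula from Re s > 1. Denominators are cleared and ζ enters
through the entire function `riemannZeta₁`, so that neither s = 1 nor s = 1/k has to be excluded. -/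
lemma tailMellin_errM_identity {k : ℕ} (hk : 2 ≤ k)
    (H : ∀ δ : ℝ, 0 < δ → IntegrableOn (fun x ↦ normErr k x ^ 2 * x ^ (-δ - 1)) (Ioi 1)) {s : ℂ}
    (hs : 1 / (2 * (k : ℝ)) < s.re) :
    (s - 1) * s * riemannZeta₁ (k * s) * riemannZeta k * tailMellin (errM k) s =
      riemannZeta k * riemannZeta₁ s * (k * s - 1) - s * riemannZeta₁ (k * s) := by
  have hk0 : k ≠ 0 := by omega
  have hk2 : (2 : ℝ) ≤ k := by exact_mod_cast hk
  have hzk : riemannZeta k ≠ 0 :=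
    riemannZeta_ne_zero_of_one_le_re (by simp; exact_mod_cast (by omega : 1 ≤ k))
  have hopen : IsOpen {s : ℂ | 1 / (2 * (k : ℝ)) < s.re} :=
    isOpen_lt continuous_const Complex.continuous_re
  have hz1 := differentiable_riemannZeta₁
  refine AnalyticOnNhd.eqOn_of_preconnected_of_eventuallyEq (𝕜 := ℂ)
    (U := {s : ℂ | 1 / (2 * (k : ℝ)) < s.re})
    (f := fun s ↦ (s - 1) * s * riemannZeta₁ (k * s) * riemannZeta k * tailMellin (errM k) s)
    (g := fun s ↦ riemannZeta k * riemannZeta₁ s * (k * s - 1) - s * riemannZeta₁ (k * s)) (z₀ := 2)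
    ?_ ?_ (isPreconnected_re_gt _) ?_ ?_ hs
  · refine DifferentiableOn.analyticOnNhd (fun z hz ↦ ?_) hopen
    have h1 := differentiableAt_tailMellin (measurable_errM k) (integrableOn_errM H) hz
    have h2 : DifferentiableAt ℂ (fun s ↦ (s - 1) * s * riemannZeta₁ (k * s) * riemannZeta k) z := by
      fun_prop
    exact (h2.mul h1).differentiableWithinAt
  · refine Differentiable.differentiableOn ?_ |>.analyticOnNhd hopen
    fun_prop
  · simp only [mem_ofPred_eq, Complex.re_ofNat]
    rw [div_lt_iff₀ (by positivity)]; linarith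
  · filter_upwards [(isOpen_lt continuous_const Complex.continuous_re).mem_nhds
      (show (1 : ℝ) < (2 : ℂ).re by simp)] with z hz
    have hz' : 1 < z.re := hz
    have hz1 : z ≠ 1 := by rintro rfl; simp at hz'
    have hz0 : z ≠ 0 := by rintro rfl; simp at hz'; linarith
    have hkzre : 1 < (k * z).re := by rw [re_natCast_mul]; nlinarith
    have hkz1 : k * z ≠ 1 := by intro h; rw [h] at hkzre; simp at hkzre
    have hzkz := riemannZeta_ne_zero_of_one_le_re hkzre.le
    have e1 : riemannZeta₁ z = (z - 1) * riemannZeta z := by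
      rw [riemannZeta_eq_inv_sub_mul hz1, mul_inv_cancel_left₀ (sub_ne_zero.mpr hz1)]
    have e2 : riemannZeta₁ (k * z) = (k * z - 1) * riemannZeta (k * z) := by
      rw [riemannZeta_eq_inv_sub_mul hkz1, mul_inv_cancel_left₀ (sub_ne_zero.mpr hkz1)]
    rw [tailMellin_errM hk0 hz', e1, e2]
    have hz1' := sub_ne_zero.mpr hz1
    generalize riemannZeta (k * z) = a at *
    field_simp

lemma riemannZeta₁_eq_mul {s : ℂ} (hs : s ≠ 1) : riemannZeta₁ s = (s - 1) * riemannZeta s := by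
  rw [riemannZeta_eq_inv_sub_mul hs, mul_inv_cancel_left₀ (sub_ne_zero.mpr hs)]

lemma deriv_riemannZeta₁_of_zero {ρ : ℂ} (hρ1 : ρ ≠ 1) (hρ : riemannZeta ρ = 0) :
    deriv riemannZeta₁ ρ = (ρ - 1) * deriv riemannZeta ρ := by
  have h1 : riemannZeta₁ =ᶠ[𝓝 ρ] fun s ↦ (s - 1) * riemannZeta s := by
    filter_upwards [isOpen_ne.mem_nhds hρ1] with s hs using riemannZeta₁_eq_mul hs
  rw [h1.deriv_eq]
  have h2 := ((hasDerivAt_id ρ).sub_const (1 : ℂ)).mul (differentiableAt_riemannZeta hρ1).hasDerivAt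
  refine h2.deriv.trans ?_
  simp [hρ]

/-- A single frequency, with the value c itself as coefficient: 2|c|² ≤ C + |c|². The transform
therefore grows at most like 1/δ near its critical line, the rate of a simple pole. -/
lemma norm_mul_tailMellin_sq_le {k : ℕ} {C : ℝ}
    (H : ∀ δ : ℝ, 0 < δ → IntegrableOn (fun x ↦ normErr k x ^ 2 * x ^ (-δ - 1)) (Ioi 1) ∧
      ∫ x in Ioi (1 : ℝ), normErr k x ^ 2 * x ^ (-δ - 1) ≤ C / δ) {δ : ℝ} (hδ : 0 < δ) (l : ℝ) :
    ‖δ * tailMellin (errM k) (1 / (2 * (k : ℂ)) + l * I + δ)‖ ^ 2 ≤ C := by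
  set c := δ * tailMellin (errM k) (1 / (2 * (k : ℂ)) + l * I + δ) with hc
  have h := bessel_normErr H hδ {()} (fun _ ↦ l) (fun _ ↦ c)
  have hδc : (δ : ℂ) ≠ 0 := Complex.ofReal_ne_zero.mpr hδ.ne'
  simp only [Finset.sum_singleton, sub_self, zero_mul, sub_zero, div_self hδc, mul_one, ← hc] at h
  rw [← Complex.normSq_eq_conj_mul_self, Complex.ofReal_re, Complex.normSq_eq_norm_sq] at h
  linarith

/-- Under the mean square bound for `M_k`, a zero `ρ` of zeta is simple, and the Mellin transform
of `M_k` has the expected residue at `ρ / k`. -/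
lemma tendsto_residue (hRH : RiemannHypothesis) {k : ℕ} (hk : 2 ≤ k) {C : ℝ}
    (H : ∀ δ : ℝ, 0 < δ → IntegrableOn (fun x ↦ normErr k x ^ 2 * x ^ (-δ - 1)) (Ioi 1) ∧
      ∫ x in Ioi (1 : ℝ), normErr k x ^ 2 * x ^ (-δ - 1) ≤ C / δ) {ρ : ℂ} (hρ : riemannZeta ρ = 0)
    (him : 0 < ρ.im) :
    deriv riemannZeta ρ ≠ 0 ∧
      Tendsto (fun δ : ℝ ↦ δ * tailMellin (errM k) (1 / (2 * (k : ℂ)) + (ρ.im / k : ℝ) * I + δ))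
        (𝓝[>] 0) (𝓝 (riemannZeta (ρ / k) / (ρ * deriv riemannZeta ρ))) := by
  have hk0 : (k : ℂ) ≠ 0 := by exact_mod_cast (by omega : k ≠ 0)
  have hk2 : (2 : ℝ) ≤ k := by exact_mod_cast hk
  have hre := hRH.re_eq hρ him.ne'
  have hρ0 : ρ ≠ 0 := by rintro rfl; simp at him
  have hρ1 : ρ ≠ 1 := by rintro rfl; simp at him
  have hρ1' := sub_ne_zero.mpr hρ1
  have hpt : ∀ δ : ℝ, 1 / (2 * (k : ℂ)) + (ρ.im / k : ℝ) * I + δ = ρ / k + δ := by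
    intro δ
    have : ρ = 1 / 2 + ρ.im * I := by apply Complex.ext <;> simp [hre]
    conv_rhs => rw [this]
    push_cast
    field_simp
  have hkim : 0 < (ρ / k).im := by
    rw [Complex.div_natCast_im]; positivity
  have hkre : (ρ / k).re = 1 / (2 * (k : ℝ)) := by
    rw [Complex.div_natCast_re, hre]; field_simp
  have hρk1 : ρ / k ≠ 1 := by intro h; rw [h] at hkim; simp at hkim
  have hρk1' := sub_ne_zero.mpr hρk1
  have hzρk : riemannZeta (ρ / k) ≠ 0 := by
    refine hRH.riemannZeta_ne_zero ?_ ?_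
    · rw [hkre]; positivity
    · rw [hkre]
      intro h
      rw [div_eq_div_iff (by positivity) (by norm_num)] at h
      linarith
  have hzk : riemannZeta k ≠ 0 :=
    riemannZeta_ne_zero_of_one_le_re (by simp; exact_mod_cast (by omega : 1 ≤ k))
  set P : ℝ → ℂ := fun δ ↦ δ * tailMellin (errM k) (ρ / k + δ) with hP
  simp only [hpt]
  set A : ℝ → ℂ := fun δ ↦ (ρ / k + δ - 1) * (ρ / k + δ) * riemannZeta k with hA
  -- A difference quotient of `riemannZeta₁` at its zero ρ. The continued identity becomes A D P = R
  -- with P bounded.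
  set D : ℝ → ℂ := fun δ ↦ δ⁻¹ • (riemannZeta₁ (ρ + k * δ)) with hD
  set R : ℝ → ℂ := fun δ ↦ riemannZeta k * riemannZeta₁ (ρ / k + δ) * (k * (ρ / k + δ) - 1)
    - (ρ / k + δ) * riemannZeta₁ (k * (ρ / k + δ)) with hR
  have hmulk : k * (ρ / k) = ρ := by field_simp
  have hz1 : Continuous riemannZeta₁ := differentiable_riemannZeta₁.continuous
  have hz1ρ : riemannZeta₁ ρ = 0 := by rw [riemannZeta₁_eq_mul hρ1, hρ, mul_zero]
  have hAt : Tendsto A (𝓝[>] 0) (𝓝 ((ρ / k - 1) * (ρ / k) * riemannZeta k)) := by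
    have : Continuous A := by rw [hA]; fun_prop
    have := (this.tendsto 0).mono_left (nhdsWithin_le_nhds (s := Ioi 0))
    simpa [hA] using this
  have hRt : Tendsto R (𝓝[>] 0) (𝓝 (riemannZeta k * ((ρ / k - 1) * riemannZeta (ρ / k)) *
      (ρ - 1))) := by
    have : Continuous R := by rw [hR]; fun_prop
    have := (this.tendsto 0).mono_left (nhdsWithin_le_nhds (s := Ioi 0))
    simpa [hR, hmulk, hz1ρ, riemannZeta₁_eq_mul hρk1] using this
  have hDt : Tendsto D (𝓝[>] 0) (𝓝 (k * ((ρ - 1) * deriv riemannZeta ρ))) := by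
    have h1 : HasDerivAt (fun z : ℂ ↦ riemannZeta₁ (ρ + k * z))
        (k * ((ρ - 1) * deriv riemannZeta ρ)) ((0 : ℝ) : ℂ) := by
      have h2 : HasDerivAt (fun z : ℂ ↦ ρ + k * z) k ((0 : ℝ) : ℂ) := by
        simpa using ((hasDerivAt_id ((0 : ℝ) : ℂ)).const_mul (k : ℂ)).const_add ρ
      have h3 : HasDerivAt riemannZeta₁ ((ρ - 1) * deriv riemannZeta ρ)
          (ρ + k * ((0 : ℝ) : ℂ)) := by
        rw [← deriv_riemannZeta₁_of_zero hρ1 hρ]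
        simpa using (differentiable_riemannZeta₁ ρ).hasDerivAt
      exact (HasDerivAt.comp (h := fun z : ℂ ↦ ρ + k * z) ((0 : ℝ) : ℂ) h3 h2).congr_deriv (by ring)
    have h4 := h1.comp_ofReal.tendsto_slope_zero_right
    simpa [hD, hz1ρ] using h4
  have hid : ∀ δ : ℝ, 0 < δ → A δ * D δ * P δ = R δ := by
    intro δ hδ
    have hδc : (δ : ℂ) ≠ 0 := Complex.ofReal_ne_zero.mpr hδ.ne'
    have h := tailMellin_errM_identity hk (fun δ hδ ↦ (H δ hδ).1) (s := ρ / k + δ) (by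
      rw [Complex.add_re, Complex.ofReal_re, hkre]; linarith)
    have hkd : (k : ℂ) * (ρ / k + δ) = ρ + k * δ := by rw [mul_add, hmulk]
    simp only [hR]
    rw [← h]
    simp only [hA, hD, hP, Complex.real_smul, Complex.ofReal_inv, hkd]
    field_simp
  have hR0 : riemannZeta k * ((ρ / k - 1) * riemannZeta (ρ / k)) * (ρ - 1) ≠ 0 :=
    mul_ne_zero (mul_ne_zero hzk (mul_ne_zero hρk1' hzρk)) hρ1'
  -- At a multiple zero D would tend to 0 while P stays bounded, so R would tend to 0. Its limit is
  -- nonzero, because ρ/k has real part 1/(2k), off the critical line.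
  have hder : deriv riemannZeta ρ ≠ 0 := by
    intro h0
    have hAD : Tendsto (fun δ ↦ A δ * D δ) (𝓝[>] 0) (𝓝 0) := by
      have := hAt.mul hDt
      rwa [h0, mul_zero, mul_zero, mul_zero] at this
    have hbd : ∀ᶠ δ in 𝓝[>] (0 : ℝ), ‖P δ‖ ≤ √C := by
      filter_upwards [self_mem_nhdsWithin] with δ hδ
      have := norm_mul_tailMellin_sq_le H hδ (ρ.im / k)
      rw [hpt] at this
      exact Real.le_sqrt_of_sq_le this
    have h1 : Tendsto (fun δ ↦ A δ * D δ * P δ) (𝓝[>] 0) (𝓝 0) := by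
      refine hAD.zero_mul_isBoundedUnder_le ⟨√C, ?_⟩
      simpa using hbd
    have h2 : Tendsto R (𝓝[>] 0) (𝓝 0) := by
      refine h1.congr' ?_
      filter_upwards [self_mem_nhdsWithin] with δ hδ using hid δ hδ
    exact hR0 (tendsto_nhds_unique hRt h2)
  refine ⟨hder, ?_⟩
  have hAD0 : ((ρ / k - 1) * (ρ / k) * riemannZeta k) * (k * ((ρ - 1) * deriv riemannZeta ρ)) ≠ 0 :=
    mul_ne_zero (mul_ne_zero (mul_ne_zero hρk1' (div_ne_zero hρ0 hk0)) hzk)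
      (mul_ne_zero hk0 (mul_ne_zero hρ1' hder))
  have hlim := hRt.div (hAt.mul hDt) hAD0
  have hval : riemannZeta k * ((ρ / k - 1) * riemannZeta (ρ / k)) * (ρ - 1) /
      (((ρ / k - 1) * (ρ / k) * riemannZeta k) * (k * ((ρ - 1) * deriv riemannZeta ρ))) =
      riemannZeta (ρ / k) / (ρ * deriv riemannZeta ρ) := by
    rw [div_eq_div_iff hAD0 (mul_ne_zero hρ0 hder)]
    linear_combination (-(ρ / k - 1) * riemannZeta k * (ρ - 1) * deriv riemannZeta ρ *
      riemannZeta (ρ / k)) * hmulk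
  rw [hval] at hlim
  refine hlim.congr' ?_
  filter_upwards [self_mem_nhdsWithin, (hAt.mul hDt).eventually_ne hAD0] with δ hδ hne
  rw [Pi.div_apply, ← hid δ hδ, mul_div_cancel_left₀ _ hne]

lemma tendsto_div_sub_mul_I (ν : ℝ) :
    Tendsto (fun δ : ℝ ↦ (δ : ℂ) / (δ - ν * I)) (𝓝[>] 0) (𝓝 (if ν = 0 then 1 else 0)) := by
  split_ifs with h
  · refine tendsto_const_nhds.congr' ?_
    filter_upwards [self_mem_nhdsWithin] with δ hδ
    have hδc : (δ : ℂ) ≠ 0 := Complex.ofReal_ne_zero.mpr (ne_of_gt hδ)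
    simp [h, hδc]
  · have h1 : Tendsto (fun δ : ℝ ↦ (δ : ℂ)) (𝓝[>] 0) (𝓝 0) := by
      simpa using (Complex.continuous_ofReal.tendsto 0).mono_left (nhdsWithin_le_nhds (s := Ioi 0))
    have h2 : Tendsto (fun δ : ℝ ↦ (δ : ℂ) / (δ - ν * I)) (𝓝[>] 0) (𝓝 (0 / (0 - ν * I))) :=
      h1.div (h1.sub_const (ν * I)) (by simpa using h)
    simpa using h2

/-- Bessel's inequality with the residues as coefficients, in the limit δ → 0. Under RH distinct
zeros have distinct ordinates, so the Gram matrix becomes the identity and 2 Σ|c|² ≤ C + Σ|c|²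
remains. -/
lemma sum_residue_sq_le (hRH : RiemannHypothesis) {k : ℕ} (hk : 2 ≤ k) {C : ℝ}
    (H : ∀ δ : ℝ, 0 < δ → IntegrableOn (fun x ↦ normErr k x ^ 2 * x ^ (-δ - 1)) (Ioi 1) ∧
      ∫ x in Ioi (1 : ℝ), normErr k x ^ 2 * x ^ (-δ - 1) ≤ C / δ) (S : Finset ℂ)
    (hS : ∀ ρ ∈ S, riemannZeta ρ = 0 ∧ 0 < ρ.im) :
    ∑ ρ ∈ S, ‖riemannZeta (ρ / k) / (ρ * deriv riemannZeta ρ)‖ ^ 2 ≤ C := by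
  have hk0 : (k : ℝ) ≠ 0 := by exact_mod_cast (by omega : k ≠ 0)
  set c : ℂ → ℂ := fun ρ ↦ riemannZeta (ρ / k) / (ρ * deriv riemannZeta ρ) with hc
  have hinj : ∀ ρ ∈ S, ∀ ρ' ∈ S, ρ'.im / k - ρ.im / k = 0 → ρ = ρ' := by
    intro ρ hρ ρ' hρ' h
    have h1 := hRH.re_eq (hS ρ hρ).1 (hS ρ hρ).2.ne'
    have h2 := hRH.re_eq (hS ρ' hρ').1 (hS ρ' hρ').2.ne'
    refine Complex.ext (h1.trans h2.symm) ?_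
    rw [← sub_div, div_eq_zero_iff] at h
    linarith [h.resolve_right hk0]
  have hleft : Tendsto (fun δ : ℝ ↦ 2 * (∑ ρ ∈ S, conj (c ρ) *
      (δ * tailMellin (errM k) (1 / (2 * (k : ℂ)) + (ρ.im / k : ℝ) * I + δ))).re) (𝓝[>] 0)
      (𝓝 (2 * (∑ ρ ∈ S, conj (c ρ) * c ρ).re)) := by
    refine Tendsto.const_mul 2 ?_
    refine (Complex.continuous_re.tendsto _).comp ?_
    exact tendsto_finsetSum _ fun ρ hρ ↦
      ((tendsto_residue hRH hk H (hS ρ hρ).1 (hS ρ hρ).2).2).const_mul _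
  have hright : Tendsto (fun δ : ℝ ↦ C + (∑ ρ ∈ S, ∑ ρ' ∈ S, conj (c ρ) * c ρ' *
      ((δ : ℂ) / (δ - ((ρ'.im / k : ℝ) - (ρ.im / k : ℝ)) * I))).re) (𝓝[>] 0)
      (𝓝 (C + (∑ ρ ∈ S, ∑ ρ' ∈ S, conj (c ρ) * c ρ' *
        (if ρ'.im / k - ρ.im / k = 0 then 1 else 0)).re)) := by
    refine Tendsto.const_add C ?_
    refine (Complex.continuous_re.tendsto _).comp ?_
    refine tendsto_finsetSum _ fun ρ _ ↦ tendsto_finsetSum _ fun ρ' _ ↦ Tendsto.const_mul _ ?_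
    have := tendsto_div_sub_mul_I (ρ'.im / k - ρ.im / k)
    simpa using this
  have hle := le_of_tendsto_of_tendsto hleft hright (by
    filter_upwards [self_mem_nhdsWithin] with δ hδ
    exact bessel_normErr H hδ S (fun ρ ↦ ρ.im / k) c)
  have hdiag : ∑ ρ ∈ S, ∑ ρ' ∈ S, conj (c ρ) * c ρ' *
      (if ρ'.im / k - ρ.im / k = 0 then 1 else 0) = ∑ ρ ∈ S, conj (c ρ) * c ρ := by
    refine Finset.sum_congr rfl fun ρ hρ ↦ ?_
    rw [Finset.sum_eq_single ρ]
    · simp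
    · intro ρ' hρ' hne
      rw [if_neg, mul_zero]
      exact fun h ↦ hne (hinj ρ hρ ρ' hρ' h).symm
    · exact fun h ↦ absurd hρ h
  have hsum : (∑ ρ ∈ S, conj (c ρ) * c ρ).re = ∑ ρ ∈ S, ‖c ρ‖ ^ 2 := by
    rw [Complex.re_sum]
    refine Finset.sum_congr rfl fun ρ _ ↦ ?_
    rw [← Complex.normSq_eq_conj_mul_self, Complex.ofReal_re, Complex.normSq_eq_norm_sq]
  rw [hdiag, hsum] at hle
  linarith

/-- The functional equation at ρ/k, together with |1/ζ| = O(|t|^(ε/2)) at 1 - ρ/k, whose real part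
is at least 3/4, gives |ζ(ρ/k)|² ≫ γ^(1 - 1/k - ε). The exponent is 2 minus this one. -/
lemma exists_norm_sq_le_of_im_ge (hRH : RiemannHypothesis) {k : ℕ} (hk : 2 ≤ k) {ε : ℝ}
    (hε : 0 < ε) : ∃ K : ℝ, 0 ≤ K ∧ ∀ ρ : ℂ, ρ.re = 1 / 2 → 3 * k ≤ ρ.im →
      ‖ρ‖ ^ 2 ≤ K * (1 + ρ.im) ^ (1 + 1 / (k : ℝ) + ε) * ‖riemannZeta (ρ / k)‖ ^ 2 := by
  obtain ⟨C, hC, hfe⟩ := exists_norm_riemannZeta_one_sub_bounds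
  obtain ⟨C', hC', hL⟩ := hRH.norm_riemannZeta_le_rpow (η := 1 / 4) (ε := ε / 2)
    (by norm_num) (by linarith)
  have hk2 : (2 : ℝ) ≤ k := by exact_mod_cast hk
  have hk0 : (0 : ℝ) < k := by linarith
  have hinv : 1 / (2 * (k : ℝ)) ≤ 1 / 4 := by
    rw [div_le_div_iff₀ (by positivity) (by norm_num)]; linarith
  refine ⟨4 * k ^ 2 * (C * C') ^ 2, by positivity, fun ρ hre him ↦ ?_⟩
  set γ := ρ.im with hγ
  set y := γ / k with hy
  have hy3 : 3 ≤ y := by rw [hy, le_div_iff₀ hk0]; exact him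
  have hy0 : 0 < y := by linarith
  have hsre : (ρ / k).re = 1 / (2 * (k : ℝ)) := by
    rw [Complex.div_natCast_re, hre]; field_simp
  have hsim : (ρ / k).im = y := by rw [Complex.div_natCast_im]
  have h1 := (hfe (ρ / k) (by rw [hsre]; positivity) (by rw [hsre]; linarith)
    (by rw [hsim, abs_of_pos hy0]; linarith)).2
  have h2 := (hL (1 - ρ / k) (by rw [Complex.sub_re, hsre, Complex.one_re]; linarith) (by
    rw [Complex.sub_im, hsim, Complex.one_im, zero_sub, abs_neg, abs_of_pos hy0]; exact hy3)).2
  rw [Complex.sub_im, hsim, Complex.one_im, zero_sub, abs_neg, abs_of_pos hy0, norm_inv] at h2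
  rw [hsre, hsim, abs_of_pos hy0] at h1
  have hzne : riemannZeta (1 - ρ / k) ≠ 0 := by
    refine hRH.riemannZeta_ne_zero ?_ ?_ <;>
      rw [Complex.sub_re, hsre, Complex.one_re]
    · linarith
    · intro h; linarith
  have hzpos : 0 < ‖riemannZeta (1 - ρ / k)‖ := norm_pos_iff.mpr hzne
  have h3 : 1 ≤ C' * y ^ (ε / 2) * ‖riemannZeta (1 - ρ / k)‖ := by
    rw [inv_le_iff_one_le_mul₀ hzpos] at h2; exact h2
  set a := 1 / 2 - 1 / (2 * (k : ℝ)) with ha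
  have h4 : y ^ a ≤ C * C' * y ^ (ε / 2) * ‖riemannZeta (ρ / k)‖ := by
    have hya : 0 < y ^ a := Real.rpow_pos_of_pos hy0 _
    calc y ^ a ≤ y ^ a * (C' * y ^ (ε / 2) * ‖riemannZeta (1 - ρ / k)‖) :=
          le_mul_of_one_le_right hya.le h3
      _ = C' * y ^ (ε / 2) * (y ^ a * ‖riemannZeta (1 - ρ / k)‖) := by ring
      _ ≤ C' * y ^ (ε / 2) * (C * ‖riemannZeta (ρ / k)‖) := by gcongr
      _ = _ := by ring
  have h5 := pow_le_pow_left₀ (Real.rpow_nonneg hy0.le a) h4 2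
  have hsq : ∀ b : ℝ, (y ^ b) ^ 2 = y ^ (2 * b) := by
    intro b; rw [← Real.rpow_natCast, ← Real.rpow_mul hy0.le]; congr 1; push_cast; ring
  rw [mul_pow, mul_pow, hsq, hsq, show 2 * (ε / 2) = ε by ring] at h5
  have hnorm : ‖ρ‖ ^ 2 ≤ 4 * k ^ 2 * y ^ 2 := by
    rw [← Complex.normSq_eq_norm_sq, Complex.normSq_apply, hre, ← hγ]
    have : γ = k * y := by rw [hy]; field_simp
    rw [this]
    nlinarith [mul_pos hk0 hy0, mul_le_mul hk2 hy3 (by norm_num) hk0.le]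
  have hy2 : y ^ 2 = y ^ (2 * a) * y ^ (1 + 1 / (k : ℝ)) := by
    rw [← Real.rpow_add hy0, ← Real.rpow_natCast]
    congr 1
    rw [ha]; push_cast; field_simp; ring
  have hyγ : y ≤ 1 + γ := by
    have : y ≤ γ := by
      rw [hy]; exact div_le_self (by nlinarith) (by linarith)
    linarith
  have h1k : 0 < 1 / (k : ℝ) := by positivity
  calc ‖ρ‖ ^ 2 ≤ 4 * k ^ 2 * y ^ 2 := hnorm
    _ = 4 * k ^ 2 * (y ^ (2 * a) * y ^ (1 + 1 / (k : ℝ))) := by rw [hy2]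
    _ ≤ 4 * k ^ 2 * ((C * C') ^ 2 * y ^ ε * ‖riemannZeta (ρ / k)‖ ^ 2 *
          y ^ (1 + 1 / (k : ℝ))) := by gcongr
    _ = 4 * k ^ 2 * (C * C') ^ 2 * (y ^ (1 + 1 / (k : ℝ)) * y ^ ε) *
          ‖riemannZeta (ρ / k)‖ ^ 2 := by ring
    _ = 4 * k ^ 2 * (C * C') ^ 2 * y ^ (1 + 1 / (k : ℝ) + ε) * ‖riemannZeta (ρ / k)‖ ^ 2 := by
        rw [← Real.rpow_add hy0]
    _ ≤ _ := by gcongr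

/-- Compactness: under RH ζ has no zero on Re s = 1/(2k). -/
lemma exists_norm_sq_le_of_im_le (hRH : RiemannHypothesis) {k : ℕ} (hk : 2 ≤ k) (b : ℝ) :
    ∃ K : ℝ, 0 ≤ K ∧ ∀ ρ : ℂ, ρ.re = 1 / 2 → 0 ≤ ρ.im → ρ.im ≤ b →
      ‖ρ‖ ^ 2 ≤ K * ‖riemannZeta (ρ / k)‖ ^ 2 := by
  have hk2 : (2 : ℝ) ≤ k := by exact_mod_cast hk
  have hre : ∀ y : ℝ, ((1 / 2 + y * I : ℂ) / k).re = 1 / (2 * k) := by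
    intro y; rw [Complex.div_natCast_re]; simp; field_simp
  have hlt : 1 / (2 * (k : ℝ)) < 1 / 2 := by
    rw [div_lt_div_iff₀ (by positivity) (by norm_num)]; linarith
  have hcont : ContinuousOn (fun y : ℝ ↦ ‖(1 / 2 + y * I : ℂ)‖ ^ 2 /
      ‖riemannZeta ((1 / 2 + y * I) / k)‖ ^ 2) (Icc 0 b) := by
    intro y _
    have hne : (1 / 2 + y * I : ℂ) / k ≠ 1 := by
      intro h
      have := hre y
      rw [h] at this; simp only [Complex.one_re] at this; linarith
    have h0 : riemannZeta ((1 / 2 + y * I) / k) ≠ 0 :=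
      hRH.riemannZeta_ne_zero (by rw [hre]; positivity) (by rw [hre]; exact hlt.ne)
    have h1 : ContinuousAt (fun y : ℝ ↦ riemannZeta ((1 / 2 + y * I) / k)) y :=
      ContinuousAt.comp (f := fun y : ℝ ↦ (1 / 2 + y * I : ℂ) / k)
        (differentiableAt_riemannZeta hne).continuousAt (by fun_prop)
    refine ContinuousAt.continuousWithinAt (ContinuousAt.div ?_ (h1.norm.pow 2) ?_)
    · fun_prop
    · exact pow_ne_zero 2 (norm_ne_zero_iff.mpr h0)
  obtain ⟨K, hK⟩ := (isCompact_Icc.bddAbove_image hcont)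
  refine ⟨max K 0, le_max_right _ _, fun ρ hρ h0 hb ↦ ?_⟩
  have hρe : ρ = 1 / 2 + ρ.im * I := by apply Complex.ext <;> simp [hρ]
  have h1 := hK ⟨ρ.im, ⟨h0, hb⟩, rfl⟩
  simp only [← hρe] at h1
  have hz : riemannZeta (ρ / k) ≠ 0 := by
    rw [hρe]
    exact hRH.riemannZeta_ne_zero (by rw [hre]; positivity) (by rw [hre]; exact hlt.ne)
  rw [div_le_iff₀ (by positivity)] at h1
  refine h1.trans ?_
  gcongr
  exact le_max_left _ _

lemma exists_norm_sq_le (hRH : RiemannHypothesis) {k : ℕ} (hk : 2 ≤ k) {ε : ℝ}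
    (hε : 0 < ε) : ∃ K : ℝ, 0 ≤ K ∧ ∀ ρ : ℂ, ρ.re = 1 / 2 → 0 < ρ.im →
      ‖ρ‖ ^ 2 ≤ K * (1 + ρ.im) ^ (1 + 1 / (k : ℝ) + ε) * ‖riemannZeta (ρ / k)‖ ^ 2 := by
  obtain ⟨K₁, hK₁, h₁⟩ := exists_norm_sq_le_of_im_ge hRH hk hε
  obtain ⟨K₂, hK₂, h₂⟩ := exists_norm_sq_le_of_im_le hRH hk (3 * k)
  refine ⟨max K₁ K₂, le_max_of_le_left hK₁, fun ρ hre him ↦ ?_⟩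
  rcases le_total (3 * (k : ℝ)) ρ.im with h | h
  · refine (h₁ ρ hre h).trans ?_
    gcongr
    exact le_max_left _ _
  · refine (h₂ ρ hre him.le h).trans ?_
    gcongr
    have h1k : 0 ≤ 1 / (k : ℝ) := by positivity
    have : 1 ≤ (1 + ρ.im) ^ (1 + 1 / (k : ℝ) + ε) := Real.one_le_rpow (by linarith) (by linarith)
    calc K₂ ≤ max K₁ K₂ := le_max_right _ _
      _ ≤ _ := le_mul_of_one_le_right (le_max_of_le_left hK₁) this

/-- The mean square bound for the error terms implies the bound for `J_{-1}`. -/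
theorem Jneg1_le_of_mean_square (hRH : RiemannHypothesis)
    (h : ∀ k : ℕ, 2 ≤ k → ∃ C : ℝ, ∀ X : ℝ, 1 ≤ X →
        ∫ x in (1 : ℝ)..X, (errM k x / x ^ (1 / (2 * (k : ℝ)))) ^ 2 / x ≤ C * Real.log X)
    {ε : ℝ} (hε : 0 < ε) :
    ∃ C : ℝ, ∀ T : ℝ, 1 ≤ T → Jneg1 T ≤ ENNReal.ofReal (C * T ^ (1 + ε)) := by
  -- The exponent obtained is 1 + 1/k + ε/2, so k is chosen with 1/k ≤ ε/2; for a given ε a single k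
  -- is used.
  obtain ⟨n, hn⟩ := exists_nat_gt (2 / ε)
  set k := max n 2 with hkdef
  have hk : 2 ≤ k := le_max_right _ _
  have hkε : 1 / (k : ℝ) ≤ ε / 2 := by
    have h1 : 2 / ε < k := hn.trans_le (by exact_mod_cast le_max_left n 2)
    rw [div_lt_iff₀ hε] at h1
    rw [div_le_div_iff₀ (by positivity) (by norm_num)]
    linarith
  obtain ⟨C, hC⟩ := h k hk
  have hC0 : 0 ≤ max C 0 := le_max_right _ _
  have H : ∀ δ : ℝ, 0 < δ → _ := fun δ hδ ↦ weighted_integral_le_of_log_bound (measurable_normErr k)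
    (fun y hy ↦ intervalIntegrable_normErr k hy) hC0 (fun X hX ↦ (hC X hX).trans
      (mul_le_mul_of_nonneg_right (le_max_left _ _) (Real.log_nonneg hX))) hδ
  obtain ⟨K, hK0, hK⟩ := exists_norm_sq_le hRH hk (ε := ε / 2) (by linarith)
  have h1k : 0 ≤ 1 / (k : ℝ) := by positivity
  refine ⟨K * 2 ^ (1 + ε) * max C 0, fun T hT ↦ ?_⟩
  rw [Jneg1, ENNReal.tsum_eq_iSup_sum]
  refine iSup_le fun S ↦ ?_
  have hprop : ∀ ρ : zetaZeros T, riemannZeta (ρ : ℂ) = 0 ∧ 0 < (ρ : ℂ).im := fun ρ ↦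
    ⟨ρ.2.1, ρ.2.2.1⟩
  have hder : ∀ ρ : zetaZeros T, deriv riemannZeta (ρ : ℂ) ≠ 0 := fun ρ ↦
    (tendsto_residue hRH hk H (hprop ρ).1 (hprop ρ).2).1
  have hterm : ∀ ρ : zetaZeros T, (‖deriv riemannZeta (ρ : ℂ)‖ₑ ^ 2)⁻¹ =
      ENNReal.ofReal ((‖deriv riemannZeta (ρ : ℂ)‖ ^ 2)⁻¹) := by
    intro ρ
    have := norm_pos_iff.mpr (hder ρ)
    rw [ENNReal.ofReal_inv_of_pos (by positivity), ENNReal.ofReal_pow (norm_nonneg _),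
      ofReal_norm]
  simp only [hterm]
  rw [← ENNReal.ofReal_sum_of_nonneg (fun _ _ ↦ by positivity)]
  refine ENNReal.ofReal_le_ofReal ?_
  have hsum := sum_residue_sq_le hRH hk H (S.map (Function.Embedding.subtype _)) (by
    intro ρ hρ
    obtain ⟨ρ', _, rfl⟩ := Finset.mem_map.mp hρ
    exact hprop ρ')
  rw [Finset.sum_map] at hsum
  simp only [Function.Embedding.subtype_apply] at hsum
  -- The left side is the squared residue times |ρ|²/|ζ(ρ/k)|². The factor 2^(1+ε) comes from 1 + γ
  -- ≤ 2T.
  have hpt : ∀ ρ : zetaZeros T, (‖deriv riemannZeta (ρ : ℂ)‖ ^ 2)⁻¹ ≤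
      K * 2 ^ (1 + ε) * T ^ (1 + ε) *
        ‖riemannZeta ((ρ : ℂ) / k) / ((ρ : ℂ) * deriv riemannZeta (ρ : ℂ))‖ ^ 2 := by
    intro ρ
    have him := (hprop ρ).2
    have hre := hRH.re_eq (hprop ρ).1 him.ne'
    have hd := norm_pos_iff.mpr (hder ρ)
    have hρ0 : (ρ : ℂ) ≠ 0 := by intro h0; rw [h0] at him; simp at him
    have hρn := norm_pos_iff.mpr hρ0
    have hle : (1 + (ρ : ℂ).im) ^ (1 + 1 / (k : ℝ) + ε / 2) ≤ 2 ^ (1 + ε) * T ^ (1 + ε) := by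
      rw [← Real.mul_rpow (by norm_num) (by linarith)]
      have hT2 : 1 + (ρ : ℂ).im ≤ 2 * T := by linarith [ρ.2.2.2]
      calc _ ≤ (2 * T) ^ (1 + 1 / (k : ℝ) + ε / 2) := by gcongr
        _ ≤ (2 * T) ^ (1 + ε) :=
            Real.rpow_le_rpow_of_exponent_le (by linarith) (by linarith)
    rw [norm_div, norm_mul, div_pow, mul_pow, inv_eq_one_div, ← mul_div_assoc,
      div_le_div_iff₀ (by positivity) (by positivity), one_mul]
    calc ‖(ρ : ℂ)‖ ^ 2 * ‖deriv riemannZeta (ρ : ℂ)‖ ^ 2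
        ≤ K * (1 + (ρ : ℂ).im) ^ (1 + 1 / (k : ℝ) + ε / 2) * ‖riemannZeta ((ρ : ℂ) / k)‖ ^ 2 *
          ‖deriv riemannZeta (ρ : ℂ)‖ ^ 2 := by gcongr; exact hK _ hre him
      _ ≤ K * (2 ^ (1 + ε) * T ^ (1 + ε)) * ‖riemannZeta ((ρ : ℂ) / k)‖ ^ 2 *
          ‖deriv riemannZeta (ρ : ℂ)‖ ^ 2 := by gcongr
      _ = _ := by ring
  have hT0 : (0 : ℝ) ≤ T := by linarith
  calc ∑ ρ ∈ S, (‖deriv riemannZeta (ρ : ℂ)‖ ^ 2)⁻¹ ≤ _ := Finset.sum_le_sum fun ρ _ ↦ hpt ρ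
    _ = K * 2 ^ (1 + ε) * T ^ (1 + ε) * ∑ ρ ∈ S, _ := (Finset.mul_sum _ _ _).symm
    _ ≤ K * 2 ^ (1 + ε) * T ^ (1 + ε) * max C 0 := by gcongr
    _ = _ := by ring

/-! ### Zeros in discs, and heights where 1/ζ is not large -/

/-- On the circle R² = conj(z - c)(z - c), so the expression factors as conj(z - a)(z - c). The
quotient by R(z - a) thus has modulus one there. -/
lemma norm_blaschke_sphere {c a z : ℂ} {R : ℝ} (hz : ‖z - c‖ = R) :
    ‖(R : ℂ) ^ 2 - conj (a - c) * (z - c)‖ = R * ‖z - a‖ := by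
  have h1 : (R : ℂ) ^ 2 = conj (z - c) * (z - c) := by
    rw [← Complex.normSq_eq_conj_mul_self, Complex.normSq_eq_norm_sq, hz]; push_cast; rfl
  rw [h1, ← sub_mul, ← map_sub, norm_mul, Complex.norm_conj, hz, mul_comm]
  congr 2
  ring

lemma norm_le_of_sphere {g : ℂ → ℂ} {c : ℂ} {R R' M : ℝ} (hR : 0 < R) (hRR : R < R')
    (hg : DifferentiableOn ℂ g (Metric.ball c R')) (hM : ∀ z, ‖z - c‖ = R → ‖g z‖ ≤ M) {z : ℂ}
    (hz : ‖z - c‖ ≤ R) : ‖g z‖ ≤ M := by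
  refine Complex.norm_le_of_forall_mem_frontier_norm_le (U := Metric.ball c R)
    Metric.isBounded_ball ?_ ?_ ?_
  · refine DifferentiableOn.diffContOnCl (hg.mono ?_)
    rw [closure_ball c hR.ne']
    exact Metric.closedBall_subset_ball hRR
  · intro w hw
    rw [frontier_ball c hR.ne'] at hw
    exact hM w (by rwa [mem_sphere_iff_norm] at hw)
  · rw [closure_ball c hR.ne', mem_closedBall_iff_norm]; exact hz

/-- Division by a finite Blaschke product. -/
lemma exists_blaschke_quotient {f : ℂ → ℂ} {c : ℂ} {R R' M : ℝ} (hR : 0 < R) (hRR : R < R')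
    (hf : DifferentiableOn ℂ f (Metric.ball c R')) (hM : ∀ z, ‖z - c‖ = R → ‖f z‖ ≤ M)
    (Z : Finset ℂ) (hZ : ∀ ρ ∈ Z, f ρ = 0 ∧ ‖ρ - c‖ < R) :
    ∃ g : ℂ → ℂ, DifferentiableOn ℂ g (Metric.ball c R') ∧ (∀ z, ‖z - c‖ = R → ‖g z‖ ≤ M) ∧
      ∀ z, f z * ∏ ρ ∈ Z, ((R : ℂ) ^ 2 - conj (ρ - c) * (z - c)) =
        g z * ∏ ρ ∈ Z, ((R : ℂ) * (z - ρ)) := by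
  classical
  induction Z using Finset.induction_on with
  | empty => exact ⟨f, hf, hM, by simp⟩
  | insert a Z ha ih =>
    obtain ⟨g, hg, hgM, hfg⟩ := ih fun ρ hρ ↦ hZ ρ (Finset.mem_insert_of_mem hρ)
    obtain ⟨hfa, hac⟩ := hZ a (Finset.mem_insert_self a Z)
    have hRc : (R : ℂ) ≠ 0 := Complex.ofReal_ne_zero.mpr hR.ne'
    have hga : g a = 0 := by
      have h1 := hfg a
      rw [hfa, zero_mul, eq_comm, mul_eq_zero] at h1
      refine h1.resolve_right (Finset.prod_ne_zero_iff.mpr fun ρ hρ ↦ mul_ne_zero hRc ?_)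
      exact sub_ne_zero.mpr fun h ↦ ha (h ▸ hρ)
    have hnhds : Metric.ball c R' ∈ 𝓝 a := by
      refine Metric.isOpen_ball.mem_nhds ?_
      rw [mem_ball_iff_norm]; linarith
    have hds : ∀ z, (z - a) * dslope g a z = g z := by
      intro z; simpa [hga] using sub_smul_dslope g a z
    -- One Blaschke factor is divided out, `dslope` removing the zero at a. The identity is kept in
    -- product form so that it also holds at the zeros.
    refine ⟨fun z ↦ dslope g a z * ((R : ℂ) ^ 2 - conj (a - c) * (z - c)) / R, ?_, ?_, ?_⟩
    · have := (Complex.differentiableOn_dslope hnhds).mpr hg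
      exact (this.mul (by fun_prop)).div_const _
    · intro z hz
      rw [norm_div, norm_mul, norm_blaschke_sphere hz, Complex.norm_real,
        Real.norm_of_nonneg hR.le]
      have : ‖dslope g a z‖ * (R * ‖z - a‖) / R = ‖g z‖ := by
        rw [← hds z, norm_mul]; field_simp
      rw [this]
      exact hgM z hz
    · intro z
      rw [Finset.prod_insert ha, Finset.prod_insert ha]
      have h1 := hfg z
      rw [← hds z] at h1
      generalize ∏ ρ ∈ Z, ((R : ℂ) ^ 2 - conj (ρ - c) * (z - c)) = P at h1 ⊢
      generalize ∏ ρ ∈ Z, ((R : ℂ) * (z - ρ)) = Q at h1 ⊢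
      field_simp
      linear_combination ((R : ℂ) ^ 2 - conj (a - c) * (z - c)) * h1

/-- Jensen's bound for the number of zeros in a disc. -/
lemma pow_card_mul_norm_le {f : ℂ → ℂ} {c : ℂ} {r R R' M : ℝ} (hr : 0 < r) (hrR : r < R)
    (hRR : R < R')
    (hf : DifferentiableOn ℂ f (Metric.ball c R')) (hM : ∀ z, ‖z - c‖ = R → ‖f z‖ ≤ M)
    (Z : Finset ℂ) (hZ : ∀ ρ ∈ Z, f ρ = 0 ∧ ‖ρ - c‖ ≤ r) :
    (R / r) ^ Z.card * ‖f c‖ ≤ M := by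
  have hR : 0 < R := hr.trans hrR
  obtain ⟨g, hg, hgM, hfg⟩ := exists_blaschke_quotient hR hRR hf hM Z
    fun ρ hρ ↦ ⟨(hZ ρ hρ).1, (hZ ρ hρ).2.trans_lt hrR⟩
  have hgc := norm_le_of_sphere hR hRR hg hgM (z := c) (by simpa using hR.le)
  -- At the centre every zero enlarges |g(c)| against |f(c)| by the factor R/|c - ρ| ≥ R/r.
  have h1 := congrArg norm (hfg c)
  rw [norm_mul, norm_mul, norm_prod, norm_prod] at h1
  simp only [sub_self, mul_zero, sub_zero, norm_pow, Complex.norm_real, Real.norm_of_nonneg hR.le,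
    Finset.prod_const, norm_mul] at h1
  have h2 : ∏ ρ ∈ Z, (R * ‖c - ρ‖) ≤ (R * r) ^ Z.card := by
    rw [← Finset.prod_const]
    refine Finset.prod_le_prod (fun ρ _ ↦ by positivity) fun ρ hρ ↦ ?_
    rw [norm_sub_rev]
    gcongr
    exact (hZ ρ hρ).2
  have hM0 : 0 ≤ M := (norm_nonneg _).trans hgc
  have h3 : ‖f c‖ * (R ^ 2) ^ Z.card ≤ M * (R * r) ^ Z.card := by
    rw [h1]; gcongr
  have h4 : (R ^ 2) ^ Z.card = (R / r) ^ Z.card * (R * r) ^ Z.card := by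
    rw [← mul_pow]; congr 1; field_simp
  rw [h4, ← mul_assoc, mul_comm ‖f c‖] at h3
  exact le_of_mul_le_mul_right h3 (by positivity)

lemma norm_blaschke_pos {c a z : ℂ} {R : ℝ} (ha : ‖a - c‖ < R) (hz : ‖z - c‖ ≤ R) :
    (R : ℂ) ^ 2 - conj (a - c) * (z - c) ≠ 0 := by
  intro h
  have hR : 0 < R := (norm_nonneg _).trans_lt ha
  have h1 := congrArg norm (sub_eq_zero.mp h)
  rw [norm_pow, Complex.norm_real, Real.norm_of_nonneg hR.le, norm_mul, Complex.norm_conj] at h1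
  nlinarith [norm_nonneg (a - c), norm_nonneg (z - c)]

lemma norm_blaschke_le {c a z : ℂ} {R : ℝ} (hR : 0 < R) (ha : ‖a - c‖ ≤ R) (hz : ‖z - c‖ ≤ R) :
    ‖(R : ℂ) ^ 2 - conj (a - c) * (z - c)‖ ≤ 2 * R ^ 2 := by
  refine (norm_sub_le _ _).trans ?_
  rw [norm_pow, Complex.norm_real, Real.norm_of_nonneg hR.le, norm_mul, Complex.norm_conj]
  nlinarith [norm_nonneg (a - c), norm_nonneg (z - c), mul_le_mul ha hz (norm_nonneg _) hR.le]

/-- A lower bound for a holomorphic function with simple zeros, in terms of its distance from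
these zeros. -/
lemma norm_inv_le_of_simple_zeros {f : ℂ → ℂ} {c : ℂ} {r r₁ R R' M : ℝ} (hr : 0 < r)
    (hrr : r < r₁) (hrR : r₁ < R) (hRR : R < R') (hM1 : 1 < M)
    (hf : DifferentiableOn ℂ f (Metric.ball c R')) (hM : ∀ z, ‖z - c‖ = R → ‖f z‖ ≤ M)
    (hfc : 1 ≤ M * ‖f c‖)
    (Z : Finset ℂ) (hZ : ∀ ρ, ρ ∈ Z ↔ f ρ = 0 ∧ ‖ρ - c‖ ≤ r₁) (hsimple : ∀ ρ ∈ Z, deriv f ρ ≠ 0)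
    {z : ℂ} (hz : ‖z - c‖ ≤ r) :
    (∏ ρ ∈ Z, ‖z - ρ‖) ≤ ‖f z‖ * (2 * R) ^ Z.card *
      Real.exp ((4 * Real.log M + 2 * Real.pi) * r₁ / (r₁ - r)) := by
  have hr1 : 0 < r₁ := hr.trans hrr
  have hR : 0 < R := hr1.trans hrR
  have hlogM : 0 < Real.log M := Real.log_pos hM1
  have hRc : (R : ℂ) ≠ 0 := Complex.ofReal_ne_zero.mpr hR.ne'
  have hZ' : ∀ ρ ∈ Z, f ρ = 0 ∧ ‖ρ - c‖ < R := fun ρ hρ ↦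
    ⟨((hZ ρ).mp hρ).1, ((hZ ρ).mp hρ).2.trans_lt hrR⟩
  obtain ⟨g, hg, hgM, hfg⟩ := exists_blaschke_quotient hR hRR hf hM Z hZ'
  have hgM' : ∀ w, ‖w - c‖ ≤ R → ‖g w‖ ≤ M := fun w hw ↦ norm_le_of_sphere hR hRR hg hgM hw
  have hprod : ∀ w, ‖w - c‖ ≤ R → ∏ ρ ∈ Z, ((R : ℂ) ^ 2 - conj (ρ - c) * (w - c)) ≠ 0 :=
    fun w hw ↦ Finset.prod_ne_zero_iff.mpr fun ρ hρ ↦ norm_blaschke_pos (hZ' ρ hρ).2 hw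
  have hsub : Metric.ball c r₁ ⊆ Metric.ball c R' := Metric.ball_subset_ball (by linarith)
  -- `g` does not vanish
  have hg0 : ∀ w ∈ Metric.ball c r₁, g w ≠ 0 := by
    intro w hw hgw
    have hwn : ‖w - c‖ < r₁ := by rwa [mem_ball_iff_norm] at hw
    have h1 := hfg w
    rw [hgw, zero_mul, mul_eq_zero] at h1
    have hfw := h1.resolve_right (hprod w (by linarith))
    have hwZ : w ∈ Z := (hZ w).mpr ⟨hfw, hwn.le⟩
    -- The product identity is differentiated at w, which is one of the listed zeros. On the right
    -- both factors vanish at w, so the derivative is 0. On the left it is f'(w), nonzero by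
    -- simplicity, times a nonzero product.
    have hd1 := ((hf.differentiableAt (Metric.isOpen_ball.mem_nhds (hsub hw))).hasDerivAt).mul
      (show DifferentiableAt ℂ
        (fun w ↦ ∏ ρ ∈ Z, ((R : ℂ) ^ 2 - conj (ρ - c) * (w - c))) w by fun_prop).hasDerivAt
    have hd2 := ((hg.differentiableAt (Metric.isOpen_ball.mem_nhds (hsub hw))).hasDerivAt).mul
      (show DifferentiableAt ℂ (fun w ↦ ∏ ρ ∈ Z, ((R : ℂ) * (w - ρ))) w by fun_prop).hasDerivAt
    have heq : (f * fun w ↦ ∏ ρ ∈ Z, ((R : ℂ) ^ 2 - conj (ρ - c) * (w - c))) =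
        g * fun w ↦ ∏ ρ ∈ Z, ((R : ℂ) * (w - ρ)) := funext hfg
    rw [heq] at hd1
    have hu := hd1.unique hd2
    have hzero : ∏ ρ ∈ Z, ((R : ℂ) * (w - ρ)) = 0 :=
      Finset.prod_eq_zero hwZ (by simp)
    rw [hfw, hgw, hzero, zero_mul, add_zero, zero_mul, add_zero, mul_zero] at hu
    exact mul_ne_zero (hsimple w hwZ) (hprod w (by linarith)) hu
  obtain ⟨L, hLd, hLc, hLe⟩ := exists_log_ball (hg.mono hsub) hg0 hr1
  have hcball : c ∈ Metric.ball c r₁ := Metric.mem_ball_self hr1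
  have hgc : ‖(g c)⁻¹‖ ≤ M := by
    have h1 := congrArg norm (hfg c)
    rw [norm_mul, norm_mul, norm_prod, norm_prod] at h1
    simp only [sub_self, mul_zero, sub_zero, norm_pow, Complex.norm_real,
      Real.norm_of_nonneg hR.le, Finset.prod_const, norm_mul] at h1
    have h2 : ∏ ρ ∈ Z, (R * ‖c - ρ‖) ≤ (R ^ 2) ^ Z.card := by
      rw [← Finset.prod_const]
      refine Finset.prod_le_prod (fun ρ _ ↦ by positivity) fun ρ hρ ↦ ?_
      rw [norm_sub_rev, sq]
      gcongr
      exact (hZ' ρ hρ).2.le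
    have h3 : ‖f c‖ ≤ ‖g c‖ := by
      have : ‖f c‖ * (R ^ 2) ^ Z.card ≤ ‖g c‖ * (R ^ 2) ^ Z.card := by rw [h1]; gcongr
      exact le_of_mul_le_mul_right this (by positivity)
    have h4 : 0 < ‖g c‖ := norm_pos_iff.mpr (hg0 c hcball)
    rw [norm_inv, inv_le_iff_one_le_mul₀ h4]
    refine hfc.trans ?_
    gcongr
  have hLcn : ‖L c‖ ≤ Real.log M + Real.pi := by
    rw [hLc]
    exact norm_log_le (hgM' c (by simpa using hR.le)) hgc (hg0 c hcball)
  have hLz := norm_log_le_of_norm_le hr1 hlogM hLd hLe (fun w hw ↦ by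
    rw [Real.exp_log (by linarith)]
    rw [mem_ball_iff_norm] at hw
    exact hgM' w (by linarith)) hrr hz
  -- The bound log M + π for L(c) contributes 2 log M + 2π, and the Borel–Carathéodory term
  -- contributes the other 2 log M.
  have hLz' : ‖L z‖ ≤ (4 * Real.log M + 2 * Real.pi) * r₁ / (r₁ - r) := by
    refine hLz.trans (div_le_div_of_nonneg_right ?_ (by linarith))
    nlinarith
  have hzb : z ∈ Metric.ball c r₁ := by rw [mem_ball_iff_norm]; linarith
  have hgz : 1 ≤ ‖g z‖ * Real.exp ((4 * Real.log M + 2 * Real.pi) * r₁ / (r₁ - r)) := by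
    rw [← hLe z hzb, Complex.norm_exp, ← Real.exp_add]
    refine Real.one_le_exp ?_
    have := (abs_le.mp (Complex.abs_re_le_norm (L z))).1
    linarith
  set E := Real.exp ((4 * Real.log M + 2 * Real.pi) * r₁ / (r₁ - r)) with hE
  have h1 := congrArg norm (hfg z)
  rw [norm_mul, norm_mul, norm_prod, norm_prod] at h1
  have hzR : ‖z - c‖ ≤ R := by linarith
  have h2 : ∏ ρ ∈ Z, ‖(R : ℂ) ^ 2 - conj (ρ - c) * (z - c)‖ ≤ (2 * R ^ 2) ^ Z.card := by
    rw [← Finset.prod_const]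
    exact Finset.prod_le_prod (fun ρ _ ↦ norm_nonneg _) fun ρ hρ ↦
      norm_blaschke_le hR (hZ' ρ hρ).2.le hzR
  have h3 : ∏ ρ ∈ Z, ‖(R : ℂ) * (z - ρ)‖ = R ^ Z.card * ∏ ρ ∈ Z, ‖z - ρ‖ := by
    simp only [norm_mul, Complex.norm_real, Real.norm_of_nonneg hR.le]
    rw [Finset.prod_mul_distrib, Finset.prod_const]
  rw [h3] at h1
  have hP0 : 0 ≤ ∏ ρ ∈ Z, ‖z - ρ‖ := Finset.prod_nonneg fun _ _ ↦ norm_nonneg _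
  have h5 : R ^ Z.card * ∏ ρ ∈ Z, ‖z - ρ‖ ≤ R ^ Z.card * (‖f z‖ * (2 * R) ^ Z.card * E) := by
    calc R ^ Z.card * ∏ ρ ∈ Z, ‖z - ρ‖
        ≤ (R ^ Z.card * ∏ ρ ∈ Z, ‖z - ρ‖) * (‖g z‖ * E) :=
          le_mul_of_one_le_right (by positivity) hgz
      _ = (‖g z‖ * (R ^ Z.card * ∏ ρ ∈ Z, ‖z - ρ‖)) * E := by ring
      _ ≤ (‖f z‖ * (2 * R ^ 2) ^ Z.card) * E := by rw [← h1]; gcongr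
      _ = R ^ Z.card * (‖f z‖ * (2 * R) ^ Z.card * E) := by
          rw [show 2 * R ^ 2 = R * (2 * R) by ring, mul_pow R]; ring
  exact le_of_mul_le_mul_left h5 (by positivity)

lemma abs_mul_log_le {x : ℝ} (hx : |x| ≤ 2) : |x * Real.log x| ≤ 2 := by
  rw [abs_mul, ← Real.log_abs x]
  rcases (abs_nonneg x).eq_or_lt with h | h
  · rw [← h]; simp
  rcases le_total |x| 1 with h1 | h1
  · have := Real.abs_log_mul_self_lt |x| h h1
    rw [abs_mul, abs_abs, mul_comm] at this
    linarith
  · have h2 := Real.log_le_sub_one_of_pos h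
    rw [abs_of_nonneg (Real.log_nonneg h1)]
    nlinarith [Real.log_nonneg h1]

/-- A product of distances to given points is not too small somewhere in an interval. -/
lemma exists_sum_log_ge (Z : Finset ℂ) (τ : ℝ) (hZ : ∀ ρ ∈ Z, |ρ.im - τ| ≤ 1) :
    ∃ y : ℝ, |y - τ| ≤ 1 / 8 ∧ (∀ ρ ∈ Z, y ≠ ρ.im) ∧
      -(20 * (Z.card : ℝ)) ≤ ∑ ρ ∈ Z, Real.log (y - ρ.im) := by
  set a := τ - 1 / 8 with ha
  set b := τ + 1 / 8 with hb
  have hab : a ≤ b := by linarith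
  have hint : ∀ ρ ∈ Z, IntervalIntegrable (fun y ↦ Real.log (y - ρ.im)) volume a b := by
    intro ρ _
    have := (intervalIntegral.intervalIntegrable_log' (a := a - ρ.im) (b := b - ρ.im)).comp_sub_right
      ρ.im
    simpa using this
  -- The primitive is x log x - x. Both values of x log x are at most 2 in modulus and the interval
  -- has length 1/4. Averaging over this length turns -5 into -20.
  have hlow : ∀ ρ ∈ Z, -5 ≤ ∫ y in a..b, Real.log (y - ρ.im) := by
    intro ρ hρ
    have h1 := abs_le.mp (hZ ρ hρ)
    rw [intervalIntegral.integral_comp_sub_right (fun x ↦ Real.log x), integral_log]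
    have h2 := abs_le.mp (abs_mul_log_le (x := b - ρ.im) (by rw [abs_le]; constructor <;> linarith))
    have h3 := abs_le.mp (abs_mul_log_le (x := a - ρ.im) (by rw [abs_le]; constructor <;> linarith))
    linarith
  have hsum : -5 * (Z.card : ℝ) ≤ ∫ y in a..b, ∑ ρ ∈ Z, Real.log (y - ρ.im) := by
    rw [intervalIntegral.integral_finsetSum hint]
    have := Finset.card_nsmul_le_sum Z _ _ hlow
    rw [nsmul_eq_mul] at this
    linarith
  have hI : IntegrableOn (fun y ↦ ∑ ρ ∈ Z, Real.log (y - ρ.im)) (Ioc a b) :=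
    (intervalIntegrable_iff_integrableOn_Ioc_of_le hab).mp
      (by simpa only [Finset.sum_fn] using IntervalIntegrable.sum Z hint)
  have hvol : volume (Ioc a b) = ENNReal.ofReal (1 / 4) := by
    rw [Real.volume_Ioc]; congr 1; rw [ha, hb]; ring
  have hμ : volume.restrict (Ioc a b) ≠ 0 := by
    rw [Ne, Measure.restrict_eq_zero, hvol]; simp
  -- Outside a null set some y reaches the average. The null set also contains the ordinates, where
  -- the logarithm is 0 by convention and would carry no information.
  obtain ⟨y, hyN, hy⟩ := exists_notMem_null_average_le
    (N := (Ioc a b)ᶜ ∪ ((Z.image Complex.im : Finset ℝ) : Set ℝ)) hμ hI (by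
      refine measure_union_null ?_ ?_
      · rw [Measure.restrict_apply measurableSet_Ioc.compl]; simp
      · exact (Finset.finite_toSet _).measure_zero _)
  rw [mem_union, not_or, mem_compl_iff, not_not] at hyN
  refine ⟨y, ?_, ?_, ?_⟩
  · rw [abs_le]; constructor <;> linarith [hyN.1.1, hyN.1.2]
  · intro ρ hρ h
    exact hyN.2 (by simpa using ⟨ρ, hρ, h.symm⟩)
  · rw [average_eq, ← intervalIntegral.integral_of_le hab, measureReal_restrict_apply_univ,
      Measure.real, hvol, ENNReal.toReal_ofReal (by norm_num), smul_eq_mul] at hy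
    linarith

/-- The radii about 2 + iτ in this part are 33/20 < 7/4 < 15/8 < 31/16. All are below 2, so the
discs stay in Re s > 0, and all exceed 3/2, the distance to the critical line. -/
lemma norm_riemannZeta_le_on_sphere {τ : ℝ} (hτ : 4 ≤ τ) {z : ℂ}
    (hz : ‖z - (2 + τ * I)‖ = 15 / 8) : ‖riemannZeta z‖ ≤ τ ^ 4 := by
  have h1 := (Complex.abs_re_le_norm (z - (2 + τ * I))).trans_eq hz
  have h2 := (Complex.abs_im_le_norm (z - (2 + τ * I))).trans_eq hz
  simp only [sub_re, add_re, re_ofNat, mul_re, ofReal_re, I_re, mul_zero, ofReal_im, I_im,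
    sub_im, add_im, im_ofNat, mul_im, mul_one, add_zero, sub_zero, zero_add] at h1 h2
  rw [abs_le] at h1 h2
  have hre : 1 / 8 ≤ z.re := by linarith
  have him : 1 ≤ z.im := by linarith
  have hn : ‖z‖ ≤ τ + 8 := by
    refine (Complex.norm_le_abs_re_add_abs_im z).trans ?_
    rw [abs_of_nonneg (by linarith), abs_of_nonneg (by linarith)]
    linarith
  have h3 := norm_riemannZeta_le (s := z) (by linarith) (by rw [abs_of_nonneg] <;> linarith)
  have h4 : ‖z‖ / z.re ≤ (τ + 8) / (1 / 8) := by gcongr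
  have h5 : (64 : ℝ) * τ ≤ τ ^ 4 := by
    have : (4 : ℝ) ^ 3 ≤ τ ^ 3 := by gcongr
    nlinarith
  linarith

lemma norm_inv_riemannZeta_two_le (τ : ℝ) : ‖(riemannZeta (2 + τ * I))⁻¹‖ ≤ 4 := by
  have h1 := (norm_riemannZeta_le_tsum (σ := 2) (by norm_num) (s := 2 + τ * I) (by simp)).2
  refine h1.trans ?_
  have h2 : ∑' n : ℕ, 1 / (n : ℝ) ^ (2 : ℝ) = Real.pi ^ 2 / 6 := by
    rw [← hasSum_zeta_two.tsum_eq]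
    norm_num
  rw [h2]
  nlinarith [Real.pi_lt_four, Real.pi_pos]

lemma one_le_pow_mul_norm_riemannZeta {τ : ℝ} (hτ : 4 ≤ τ) :
    1 ≤ τ ^ 4 * ‖riemannZeta (2 + τ * I)‖ := by
  have h0 : 0 < ‖riemannZeta (2 + τ * I)‖ :=
    norm_pos_iff.mpr (riemannZeta_ne_zero_of_one_le_re (by simp))
  have h1 := norm_inv_riemannZeta_two_le τ
  rw [norm_inv, inv_le_iff_one_le_mul₀ h0] at h1
  have h2 : (4 : ℝ) ≤ τ ^ 4 := by
    calc (4 : ℝ) ≤ 4 ^ 4 := by norm_num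
      _ ≤ τ ^ 4 := by gcongr
  nlinarith

lemma differentiableOn_riemannZeta_ball {τ : ℝ} (hτ : 4 ≤ τ) :
    DifferentiableOn ℂ riemannZeta (Metric.ball (2 + τ * I) (31 / 16)) := by
  intro z hz
  refine (differentiableAt_riemannZeta ?_).differentiableWithinAt
  rintro rfl
  rw [mem_ball_iff_norm] at hz
  have h2 := (Complex.abs_im_le_norm (1 - (2 + τ * I))).trans_lt hz
  simp at h2
  rw [abs_of_nonneg (by linarith)] at h2
  linarith

/-- Jensen's bound with ratio of radii 15/14: as |ζ(2 + iτ)| ≥ τ^(-4), one gets (15/14)^N ≤ τ⁸. -/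
lemma card_le_of_pow_le {N : ℕ} {τ : ℝ} (hτ : 4 ≤ τ)
    (h : (15 / 8 / (7 / 4) : ℝ) ^ N * ‖riemannZeta (2 + τ * I)‖ ≤ τ ^ 4) :
    (N : ℝ) ≤ 8 / Real.log (15 / 14) * Real.log τ := by
  have hl : 0 < Real.log (15 / 14) := Real.log_pos (by norm_num)
  have h1 := one_le_pow_mul_norm_riemannZeta hτ
  have h0 : 0 < ‖riemannZeta (2 + τ * I)‖ :=
    norm_pos_iff.mpr (riemannZeta_ne_zero_of_one_le_re (by simp))
  have h2 : (15 / 14 : ℝ) ^ N ≤ τ ^ 8 := by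
    rw [show (15 / 8 / (7 / 4) : ℝ) = 15 / 14 by norm_num] at h
    calc (15 / 14 : ℝ) ^ N ≤ (15 / 14 : ℝ) ^ N * (τ ^ 4 * ‖riemannZeta (2 + τ * I)‖) :=
          le_mul_of_one_le_right (by positivity) h1
      _ = τ ^ 4 * ((15 / 14 : ℝ) ^ N * ‖riemannZeta (2 + τ * I)‖) := by ring
      _ ≤ τ ^ 4 * τ ^ 4 := by gcongr
      _ = τ ^ 8 := by ring
  have h3 := Real.log_le_log (by positivity) h2
  rw [Real.log_pow, Real.log_pow] at h3
  rw [div_mul_eq_mul_div, le_div_iff₀ hl]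
  exact_mod_cast h3

lemma RiemannHypothesis.norm_sub_sq (hRH : RiemannHypothesis) {ρ : ℂ} (hρ : riemannZeta ρ = 0)
    (him : ρ.im ≠ 0) (τ : ℝ) : ‖ρ - (2 + τ * I)‖ ^ 2 = 9 / 4 + (ρ.im - τ) ^ 2 := by
  rw [← Complex.normSq_eq_norm_sq, Complex.normSq_apply]
  simp [hRH.re_eq hρ him]
  ring

/-- The number of zeros of zeta in a window of bounded length at height `τ` is `O(log τ)`. -/
lemma RiemannHypothesis.card_zeros_le (hRH : RiemannHypothesis) {τ : ℝ} (hτ : 4 ≤ τ)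
    (Z : Finset ℂ) (hZ : ∀ ρ ∈ Z, riemannZeta ρ = 0 ∧ |ρ.im - τ| ≤ 1 / 2) :
    (Z.card : ℝ) ≤ 8 / Real.log (15 / 14) * Real.log τ := by
  refine card_le_of_pow_le hτ (pow_card_mul_norm_le (by norm_num) (by norm_num)
    (show (15 / 8 : ℝ) < 31 / 16 by norm_num) (differentiableOn_riemannZeta_ball hτ)
    (fun z hz ↦ norm_riemannZeta_le_on_sphere hτ hz) Z fun ρ hρ ↦ ⟨(hZ ρ hρ).1, ?_⟩)
  have h1 := abs_le.mp (hZ ρ hρ).2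
  have h2 := hRH.norm_sub_sq (hZ ρ hρ).1 (by linarith : 0 < ρ.im).ne' τ
  nlinarith [norm_nonneg (ρ - (2 + τ * I))]

lemma finite_zeros_closedBall (c : ℂ) (r : ℝ) :
    {ρ : ℂ | riemannZeta ρ = 0 ∧ ‖ρ - c‖ ≤ r}.Finite := by
  refine (IsCompact.inter_riemannZetaZeros_finite (isCompact_closedBall c r)).subset ?_
  intro ρ hρ
  exact ⟨mem_closedBall_iff_norm.mpr hρ.2, hρ.1⟩

/-- Near every height there is a horizontal segment across the critical line on which `1 / ζ`
is polynomially bounded. -/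
lemma RiemannHypothesis.exists_good_height (hRH : RiemannHypothesis)
    (hsimple : ∀ ρ, riemannZeta ρ = 0 → 0 < ρ.im → deriv riemannZeta ρ ≠ 0) :
    ∃ A : ℝ, 0 < A ∧ ∀ τ : ℝ, 4 ≤ τ → ∃ y : ℝ, |y - τ| ≤ 1 / 8 ∧
      (∀ z : ℂ, 3 / 8 ≤ z.re → z.re ≤ 5 / 8 → z.im = y → ‖(riemannZeta z)⁻¹‖ ≤ τ ^ A) ∧
      ∀ ρ, riemannZeta ρ = 0 → 0 < ρ.im → τ ^ (-A) ≤ |y - ρ.im| := by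
  set C := 8 / Real.log (15 / 14) with hC
  have hC0 : 0 < C := div_pos (by norm_num) (Real.log_pos (by norm_num))
  -- With N ≤ C log τ zeros, 20 N comes from the product of distances and 2 N from (15/4)^N ≤
  -- e^(2N). The term 420 log τ bounds the Borel–Carathéodory exponent 17.5 (16 log τ + 2π), as π <
  -- 4 and log τ ≥ 1.
  refine ⟨22 * C + 420, by positivity, fun τ hτ ↦ ?_⟩
  have hτ0 : 0 < τ := by linarith
  have hlog : 1 ≤ Real.log τ := by
    rw [Real.le_log_iff_exp_le hτ0]
    linarith [Real.exp_one_lt_d9]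
  set c : ℂ := 2 + τ * I with hc
  set Z := (finite_zeros_closedBall c (7 / 4)).toFinset with hZdef
  have hZ : ∀ ρ, ρ ∈ Z ↔ riemannZeta ρ = 0 ∧ ‖ρ - c‖ ≤ 7 / 4 := by
    intro ρ; simp [hZdef]
  have hdiff := differentiableOn_riemannZeta_ball hτ
  have hsph : ∀ z, ‖z - c‖ = 15 / 8 → ‖riemannZeta z‖ ≤ τ ^ 4 :=
    fun z hz ↦ norm_riemannZeta_le_on_sphere hτ hz
  have hN : (Z.card : ℝ) ≤ C * Real.log τ :=
    card_le_of_pow_le hτ (pow_card_mul_norm_le (by norm_num) (by norm_num)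
      (show (15 / 8 : ℝ) < 31 / 16 by norm_num) hdiff hsph Z fun ρ hρ ↦ (hZ ρ).mp hρ)
  have him : ∀ ρ ∈ Z, 0 < ρ.im := by
    intro ρ hρ
    have h1 := (Complex.abs_im_le_norm (ρ - c)).trans ((hZ ρ).mp hρ).2
    rw [abs_le] at h1
    simp [hc] at h1
    linarith
  have hZ1 : ∀ ρ ∈ Z, |ρ.im - τ| ≤ 1 := by
    intro ρ hρ
    have h1 := hRH.norm_sub_sq ((hZ ρ).mp hρ).1 (him ρ hρ).ne' τ
    have h2 := ((hZ ρ).mp hρ).2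
    rw [← sq_le_one_iff_abs_le_one]
    nlinarith [norm_nonneg (ρ - c)]
  obtain ⟨y, hy, hyne, hylog⟩ := exists_sum_log_ge Z τ hZ1
  have hy' := abs_le.mp hy
  have hlogle : ∀ ρ ∈ Z, Real.log (y - ρ.im) ≤ 1 := by
    intro ρ hρ
    have h1 := abs_le.mp (hZ1 ρ hρ)
    rw [← Real.log_abs]
    have h2 : |y - ρ.im| ≤ 2 := by rw [abs_le]; constructor <;> linarith
    have h3 := Real.log_le_sub_one_of_pos (abs_pos.mpr (sub_ne_zero.mpr (hyne ρ hρ)))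
    linarith
  refine ⟨y, hy, ?_, ?_⟩
  · intro z hz1 hz2 hzy
    -- The farthest points have squared distance at most (13/8)² + (1/8)².
    have hzc : ‖z - c‖ ≤ 33 / 20 := by
      have : ‖z - c‖ ^ 2 = (z.re - 2) ^ 2 + (y - τ) ^ 2 := by
        rw [← Complex.normSq_eq_norm_sq, Complex.normSq_apply]
        simp [hc, hzy]
        ring
      have h2 : (y - τ) ^ 2 ≤ (1 / 8) ^ 2 := by
        rw [← sq_abs]; gcongr
      have h3 : (z.re - 2) ^ 2 ≤ (13 / 8) ^ 2 := by nlinarith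
      nlinarith [norm_nonneg (z - c)]
    have hmain := norm_inv_le_of_simple_zeros (f := riemannZeta) (r := 33 / 20) (r₁ := 7 / 4)
      (by norm_num) (by norm_num) (by norm_num) (show (15 / 8 : ℝ) < 31 / 16 by norm_num)
      (one_lt_pow₀ (by linarith : (1 : ℝ) < τ) (by norm_num)) hdiff hsph
      (one_le_pow_mul_norm_riemannZeta hτ) Z hZ
      (fun ρ hρ ↦ hsimple ρ ((hZ ρ).mp hρ).1 (him ρ hρ)) hzc
    have hprod : Real.exp (-(20 * (Z.card : ℝ))) ≤ ∏ ρ ∈ Z, ‖z - ρ‖ := by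
      calc Real.exp (-(20 * (Z.card : ℝ))) ≤ Real.exp (∑ ρ ∈ Z, Real.log (y - ρ.im)) :=
            Real.exp_le_exp.mpr hylog
        _ = ∏ ρ ∈ Z, |y - ρ.im| := by
            rw [Real.exp_sum]
            refine Finset.prod_congr rfl fun ρ hρ ↦ ?_
            rw [← Real.log_abs, Real.exp_log (abs_pos.mpr (sub_ne_zero.mpr (hyne ρ hρ)))]
        _ ≤ ∏ ρ ∈ Z, ‖z - ρ‖ := by
            refine Finset.prod_le_prod (fun _ _ ↦ abs_nonneg _) fun ρ _ ↦ ?_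
            have := Complex.abs_im_le_norm (z - ρ)
            rwa [sub_im, hzy] at this
    have hpow : (2 * (15 / 8) : ℝ) ^ Z.card ≤ Real.exp (2 * (Z.card : ℝ)) := by
      rw [mul_comm 2 (Z.card : ℝ), Real.exp_nat_mul]
      gcongr
      have h1 := Real.exp_one_gt_d9
      have h2 : Real.exp 2 = Real.exp 1 * Real.exp 1 := by rw [← Real.exp_add]; norm_num
      rw [h2]; nlinarith
    have hE : Real.exp ((4 * Real.log (τ ^ 4) + 2 * Real.pi) * (7 / 4) / (7 / 4 - 33 / 20)) ≤
        Real.exp (420 * Real.log τ) := by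
      rw [Real.exp_le_exp, Real.log_pow]
      have := Real.pi_lt_four
      rw [show (7 / 4 - 33 / 20 : ℝ) = 1 / 10 by norm_num, div_div_eq_mul_div, div_one]
      push_cast
      linarith
    have h3 : Real.exp (-(20 * (Z.card : ℝ))) ≤ ‖riemannZeta z‖ *
        Real.exp (2 * (Z.card : ℝ)) * Real.exp (420 * Real.log τ) := by
      refine (hprod.trans hmain).trans ?_
      gcongr
    have h0 : 0 < ‖riemannZeta z‖ := by
      by_contra h
      have : ‖riemannZeta z‖ = 0 := le_antisymm (not_lt.mp h) (norm_nonneg _)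
      rw [this] at h3
      simp at h3
      exact absurd h3 (not_le.mpr (Real.exp_pos _))
    rw [norm_inv, inv_le_iff_one_le_mul₀ h0, Real.rpow_def_of_pos hτ0]
    have h4 : Real.exp (22 * (Z.card : ℝ) + 420 * Real.log τ) ≤
        Real.exp (Real.log τ * (22 * C + 420)) := by
      rw [Real.exp_le_exp]; nlinarith
    calc (1 : ℝ) = Real.exp (20 * (Z.card : ℝ)) * Real.exp (-(20 * (Z.card : ℝ))) := by
          rw [← Real.exp_add]; simp
      _ ≤ Real.exp (20 * (Z.card : ℝ)) * (‖riemannZeta z‖ *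
        Real.exp (2 * (Z.card : ℝ)) * Real.exp (420 * Real.log τ)) := by gcongr
      _ = Real.exp (22 * (Z.card : ℝ) + 420 * Real.log τ) * ‖riemannZeta z‖ := by
          rw [show 22 * (Z.card : ℝ) + 420 * Real.log τ =
            20 * (Z.card : ℝ) + 2 * (Z.card : ℝ) + 420 * Real.log τ by ring, Real.exp_add,
            Real.exp_add]
          ring
      _ ≤ _ := by gcongr
  · intro ρ hρ hρim
    by_cases hρZ : ρ ∈ Z
    -- One term of the sum is isolated. The others are at most 1 each, so log |y - γ| ≥ -21 N.
    · have h1 : Real.log (y - ρ.im) + ∑ ρ' ∈ Z.erase ρ, Real.log (y - ρ'.im) =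
          ∑ ρ' ∈ Z, Real.log (y - ρ'.im) := Finset.add_sum_erase Z (fun ρ' ↦ Real.log (y - ρ'.im)) hρZ
      have h2 : ∑ ρ' ∈ Z.erase ρ, Real.log (y - ρ'.im) ≤ (Z.erase ρ).card • (1 : ℝ) :=
        Finset.sum_le_card_nsmul _ _ _ fun ρ' h ↦ hlogle ρ' (Finset.mem_of_mem_erase h)
      have h3 : ((Z.erase ρ).card : ℝ) ≤ Z.card := by exact_mod_cast Finset.card_erase_le
      rw [nsmul_eq_mul, mul_one] at h2
      have h4 : -(Real.log τ * (22 * C + 420)) ≤ Real.log |y - ρ.im| := by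
        rw [Real.log_abs]
        nlinarith
      rw [Real.rpow_def_of_pos hτ0, ← Real.exp_log (abs_pos.mpr (sub_ne_zero.mpr (hyne ρ hρZ))),
        Real.exp_le_exp]
      linarith
    · have h1 := hRH.norm_sub_sq hρ hρim.ne' τ
      have h2 : 7 / 4 < ‖ρ - c‖ := by
        by_contra h
        exact hρZ ((hZ ρ).mpr ⟨hρ, not_lt.mp h⟩)
      have h3 : (3 / 4) ^ 2 ≤ (ρ.im - τ) ^ 2 := by nlinarith
      have h4 : 3 / 4 ≤ |ρ.im - τ| := by
        rw [← sq_abs (ρ.im - τ)] at h3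
        exact (pow_le_pow_iff_left₀ (by norm_num) (abs_nonneg _) two_ne_zero).mp h3
      have h5 : 1 / 2 ≤ |y - ρ.im| := by
        have := abs_sub_le ρ.im y τ
        rw [abs_sub_comm ρ.im y] at this
        linarith
      refine le_trans ?_ h5
      calc τ ^ (-(22 * C + 420)) ≤ τ ^ (-1 : ℝ) :=
            Real.rpow_le_rpow_of_exponent_le (by linarith) (by linarith)
        _ = τ⁻¹ := Real.rpow_neg_one τ
        _ ≤ 1 / 2 := by rw [one_div]; gcongr; linarith

/-! ### The local polar part of 1/ζ -/

/-- Finitely many removable singularities. -/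
lemma exists_differentiableOn_of_removable {U : Set ℂ} (hU : IsOpen U) (Z : Finset ℂ) {f : ℂ → ℂ}
    (hf : DifferentiableOn ℂ f (U \ Z))
    (hZ : ∀ ρ ∈ Z, Tendsto (fun z ↦ (z - ρ) * f z) (𝓝[≠] ρ) (𝓝 0)) :
    ∃ g : ℂ → ℂ, DifferentiableOn ℂ g U ∧ ∀ z ∉ Z, g z = f z := by
  classical
  induction Z using Finset.induction_on generalizing f with
  | empty => exact ⟨f, by simpa using hf, fun _ _ ↦ rfl⟩
  | insert a Z ha ih =>
    by_cases haU : a ∈ U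
    swap
    · obtain ⟨g, hg, hgf⟩ := ih (f := f) (hf.mono (by
        rintro z ⟨hz, hzZ⟩
        refine ⟨hz, ?_⟩
        rw [Finset.coe_insert, mem_insert_iff, not_or]
        exact ⟨fun h ↦ haU (h ▸ hz), hzZ⟩)) fun ρ hρ ↦ hZ ρ (Finset.mem_insert_of_mem hρ)
      exact ⟨g, hg, fun z hz ↦ hgf z fun h ↦ hz (Finset.mem_insert_of_mem h)⟩
    have hopen : IsOpen (U \ (Z : Set ℂ)) := hU.sdiff Z.finite_toSet.isClosed
    have hnhds : U \ (Z : Set ℂ) ∈ 𝓝 a := hopen.mem_nhds ⟨haU, ha⟩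
    have hd : DifferentiableOn ℂ f ((U \ (Z : Set ℂ)) \ {a}) := by
      refine hf.mono ?_
      rintro z ⟨⟨hz, hzZ⟩, hza⟩
      refine ⟨hz, ?_⟩
      rw [Finset.coe_insert, mem_insert_iff, not_or]
      exact ⟨hza, hzZ⟩
    have ho : (fun z ↦ f z - f a) =o[𝓝[≠] a] fun z ↦ (z - a)⁻¹ := by
      rw [Asymptotics.isLittleO_iff_tendsto' (by
        filter_upwards [self_mem_nhdsWithin] with z hz h
        exact absurd (inv_eq_zero.mp h) (sub_ne_zero.mpr hz))]
      have h1 := hZ a (Finset.mem_insert_self a Z)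
      have h2 : Tendsto (fun z ↦ (z - a) * f a) (𝓝[≠] a) (𝓝 0) := by
        have : Tendsto (fun z ↦ (z - a) * f a) (𝓝 a) (𝓝 ((a - a) * f a)) :=
          Continuous.tendsto (by fun_prop) a
        rw [sub_self, zero_mul] at this
        exact this.mono_left nhdsWithin_le_nhds
      have h3 := h1.sub h2
      rw [sub_zero] at h3
      refine h3.congr fun z ↦ ?_
      rw [div_inv_eq_mul]; ring
    have hupd := Complex.differentiableOn_update_limUnder_of_isLittleO hnhds hd ho
    obtain ⟨g, hg, hgf⟩ := ih hupd (by
      intro ρ hρ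
      have hne : ρ ≠ a := fun h ↦ ha (h ▸ hρ)
      refine (hZ ρ (Finset.mem_insert_of_mem hρ)).congr' ?_
      have : ∀ᶠ z in 𝓝[≠] ρ, z ≠ a := (isOpen_ne.mem_nhds hne |> mem_nhdsWithin_of_mem_nhds)
      filter_upwards [this] with z hz
      rw [Function.update_of_ne hz])
    refine ⟨g, hg, fun z hz ↦ ?_⟩
    rw [Finset.mem_insert, not_or] at hz
    rw [hgf z hz.2, Function.update_of_ne hz.1]

lemma tendsto_sub_mul_inv_of_deriv_ne_zero {f : ℂ → ℂ} {ρ : ℂ} (hf : DifferentiableAt ℂ f ρ)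
    (h0 : f ρ = 0) (hd : deriv f ρ ≠ 0) :
    Tendsto (fun z ↦ (z - ρ) * (f z)⁻¹) (𝓝[≠] ρ) (𝓝 (deriv f ρ)⁻¹) := by
  have h1 := (hasDerivAt_iff_tendsto_slope.mp hf.hasDerivAt).inv₀ hd
  refine h1.congr fun z ↦ ?_
  rw [slope_def_field, h0, sub_zero, inv_div, div_eq_mul_inv]

/-- The polar part of `1 / f` at a finite set of simple zeros of `f`. -/
def polarSum (f : ℂ → ℂ) (Z : Finset ℂ) (s : ℂ) : ℂ := ∑ ρ ∈ Z, (deriv f ρ)⁻¹ * (s - ρ)⁻¹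

/-- At a simple zero (z - ρ)/f(z) tends to 1/f'(ρ), which the polar part cancels. Only removable
singularities are left. -/
lemma exists_inv_sub_polarSum {f : ℂ → ℂ} {U : Set ℂ} (hU : IsOpen U) (Z : Finset ℂ)
    (hf : DifferentiableOn ℂ f U) (hZ : ∀ s ∈ U, f s = 0 → s ∈ Z)
    (hZ' : ∀ ρ ∈ Z, DifferentiableAt ℂ f ρ ∧ f ρ = 0 ∧ deriv f ρ ≠ 0) :
    ∃ g : ℂ → ℂ, DifferentiableOn ℂ g U ∧ ∀ z ∉ Z, g z = (f z)⁻¹ - polarSum f Z z := by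
  classical
  refine exists_differentiableOn_of_removable hU Z ?_ ?_
  · refine DifferentiableOn.sub ?_ ?_
    · exact (hf.mono sdiff_subset).inv fun z hz h ↦ hz.2 (hZ z hz.1 h)
    · unfold polarSum
      refine DifferentiableOn.fun_sum fun ρ hρ ↦ (DifferentiableOn.inv (by fun_prop) ?_).const_mul _
      intro z hz h
      exact hz.2 (by rw [sub_eq_zero] at h; rw [h]; exact hρ)
  · intro ρ hρ
    obtain ⟨h1, h2, h3⟩ := hZ' ρ hρ
    have ht := tendsto_sub_mul_inv_of_deriv_ne_zero h1 h2 h3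
    have hrest : Tendsto (fun z ↦ (z - ρ) * ∑ ρ' ∈ Z.erase ρ, (deriv f ρ')⁻¹ * (z - ρ')⁻¹)
        (𝓝[≠] ρ) (𝓝 0) := by
      have hc : ContinuousAt (fun z ↦ (z - ρ) *
          ∑ ρ' ∈ Z.erase ρ, (deriv f ρ')⁻¹ * (z - ρ')⁻¹) ρ := by
        refine ContinuousAt.mul (by fun_prop) (tendsto_finsetSum _ fun ρ' hρ' ↦ ?_)
        refine ContinuousAt.mul continuousAt_const (ContinuousAt.inv₀ (by fun_prop) ?_)
        exact sub_ne_zero.mpr (Finset.ne_of_mem_erase hρ').symm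
      have := hc.tendsto
      simp only [sub_self, zero_mul] at this
      exact this.mono_left nhdsWithin_le_nhds
    have h4 := (ht.sub_const ((deriv f ρ)⁻¹)).sub hrest
    rw [sub_self, sub_zero] at h4
    refine h4.congr' ?_
    filter_upwards [self_mem_nhdsWithin] with z hz
    have hz' : z - ρ ≠ 0 := sub_ne_zero.mpr hz
    rw [polarSum, ← Finset.add_sum_erase Z _ hρ]
    field_simp
    ring

lemma norm_polarSum_le {f : ℂ → ℂ} {Z : Finset ℂ} {s : ℂ} {d : ℝ} (hd : 0 < d)
    (h : ∀ ρ ∈ Z, d ≤ ‖s - ρ‖) :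
    ‖polarSum f Z s‖ ≤ (∑ ρ ∈ Z, ‖(deriv f ρ)⁻¹‖) * d⁻¹ := by
  rw [Finset.sum_mul]
  refine norm_sum_le_of_le _ fun ρ hρ ↦ ?_
  rw [norm_mul, norm_inv (s - ρ)]
  gcongr
  exact h ρ hρ

/-- On the mirrored line the functional equation gives |ζ(s)| ≫ |t|^η |ζ(1 - s)|, and |t|^η ≥ 1
helps, so the bound on the right carries over. -/
lemma RiemannHypothesis.norm_inv_le_of_re (hRH : RiemannHypothesis) {η ε : ℝ} (hη : 0 < η)
    (hη' : η ≤ 1 / 2) (hε : 0 < ε) :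
    ∃ C : ℝ, 1 ≤ C ∧ ∀ s : ℂ, 3 ≤ |s.im| → (1 / 2 + η ≤ s.re ∨ s.re = 1 / 2 - η) →
      ‖(riemannZeta s)⁻¹‖ ≤ C * |s.im| ^ ε := by
  obtain ⟨C₁, hC₁, h₁⟩ := hRH.norm_riemannZeta_le_rpow hη hε
  obtain ⟨C₂, hC₂, h₂⟩ := exists_norm_riemannZeta_one_sub_bounds
  refine ⟨1 + C₁ + C₂ * C₁, by nlinarith [mul_pos hC₂ hC₁], fun s hs hre ↦ ?_⟩
  have hs0 : 0 < |s.im| := by linarith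
  have hp : 0 < |s.im| ^ ε := Real.rpow_pos_of_pos hs0 _
  have hCC := mul_pos hC₂ hC₁
  rcases hre with hre | hre
  · refine (h₁ s hre hs).2.trans ?_
    gcongr
    linarith
  · have h3 := (h₁ (1 - s) (by simp [hre]; linarith) (by simpa using hs)).2
    have h4 := (h₂ s (by linarith) (by linarith) (by linarith)).2
    have h5 : 1 ≤ |s.im| ^ (1 / 2 - s.re) := Real.one_le_rpow (by linarith) (by linarith)
    have h6 : 0 < ‖riemannZeta (1 - s)‖ := norm_pos_iff.mpr <|
      hRH.riemannZeta_ne_zero (by simp [hre]; linarith) (by simp [hre]; linarith)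
    have h7 : ‖riemannZeta (1 - s)‖ ≤ C₂ * ‖riemannZeta s‖ := by nlinarith
    have h8 : 0 < ‖riemannZeta s‖ := by
      by_contra h
      have : ‖riemannZeta s‖ = 0 := le_antisymm (not_lt.mp h) (norm_nonneg _)
      rw [this] at h7; linarith
    have h9 : ‖(riemannZeta s)⁻¹‖ ≤ C₂ * ‖(riemannZeta (1 - s))⁻¹‖ := by
      rw [norm_inv, norm_inv, ← div_eq_mul_inv, le_div_iff₀ h6, ← div_eq_inv_mul, div_le_iff₀ h8]
      exact h7
    have h10 : ‖(riemannZeta (1 - s))⁻¹‖ ≤ C₁ * |s.im| ^ ε := by simpa using h3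
    calc ‖(riemannZeta s)⁻¹‖ ≤ C₂ * (C₁ * |s.im| ^ ε) := h9.trans (by gcongr)
      _ = (C₂ * C₁) * |s.im| ^ ε := by ring
      _ ≤ _ := by gcongr; linarith

/-- Convexity bound on a rectangle whose vertical sides carry the better bound. -/
lemma norm_le_of_rectangle {g : ℂ → ℂ} {η y₁ y₂ V K : ℝ} (hη : 0 < η) (hK : 0 ≤ K) (hy : y₁ < y₂)
    (hg : DifferentiableOn ℂ g {z | y₁ - 1 / 8 < z.im ∧ z.im < y₂ + 1 / 8})
    (hV : ∀ z : ℂ, |z.re - 1 / 2| = η → y₁ ≤ z.im → z.im ≤ y₂ → ‖g z‖ ≤ V)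
    (hH : ∀ z : ℂ, |z.re - 1 / 2| ≤ η → z.im = y₁ ∨ z.im = y₂ → ‖g z‖ ≤ V * Real.exp K)
    {s : ℂ} (hs : |s.re - 1 / 2| ≤ η) (hs₁ : y₁ + 1 ≤ s.im) (hs₂ : s.im ≤ y₂ - 1) :
    ‖g s‖ ≤ V * Real.exp (K * η ^ 2) := by
  have hlt : 1 / 2 - η < 1 / 2 + η := by linarith
  have hcl : closure (Ioo (1 / 2 - η) (1 / 2 + η) ×ℂ Ioo y₁ y₂) =
      Icc (1 / 2 - η) (1 / 2 + η) ×ℂ Icc y₁ y₂ := by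
    rw [Complex.closure_reProdIm, closure_Ioo hlt.ne, closure_Ioo hy.ne]
  have hV0 : 0 ≤ V := (norm_nonneg _).trans (hV ⟨1 / 2 + η, y₁⟩ (by simp [abs_of_pos hη]) le_rfl hy.le)
  set w : ℂ := ⟨1 / 2, s.im⟩ with hw
  have hexp : ∀ z : ℂ, ‖cexp (K * (z - w) ^ 2)‖ =
      Real.exp (K * ((z.re - 1 / 2) ^ 2 - (z.im - s.im) ^ 2)) := by
    intro z
    rw [Complex.norm_exp]
    congr 1
    rw [Complex.re_ofReal_mul, sq, Complex.mul_re]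
    simp [hw]
    ring_nf
    simp
  -- Maximum principle for g(z) exp(K (z - w)²), with w on the critical line at the height of s. The
  -- horizontal sides are at least 1 away in height, so there the factor is at most exp(K(η² - 1))
  -- and absorbs exp K. At s its modulus is at least 1.
  have key : ‖g s * cexp (K * (s - w) ^ 2)‖ ≤ V * Real.exp (K * η ^ 2) := by
    refine Complex.norm_le_of_forall_mem_frontier_norm_le
      (f := fun z ↦ g z * cexp (K * (z - w) ^ 2))
      (U := Ioo (1 / 2 - η) (1 / 2 + η) ×ℂ Ioo y₁ y₂)
      ((Metric.isBounded_Ioo _ _).reProdIm (Metric.isBounded_Ioo _ _)) ?_ ?_ ?_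
    · refine DifferentiableOn.diffContOnCl ?_
      rw [hcl]
      refine DifferentiableOn.mul (hg.mono ?_) (by fun_prop)
      intro z hz
      rw [Complex.mem_reProdIm] at hz
      exact ⟨by linarith [hz.2.1], by linarith [hz.2.2]⟩
    · intro z hz
      rw [Complex.frontier_reProdIm, closure_Ioo hlt.ne, closure_Ioo hy.ne, frontier_Ioo hlt,
        frontier_Ioo hy] at hz
      rw [norm_mul, hexp]
      rcases hz with hz | hz
      · rw [Complex.mem_reProdIm] at hz
        have h1 : |z.re - 1 / 2| ≤ η := by rw [abs_le]; constructor <;> linarith [hz.1.1, hz.1.2]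
        have h2 : (z.re - 1 / 2) ^ 2 ≤ η ^ 2 := by rw [← sq_abs]; gcongr
        have h3 : 1 ≤ (z.im - s.im) ^ 2 := by
          rcases hz.2 with h | h
          · rw [h]; nlinarith
          · rw [mem_singleton_iff] at h; rw [h]; nlinarith
        calc ‖g z‖ * Real.exp (K * ((z.re - 1 / 2) ^ 2 - (z.im - s.im) ^ 2))
            ≤ (V * Real.exp K) * Real.exp (K * (η ^ 2 - 1)) := by
              gcongr
              exact hH z h1 (by simpa using hz.2)
          _ = V * Real.exp (K * η ^ 2) := by rw [mul_assoc, ← Real.exp_add]; ring_nf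
      · rw [Complex.mem_reProdIm] at hz
        have h1 : |z.re - 1 / 2| = η := by
          rcases hz.1 with h | h
          · rw [h]; simp [abs_of_pos hη]
          · rw [mem_singleton_iff] at h; rw [h]; simp [abs_of_pos hη]
        have h2 : (z.re - 1 / 2) ^ 2 = η ^ 2 := by rw [← sq_abs, h1]
        gcongr
        · exact hV z h1 hz.2.1 hz.2.2
        · rw [h2]; nlinarith [sq_nonneg (z.im - s.im)]
    · rw [hcl, Complex.mem_reProdIm]
      rw [abs_le] at hs
      refine ⟨⟨by linarith, by linarith⟩, by linarith, by linarith⟩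
  rw [norm_mul, hexp] at key
  refine le_trans (le_mul_of_one_le_right (norm_nonneg _) (Real.one_le_exp ?_)) key
  rw [sub_self, zero_pow two_ne_zero, sub_zero]
  positivity

/-- The zeros of zeta on the critical line at distance at most `3` from height `τ`. -/
def zeroWindow (τ : ℝ) : Finset ℂ := (finite_zeros_closedBall (1 / 2 + τ * I) 3).toFinset

lemma mem_zeroWindow {τ : ℝ} {ρ : ℂ} :
    ρ ∈ zeroWindow τ ↔ riemannZeta ρ = 0 ∧ ‖ρ - (1 / 2 + τ * I)‖ ≤ 3 := by
  simp [zeroWindow]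

lemma abs_im_sub_le_of_mem_zeroWindow {τ : ℝ} {ρ : ℂ} (h : ρ ∈ zeroWindow τ) :
    |ρ.im - τ| ≤ 3 := by
  have h1 := (Complex.abs_im_le_norm _).trans (mem_zeroWindow.mp h).2
  simpa using h1

lemma im_pos_of_mem_zeroWindow {τ : ℝ} (hτ : 16 ≤ τ) {ρ : ℂ} (h : ρ ∈ zeroWindow τ) :
    0 < ρ.im := by
  have := abs_le.mp (abs_im_sub_le_of_mem_zeroWindow h)
  linarith

lemma RiemannHypothesis.mem_zeroWindow_of_abs_le (hRH : RiemannHypothesis) {τ : ℝ} {ρ : ℂ}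
    (hρ : riemannZeta ρ = 0) (him : 0 < ρ.im) (h : |ρ.im - τ| ≤ 3) : ρ ∈ zeroWindow τ := by
  rw [mem_zeroWindow]
  refine ⟨hρ, (Complex.norm_le_abs_re_add_abs_im _).trans ?_⟩
  simpa [hRH.re_eq hρ him.ne'] using h

lemma RiemannHypothesis.re_of_mem_zeroWindow (hRH : RiemannHypothesis) {τ : ℝ} (hτ : 16 ≤ τ)
    {ρ : ℂ} (h : ρ ∈ zeroWindow τ) : ρ.re = 1 / 2 :=
  hRH.re_eq (mem_zeroWindow.mp h).1 (im_pos_of_mem_zeroWindow hτ h).ne'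

lemma RiemannHypothesis.card_zeroWindow_le (hRH : RiemannHypothesis) :
    ∃ C : ℝ, 0 < C ∧ ∀ τ : ℝ, 16 ≤ τ → ((zeroWindow τ).card : ℝ) ≤ C * Real.log τ := by
  classical
  set C := 8 / Real.log (15 / 14) with hC
  have hC0 : 0 < C := div_pos (by norm_num) (Real.log_pos (by norm_num))
  refine ⟨14 * C, by positivity, fun τ hτ ↦ ?_⟩
  have hsub : zeroWindow τ ⊆ (Finset.range 7).biUnion
      fun j : ℕ ↦ (zeroWindow τ).filter fun ρ ↦ |ρ.im - (τ - 3 + j)| ≤ 1 / 2 := by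
    intro ρ hρ
    have h1 := abs_le.mp (abs_im_sub_le_of_mem_zeroWindow hρ)
    rw [Finset.mem_biUnion]
    have h2 := Nat.floor_le (show 0 ≤ ρ.im - τ + 3 + 1 / 2 by linarith)
    have h3 := Nat.lt_floor_add_one (ρ.im - τ + 3 + 1 / 2)
    refine ⟨⌊ρ.im - τ + 3 + 1 / 2⌋₊, ?_, ?_⟩
    · rw [Finset.mem_range, Nat.floor_lt (by linarith)]
      push_cast; linarith
    · rw [Finset.mem_filter]
      refine ⟨hρ, ?_⟩
      rw [abs_le]; constructor <;> linarith
  have hlog : Real.log (τ + 3) ≤ 2 * Real.log τ := by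
    rw [show 2 * Real.log τ = Real.log (τ ^ 2) by rw [Real.log_pow]; norm_num]
    exact Real.log_le_log (by linarith) (by nlinarith)
  calc ((zeroWindow τ).card : ℝ) ≤ ∑ j ∈ Finset.range 7,
        (((zeroWindow τ).filter fun ρ ↦ |ρ.im - (τ - 3 + (j : ℕ))| ≤ 1 / 2).card : ℝ) := by
        exact_mod_cast (Finset.card_le_card hsub).trans Finset.card_biUnion_le
    _ ≤ ∑ j ∈ Finset.range 7, 2 * C * Real.log τ := by
        refine Finset.sum_le_sum fun j hj ↦ ?_
        have hj' : (j : ℝ) ≤ 6 := by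
          have := Finset.mem_range.mp hj
          exact_mod_cast (by omega : j ≤ 6)
        have hj0 : (0 : ℝ) ≤ j := j.cast_nonneg
        refine (hRH.card_zeros_le (τ := τ - 3 + j) (by linarith) _ fun ρ hρ ↦ ?_).trans ?_
        · rw [Finset.mem_filter] at hρ
          exact ⟨(mem_zeroWindow.mp hρ.1).1, hρ.2⟩
        · have : Real.log (τ - 3 + j) ≤ 2 * Real.log τ :=
            (Real.log_le_log (by linarith) (by linarith)).trans hlog
          nlinarith
    _ = 14 * C * Real.log τ := by rw [Finset.sum_const, Finset.card_range, nsmul_eq_mul]; push_cast; ring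

/-- Near the critical line `1 / ζ` is its local polar part, up to a small error. -/
lemma RiemannHypothesis.norm_inv_riemannZeta_le_polarSum (hRH : RiemannHypothesis)
    (hsimple : ∀ ρ, riemannZeta ρ = 0 → 0 < ρ.im → deriv riemannZeta ρ ≠ 0) {ε : ℝ} (hε : 0 < ε) :
    ∃ C : ℝ, 1 ≤ C ∧ ∀ τ : ℝ, 16 ≤ τ → ∀ s : ℂ, 1 / 2 < s.re → τ ≤ s.im → s.im ≤ τ + 1 →
      ‖(riemannZeta s)⁻¹‖ ≤
        C * τ ^ ε * (1 + ∑ ρ ∈ zeroWindow τ, ‖(deriv riemannZeta ρ)⁻¹‖) +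
          ‖polarSum riemannZeta (zeroWindow τ) s‖ := by
  obtain ⟨A, hA, hgood⟩ := hRH.exists_good_height hsimple
  -- With K = A log(2τ) the rectangle costs (2τ)^(A η²), which this η keeps below (2τ)^(ε/2).
  set η := min (1 / 8) (ε / (2 * A)) with hηdef
  have hη : 0 < η := lt_min (by norm_num) (by positivity)
  have hη8 : η ≤ 1 / 8 := min_le_left _ _
  have hηA : A * η ^ 2 ≤ ε / 2 := by
    have h1 : η ≤ ε / (2 * A) := min_le_right _ _
    rw [le_div_iff₀ (by positivity)] at h1
    nlinarith [mul_pos hA hη]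
  obtain ⟨C₁, hC₁, h₁⟩ := hRH.norm_inv_le_of_re hη (by linarith) (half_pos hε)
  have hηinv : 1 ≤ η⁻¹ := by rw [one_le_inv₀ hη]; linarith
  have h2ε : 1 ≤ (2 : ℝ) ^ ε := Real.one_le_rpow (by norm_num) hε.le
  refine ⟨C₁ * η⁻¹ * 2 ^ ε, one_le_mul_of_one_le_of_one_le
    (one_le_mul_of_one_le_of_one_le hC₁ hηinv) h2ε, fun τ hτ s hs hs₁ hs₂ ↦ ?_⟩
  set W := zeroWindow τ with hW
  set B := ∑ ρ ∈ W, ‖(deriv riemannZeta ρ)⁻¹‖ with hB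
  have hB0 : 0 ≤ B := Finset.sum_nonneg fun _ _ ↦ norm_nonneg _
  have hτ1 : 1 ≤ 2 * τ := by linarith
  have hV1 : 1 ≤ (2 * τ) ^ (ε / 2) := Real.one_le_rpow hτ1 (by positivity)
  have hV2 : 1 ≤ (2 * τ) ^ A := Real.one_le_rpow hτ1 hA.le
  have hCτ : C₁ * η⁻¹ * 2 ^ ε * τ ^ ε = C₁ * η⁻¹ * (2 * τ) ^ (ε / 2) * (2 * τ) ^ (ε / 2) := by
    rw [mul_assoc _ _ ((2 * τ) ^ (ε / 2)), ← Real.rpow_add (by linarith), add_halves,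
      Real.mul_rpow (by norm_num) (by linarith)]
    ring
  have hCη : 1 ≤ C₁ * η⁻¹ := one_le_mul_of_one_le_of_one_le hC₁ hηinv
  have hline : ∀ z : ℂ, τ - 2 ≤ z.im → z.im ≤ τ + 3 → |z.im| ^ (ε / 2) ≤ (2 * τ) ^ (ε / 2) := by
    intro z h1 h2
    rw [abs_of_nonneg (by linarith)]
    exact Real.rpow_le_rpow (by linarith) (by linarith) (by positivity)
  rcases le_or_gt (1 / 2 + η) s.re with hsη | hsη
  · have h3 := h₁ s (by rw [abs_of_nonneg (by linarith)]; linarith) (Or.inl hsη)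
    have h4 := hline s (by linarith) (by linarith)
    rw [hCτ]
    refine le_trans ?_ (le_add_of_nonneg_right (norm_nonneg _))
    calc ‖(riemannZeta s)⁻¹‖ ≤ C₁ * (2 * τ) ^ (ε / 2) := h3.trans (by gcongr)
      _ = C₁ * 1 * (2 * τ) ^ (ε / 2) * 1 * (1 + 0) := by ring
      _ ≤ _ := by gcongr
  -- The two good heights keep the horizontal sides at distance at least 1 from [τ, τ + 1], while a
  -- neighbourhood of the rectangle stays within 3 of height τ, so that all its zeros belong to the
  -- window.
  obtain ⟨y₁, hy₁, hinv₁, hdist₁⟩ := hgood (τ - 3 / 2) (by linarith)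
  obtain ⟨y₂, hy₂, hinv₂, hdist₂⟩ := hgood (τ + 5 / 2) (by linarith)
  rw [abs_le] at hy₁ hy₂
  set U : Set ℂ := {z | y₁ - 1 / 8 < z.im ∧ z.im < y₂ + 1 / 8} with hU
  have hUo : IsOpen U := (isOpen_lt continuous_const Complex.continuous_im).inter
    (isOpen_lt Complex.continuous_im continuous_const)
  have hdiff : ∀ z : ℂ, 0 < z.im → DifferentiableAt ℂ riemannZeta z := fun z hz ↦
    differentiableAt_riemannZeta (by rintro rfl; simp at hz)
  obtain ⟨g, hg, hgf⟩ := exists_inv_sub_polarSum (f := riemannZeta) hUo W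
    (fun z hz ↦ (hdiff z (by linarith [hz.1])).differentiableWithinAt)
    (fun z hz h0 ↦ hRH.mem_zeroWindow_of_abs_le h0 (by linarith [hz.1])
      (by rw [abs_le]; constructor <;> linarith [hz.1, hz.2]))
    (fun ρ hρ ↦ ⟨hdiff ρ (im_pos_of_mem_zeroWindow hτ hρ), (mem_zeroWindow.mp hρ).1,
      hsimple ρ (mem_zeroWindow.mp hρ).1 (im_pos_of_mem_zeroWindow hτ hρ)⟩)
  have hnorm : ∀ z ∉ W, ‖g z‖ ≤ ‖(riemannZeta z)⁻¹‖ + ‖polarSum riemannZeta W z‖ := by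
    intro z hz
    rw [hgf z hz]; exact norm_sub_le _ _
  have hK : 0 ≤ A * Real.log (2 * τ) := mul_nonneg hA.le (Real.log_nonneg hτ1)
  have hexpK : ∀ c : ℝ, Real.exp (A * Real.log (2 * τ) * c) = (2 * τ) ^ (A * c) := by
    intro c
    rw [Real.rpow_def_of_pos (by linarith)]; ring_nf
  have hhor : ∀ τ' y : ℝ, 4 ≤ τ' → τ' ≤ 2 * τ →
      (∀ z : ℂ, 3 / 8 ≤ z.re → z.re ≤ 5 / 8 → z.im = y → ‖(riemannZeta z)⁻¹‖ ≤ τ' ^ A) →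
      (∀ ρ, riemannZeta ρ = 0 → 0 < ρ.im → τ' ^ (-A) ≤ |y - ρ.im|) →
      ∀ z : ℂ, |z.re - 1 / 2| ≤ η → z.im = y → ‖g z‖ ≤ (2 * τ) ^ A * (1 + B) := by
    intro τ' y h4 hle hinv hdist z hz hzy
    rw [abs_le] at hz
    have hpos : 0 < τ' ^ (-A) := Real.rpow_pos_of_pos (by linarith) _
    have hd : ∀ ρ ∈ W, τ' ^ (-A) ≤ ‖z - ρ‖ := by
      intro ρ hρ
      refine (hdist ρ (mem_zeroWindow.mp hρ).1 (im_pos_of_mem_zeroWindow hτ hρ)).trans ?_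
      have := Complex.abs_im_le_norm (z - ρ)
      rwa [sub_im, hzy] at this
    have hzW : z ∉ W := by
      intro h
      have := hd z h
      rw [sub_self, norm_zero] at this
      linarith
    have hle' : τ' ^ A ≤ (2 * τ) ^ A := Real.rpow_le_rpow (by linarith) hle hA.le
    have h5 := hinv z (by linarith) (by linarith) hzy
    have h6 := norm_polarSum_le (f := riemannZeta) hpos hd
    rw [Real.rpow_neg (by linarith), inv_inv] at h6
    calc ‖g z‖ ≤ (2 * τ) ^ A + B * (2 * τ) ^ A :=
          (hnorm z hzW).trans (add_le_add (h5.trans hle') (h6.trans (by gcongr)))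
      _ = _ := by ring
  have hmain := norm_le_of_rectangle (g := g) (V := C₁ * η⁻¹ * (2 * τ) ^ (ε / 2) * (1 + B))
    (s := s) hη hK
    (show y₁ < y₂ by linarith) hg ?_ ?_
    (by rw [abs_le]; constructor <;> linarith) (by linarith) (by linarith)
  · rw [hexpK] at hmain
    have hsW : s ∉ W := fun h ↦ hs.ne' (hRH.re_of_mem_zeroWindow hτ h)
    have h7 : ‖(riemannZeta s)⁻¹‖ ≤ ‖g s‖ + ‖polarSum riemannZeta W s‖ := by
      have := hgf s hsW
      rw [eq_sub_iff_add_eq] at this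
      rw [← this]
      exact norm_add_le _ _
    refine h7.trans (add_le_add_left (hmain.trans ?_) _)
    rw [hCτ]
    have h8 : (2 * τ) ^ (A * η ^ 2) ≤ (2 * τ) ^ (ε / 2) := Real.rpow_le_rpow_of_exponent_le hτ1 hηA
    calc C₁ * η⁻¹ * (2 * τ) ^ (ε / 2) * (1 + B) * (2 * τ) ^ (A * η ^ 2)
        ≤ C₁ * η⁻¹ * (2 * τ) ^ (ε / 2) * (1 + B) * (2 * τ) ^ (ε / 2) := by gcongr
      _ = _ := by ring
  · intro z hz hz₁ hz₂
    have hd : ∀ ρ ∈ W, η ≤ ‖z - ρ‖ := by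
      intro ρ hρ
      have := Complex.abs_re_le_norm (z - ρ)
      rwa [sub_re, hRH.re_of_mem_zeroWindow hτ hρ, hz] at this
    have hzW : z ∉ W := by
      intro h
      have := hd z h
      rw [sub_self, norm_zero] at this
      linarith
    have h5 := h₁ z (by rw [abs_of_nonneg (by linarith)]; linarith) (by
      rcases (abs_eq hη.le).mp hz with h | h
      · left; linarith
      · right; linarith)
    have h6 := norm_polarSum_le (f := riemannZeta) hη hd
    have h4 := hline z (by linarith) (by linarith)
    calc ‖g z‖ ≤ C₁ * (2 * τ) ^ (ε / 2) + B * η⁻¹ :=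
          (hnorm z hzW).trans (add_le_add (h5.trans (by gcongr)) h6)
      _ = C₁ * 1 * (2 * τ) ^ (ε / 2) + 1 * η⁻¹ * 1 * B := by ring
      _ ≤ C₁ * η⁻¹ * (2 * τ) ^ (ε / 2) + C₁ * η⁻¹ * (2 * τ) ^ (ε / 2) * B := by gcongr
      _ = _ := by ring
  · intro z hz hzy
    have h9 : ‖g z‖ ≤ (2 * τ) ^ A * (1 + B) := by
      rcases hzy with h | h
      · exact hhor _ y₁ (by linarith) (by linarith) hinv₁ hdist₁ z hz h
      · exact hhor _ y₂ (by linarith) (by linarith) hinv₂ hdist₂ z hz h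
    have h10 := hexpK 1
    rw [mul_one, mul_one] at h10
    rw [h10]
    calc ‖g z‖ ≤ 1 * 1 * (1 + B) * (2 * τ) ^ A := by rw [one_mul, one_mul, mul_comm]; exact h9
      _ ≤ _ := by gcongr

/-! ### Mean squares of 1/ζ near the critical line -/

/-- The primitive is an arctangent. The factor 1/δ obtained here is the one that finally becomes log
X. -/
lemma integral_inv_sq_add_sq_le {δ : ℝ} (hδ : 0 < δ) (γ a b : ℝ) :
    ∫ t in a..b, (δ ^ 2 + (t - γ) ^ 2)⁻¹ ≤ Real.pi / δ := by
  have hderiv : ∀ t, HasDerivAt (fun t ↦ Real.arctan ((t - γ) / δ) / δ)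
      ((δ ^ 2 + (t - γ) ^ 2)⁻¹) t := by
    intro t
    have h1 := ((((hasDerivAt_id t).sub_const γ).div_const δ).arctan).div_const δ
    refine h1.congr_deriv ?_
    have : δ ^ 2 + (t - γ) ^ 2 ≠ 0 := by positivity
    simp only [id]
    field_simp
  have hcont : Continuous fun t : ℝ ↦ (δ ^ 2 + (t - γ) ^ 2)⁻¹ :=
    Continuous.inv₀ (by fun_prop) fun t ↦ by positivity
  rw [intervalIntegral.integral_eq_sub_of_hasDerivAt (fun t _ ↦ hderiv t)
    (hcont.intervalIntegrable _ _), ← sub_div]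
  gcongr
  linarith [Real.arctan_lt_pi_div_two ((b - γ) / δ), Real.neg_pi_div_two_lt_arctan ((a - γ) / δ)]

/-- The sum of `1 / |ζ'(ρ)|²` over a window. -/
def windowSum (τ : ℝ) : ℝ := ∑ ρ ∈ zeroWindow τ, ‖(deriv riemannZeta ρ)⁻¹‖ ^ 2

lemma windowSum_nonneg (τ : ℝ) : 0 ≤ windowSum τ := Finset.sum_nonneg fun _ _ ↦ by positivity

/-- Cauchy–Schwarz over the zeros; at real part 1/2 + δ one has |s - ρ|² = δ² + (t - γ)². -/
lemma norm_sq_polarSum_le {f : ℂ → ℂ} (Z : Finset ℂ) (hZ : ∀ ρ ∈ Z, ρ.re = 1 / 2) {δ t : ℝ} :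
    ‖polarSum f Z (1 / 2 + δ + t * I)‖ ^ 2 ≤
      Z.card * ∑ ρ ∈ Z, ‖(deriv f ρ)⁻¹‖ ^ 2 * (δ ^ 2 + (t - ρ.im) ^ 2)⁻¹ := by
  have h1 : ‖polarSum f Z (1 / 2 + δ + t * I)‖ ≤
      ∑ ρ ∈ Z, ‖(deriv f ρ)⁻¹ * (1 / 2 + δ + t * I - ρ)⁻¹‖ := norm_sum_le _ _
  calc ‖polarSum f Z (1 / 2 + δ + t * I)‖ ^ 2
      ≤ (∑ ρ ∈ Z, ‖(deriv f ρ)⁻¹ * (1 / 2 + δ + t * I - ρ)⁻¹‖) ^ 2 := by gcongr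
    _ ≤ Z.card * ∑ ρ ∈ Z, ‖(deriv f ρ)⁻¹ * (1 / 2 + δ + t * I - ρ)⁻¹‖ ^ 2 :=
        sq_sum_le_card_mul_sum_sq
    _ = _ := by
        congr 1
        refine Finset.sum_congr rfl fun ρ hρ ↦ ?_
        rw [norm_mul, mul_pow, norm_inv (_ - ρ), inv_pow, ← Complex.normSq_eq_norm_sq (_ - ρ),
          Complex.normSq_apply]
        congr 2
        simp [hZ ρ hρ]
        ring

/-- The approximation by the polar part is squared and integrated. Cauchy–Schwarz loses only the
number of zeros in the window, O(log τ), which τ^(ε/2) absorbs, so nothing about gaps between zeros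
is needed. -/
lemma RiemannHypothesis.lintegral_inv_riemannZeta_window_le (hRH : RiemannHypothesis)
    (hsimple : ∀ ρ, riemannZeta ρ = 0 → 0 < ρ.im → deriv riemannZeta ρ ≠ 0) {ε : ℝ} (hε : 0 < ε) :
    ∃ C : ℝ, 0 < C ∧ ∀ τ : ℝ, 16 ≤ τ → ∀ δ : ℝ, 0 < δ → δ ≤ 1 →
      ∫⁻ t in Ioc τ (τ + 1), ‖(riemannZeta (1 / 2 + δ + t * I))⁻¹‖ₑ ^ 2 ≤
        ENNReal.ofReal (C * τ ^ ε / δ * (1 + windowSum τ)) := by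
  obtain ⟨C₁, hC₁, h₁⟩ := hRH.norm_inv_riemannZeta_le_polarSum hsimple (show 0 < ε / 4 by linarith)
  obtain ⟨C₂, hC₂, h₂⟩ := hRH.card_zeroWindow_le
  set D := C₂ / (ε / 2) with hD
  have hD0 : 0 < D := by positivity
  refine ⟨4 * C₁ ^ 2 * (1 + D) + 2 * D * Real.pi, by positivity, fun τ hτ δ hδ hδ1 ↦ ?_⟩
  have hτ0 : 0 < τ := by linarith
  set W := zeroWindow τ with hW
  set N : ℝ := (W.card : ℝ) with hN
  set Q := windowSum τ with hQ
  have hQ0 : 0 ≤ Q := windowSum_nonneg τ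
  have hN0 : 0 ≤ N := Nat.cast_nonneg _
  have hp : 1 ≤ τ ^ (ε / 2) := Real.one_le_rpow (by linarith) (by positivity)
  have hND : N ≤ D * τ ^ (ε / 2) := by
    refine (h₂ τ hτ).trans ?_
    calc C₂ * Real.log τ ≤ C₂ * (τ ^ (ε / 2) / (ε / 2)) := by
          gcongr
          exact Real.log_le_rpow_div hτ0.le (by positivity)
      _ = D * τ ^ (ε / 2) := by rw [hD]; ring
  set B := ∑ ρ ∈ W, ‖(deriv riemannZeta ρ)⁻¹‖ with hB
  have hB0 : 0 ≤ B := Finset.sum_nonneg fun _ _ ↦ norm_nonneg _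
  have hB2 : B ^ 2 ≤ N * Q := sq_sum_le_card_mul_sum_sq
  set a := 4 * C₁ ^ 2 * τ ^ (ε / 2) * (1 + N * Q) with ha
  set q : ℂ → ℝ := fun ρ ↦ ‖(deriv riemannZeta ρ)⁻¹‖ ^ 2 with hq
  set h : ℝ → ℝ := fun t ↦ a + 2 * N * ∑ ρ ∈ W, q ρ * (δ ^ 2 + (t - ρ.im) ^ 2)⁻¹ with hh
  have hp4 : (τ ^ (ε / 4)) ^ 2 = τ ^ (ε / 2) := by
    rw [← Real.rpow_natCast, ← Real.rpow_mul hτ0.le]; norm_num; ring_nf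
  have hpt : ∀ t ∈ Ioc τ (τ + 1), ‖(riemannZeta (1 / 2 + δ + t * I))⁻¹‖ ^ 2 ≤ h t := by
    intro t ht
    have h3 := h₁ τ hτ (1 / 2 + δ + t * I) (by simpa using hδ) (by simpa using ht.1.le)
      (by simpa using ht.2)
    have h4 := norm_sq_polarSum_le (f := riemannZeta) W
      (fun ρ hρ ↦ hRH.re_of_mem_zeroWindow hτ hρ) (δ := δ) (t := t)
    calc ‖(riemannZeta (1 / 2 + δ + t * I))⁻¹‖ ^ 2
        ≤ (C₁ * τ ^ (ε / 4) * (1 + B) + ‖polarSum riemannZeta W (1 / 2 + δ + t * I)‖) ^ 2 := by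
          gcongr
      _ ≤ 2 * (C₁ * τ ^ (ε / 4) * (1 + B)) ^ 2 +
          2 * ‖polarSum riemannZeta W (1 / 2 + δ + t * I)‖ ^ 2 := by
          nlinarith [sq_nonneg (C₁ * τ ^ (ε / 4) * (1 + B) -
            ‖polarSum riemannZeta W (1 / 2 + δ + t * I)‖)]
      _ ≤ a + 2 * (N * ∑ ρ ∈ W, q ρ * (δ ^ 2 + (t - ρ.im) ^ 2)⁻¹) := by
          refine add_le_add ?_ (by gcongr)
          rw [mul_pow, mul_pow, hp4, ha]
          have h5 : (1 + B) ^ 2 ≤ 2 * (1 + N * Q) := by nlinarith [sq_nonneg (1 - B)]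
          calc 2 * (C₁ ^ 2 * τ ^ (ε / 2) * (1 + B) ^ 2)
              ≤ 2 * (C₁ ^ 2 * τ ^ (ε / 2) * (2 * (1 + N * Q))) := by gcongr
            _ = _ := by ring
      _ = h t := by rw [hh]; ring
  have hcont1 : ∀ ρ : ℂ, Continuous fun t : ℝ ↦ q ρ * (δ ^ 2 + (t - ρ.im) ^ 2)⁻¹ := fun ρ ↦
    continuous_const.mul (Continuous.inv₀ (by fun_prop) fun t ↦ by positivity)
  have hcont2 : Continuous fun t : ℝ ↦ ∑ ρ ∈ W, q ρ * (δ ^ 2 + (t - ρ.im) ^ 2)⁻¹ :=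
    continuous_finsetSum _ fun ρ _ ↦ hcont1 ρ
  have hcont : Continuous h := continuous_const.add (continuous_const.mul hcont2)
  have hint : ∫ t in Ioc τ (τ + 1), h t ≤ a + 2 * N * (Q * (Real.pi / δ)) := by
    rw [← intervalIntegral.integral_of_le (by linarith), hh,
      intervalIntegral.integral_add intervalIntegrable_const
        ((hcont2.intervalIntegrable _ _).const_mul _),
      intervalIntegral.integral_const, intervalIntegral.integral_const_mul,
      intervalIntegral.integral_finsetSum fun ρ _ ↦ (hcont1 ρ).intervalIntegrable _ _]
    simp only [intervalIntegral.integral_const_mul]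
    refine add_le_add (by simp) ?_
    gcongr
    rw [hQ, windowSum, Finset.sum_mul]
    refine Finset.sum_le_sum fun ρ _ ↦ ?_
    rw [hq]
    gcongr
    exact integral_inv_sq_add_sq_le hδ _ _ _
  have ha0 : 0 ≤ a := by positivity
  have hfin : a + 2 * N * (Q * (Real.pi / δ)) ≤
      (4 * C₁ ^ 2 * (1 + D) + 2 * D * Real.pi) * τ ^ ε / δ * (1 + Q) := by
    have hδi : 1 ≤ δ⁻¹ := (one_le_inv₀ hδ).mpr hδ1
    have hsplit : τ ^ ε = τ ^ (ε / 2) * τ ^ (ε / 2) := by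
      rw [← Real.rpow_add hτ0, add_halves]
    have h6 : 1 + N * Q ≤ (1 + D) * τ ^ (ε / 2) * (1 + Q) := by
      nlinarith [mul_nonneg hN0 hQ0, mul_le_mul_of_nonneg_right hND hQ0, mul_nonneg hD0.le hQ0,
        mul_pos hD0 (by linarith : 0 < τ ^ (ε / 2)), mul_nonneg (by linarith : 0 ≤ τ ^ (ε / 2)) hQ0]
    have h7 : a ≤ 4 * C₁ ^ 2 * (1 + D) * τ ^ ε * δ⁻¹ * (1 + Q) := by
      rw [ha, hsplit]
      calc 4 * C₁ ^ 2 * τ ^ (ε / 2) * (1 + N * Q)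
          ≤ 4 * C₁ ^ 2 * τ ^ (ε / 2) * ((1 + D) * τ ^ (ε / 2) * (1 + Q)) := by gcongr
        _ = 4 * C₁ ^ 2 * (1 + D) * (τ ^ (ε / 2) * τ ^ (ε / 2)) * 1 * (1 + Q) := by ring
        _ ≤ _ := by gcongr
    have h8 : 2 * N * (Q * (Real.pi / δ)) ≤ 2 * D * Real.pi * τ ^ ε * δ⁻¹ * (1 + Q) := by
      rw [hsplit]
      calc 2 * N * (Q * (Real.pi / δ))
          ≤ 2 * (D * τ ^ (ε / 2)) * ((1 + Q) * (Real.pi / δ)) := by gcongr; linarith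
        _ = 2 * D * Real.pi * (τ ^ (ε / 2) * 1) * δ⁻¹ * (1 + Q) := by
            rw [div_eq_mul_inv]; ring
        _ ≤ _ := by gcongr
    rw [div_eq_mul_inv]
    calc _ ≤ _ := add_le_add h7 h8
      _ = _ := by ring
  calc ∫⁻ t in Ioc τ (τ + 1), ‖(riemannZeta (1 / 2 + δ + t * I))⁻¹‖ₑ ^ 2
      ≤ ∫⁻ t in Ioc τ (τ + 1), ENNReal.ofReal (h t) := by
        refine setLIntegral_mono' measurableSet_Ioc fun t ht ↦ ?_
        rw [← ofReal_norm, ← ENNReal.ofReal_pow (norm_nonneg _)]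
        exact ENNReal.ofReal_le_ofReal (hpt t ht)
    _ = ENNReal.ofReal (∫ t in Ioc τ (τ + 1), h t) := by
        rw [ofReal_integral_eq_lintegral_ofReal (hcont.integrableOn_Ioc)]
        refine Eventually.of_forall fun t ↦ add_nonneg ha0 (mul_nonneg (by positivity) ?_)
        exact Finset.sum_nonneg fun ρ _ ↦ by positivity
    _ ≤ _ := ENNReal.ofReal_le_ofReal (hint.trans hfin)

/-- A multiple zero would contribute 1/0 = ∞ to a finite sum. -/
lemma deriv_ne_zero_of_Jneg1_le
    (hJ : ∀ ε : ℝ, 0 < ε → ∃ C : ℝ, ∀ T : ℝ, 1 ≤ T → Jneg1 T ≤ ENNReal.ofReal (C * T ^ (1 + ε)))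
    {ρ : ℂ} (hρ : riemannZeta ρ = 0) (him : 0 < ρ.im) : deriv riemannZeta ρ ≠ 0 := by
  intro h
  obtain ⟨C, hC⟩ := hJ 1 one_pos
  have h1 := hC (max 1 ρ.im) (le_max_left _ _)
  have h2 := ENNReal.le_tsum (f := fun ρ : zetaZeros (max 1 ρ.im) ↦
    (‖deriv riemannZeta (ρ : ℂ)‖ₑ ^ 2)⁻¹) ⟨ρ, hρ, him, le_max_right _ _⟩
  simp only [h, enorm_zero, ne_eq, OfNat.ofNat_ne_zero, not_false_eq_true, zero_pow,
    ENNReal.inv_zero, top_le_iff] at h2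
  rw [Jneg1, h2] at h1
  exact absurd h1 (by simp)

lemma ofReal_norm_inv_sq {w : ℂ} (hw : w ≠ 0) : ENNReal.ofReal (‖w⁻¹‖ ^ 2) = (‖w‖ₑ ^ 2)⁻¹ := by
  rw [ENNReal.ofReal_pow (norm_nonneg _), ofReal_norm, enorm_inv hw, ENNReal.inv_pow]

lemma sum_norm_inv_sq_le_of_Jneg1_le {T D : ℝ} (hD : 0 ≤ D)
    (hJ : Jneg1 T ≤ ENNReal.ofReal D) (Z : Finset ℂ) (hZ : ∀ ρ ∈ Z, ρ ∈ zetaZeros T)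
    (hne : ∀ ρ ∈ Z, deriv riemannZeta ρ ≠ 0) :
    ∑ ρ ∈ Z, ‖(deriv riemannZeta ρ)⁻¹‖ ^ 2 ≤ D := by
  classical
  have h1 : ENNReal.ofReal (∑ ρ ∈ Z, ‖(deriv riemannZeta ρ)⁻¹‖ ^ 2) ≤ ENNReal.ofReal D := by
    refine le_trans ?_ hJ
    rw [ENNReal.ofReal_sum_of_nonneg fun _ _ ↦ by positivity]
    have h2 : ∑ ρ ∈ Z, ENNReal.ofReal (‖(deriv riemannZeta ρ)⁻¹‖ ^ 2) =
        ∑ ρ ∈ Z.subtype (· ∈ zetaZeros T), (‖deriv riemannZeta (ρ : ℂ)‖ₑ ^ 2)⁻¹ := by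
      rw [Finset.sum_subtype_of_mem (p := (· ∈ zetaZeros T))
        (fun ρ ↦ (‖deriv riemannZeta ρ‖ₑ ^ 2)⁻¹) hZ]
      exact Finset.sum_congr rfl fun ρ hρ ↦ ofReal_norm_inv_sq (hne ρ hρ)
    rw [h2]
    exact ENNReal.sum_le_tsum _
  exact (ENNReal.ofReal_le_ofReal_iff hD).mp h1

/-- A zero belongs only to windows whose height j satisfies |γ - j| ≤ 3, hence to at most 7 of them,
and the windows up to n reach height n + 3. -/
lemma sum_windowSum_le {n : ℕ} {D : ℝ} (hD : 0 ≤ D) (hJ : Jneg1 (n + 3) ≤ ENNReal.ofReal D)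
    (hsimple : ∀ ρ, riemannZeta ρ = 0 → 0 < ρ.im → deriv riemannZeta ρ ≠ 0) :
    ∑ j ∈ Finset.Icc 16 n, windowSum j ≤ 7 * D := by
  classical
  set Z : Finset ℂ := (Finset.Icc 16 n).biUnion fun j ↦ zeroWindow j with hZ
  have hmem : ∀ ρ ∈ Z, ρ ∈ zetaZeros (n + 3) := by
    intro ρ hρ
    rw [hZ, Finset.mem_biUnion] at hρ
    obtain ⟨j, hj, hρj⟩ := hρ
    rw [Finset.mem_Icc] at hj
    have hj1 : (16 : ℝ) ≤ j := by exact_mod_cast hj.1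
    have hj2 : (j : ℝ) ≤ n := by exact_mod_cast hj.2
    refine ⟨(mem_zeroWindow.mp hρj).1, im_pos_of_mem_zeroWindow hj1 hρj, ?_⟩
    linarith [(abs_le.mp (abs_im_sub_le_of_mem_zeroWindow hρj)).2]
  have hsum := sum_norm_inv_sq_le_of_Jneg1_le hD hJ Z hmem
    fun ρ hρ ↦ hsimple ρ (hmem ρ hρ).1 (hmem ρ hρ).2.1
  have hcard : ∀ ρ : ℂ, (((Finset.Icc 16 n).filter fun j : ℕ ↦ ρ ∈ zeroWindow j).card : ℝ) ≤ 7 := by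
    intro ρ
    have hsub : ((Finset.Icc 16 n).filter fun j : ℕ ↦ ρ ∈ zeroWindow j) ⊆
        Finset.Icc ⌈ρ.im - 3⌉₊ (⌈ρ.im - 3⌉₊ + 6) := by
      intro j hj
      rw [Finset.mem_filter, Finset.mem_Icc] at hj
      have h1 := abs_le.mp (abs_im_sub_le_of_mem_zeroWindow hj.2)
      have h2 := Nat.le_ceil (ρ.im - 3)
      rw [Finset.mem_Icc]
      refine ⟨Nat.ceil_le.mpr (by linarith), ?_⟩
      have : (j : ℝ) ≤ ((⌈ρ.im - 3⌉₊ + 6 : ℕ) : ℝ) := by push_cast; linarith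
      exact_mod_cast this
    have := Finset.card_le_card hsub
    rw [Nat.card_Icc] at this
    exact_mod_cast (by omega : ((Finset.Icc 16 n).filter fun j : ℕ ↦ ρ ∈ zeroWindow j).card ≤ 7)
  calc ∑ j ∈ Finset.Icc 16 n, windowSum j
      = ∑ j ∈ Finset.Icc 16 n, ∑ ρ ∈ Z, if ρ ∈ zeroWindow j then
          ‖(deriv riemannZeta ρ)⁻¹‖ ^ 2 else 0 := by
        refine Finset.sum_congr rfl fun j hj ↦ ?_
        rw [windowSum, ← Finset.sum_filter]
        refine Finset.sum_congr ?_ fun _ _ ↦ rfl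
        ext ρ
        rw [Finset.mem_filter, hZ, Finset.mem_biUnion]
        exact ⟨fun h ↦ ⟨⟨j, hj, h⟩, h⟩, fun h ↦ h.2⟩
    _ = ∑ ρ ∈ Z, (((Finset.Icc 16 n).filter fun j : ℕ ↦ ρ ∈ zeroWindow j).card : ℝ) *
          ‖(deriv riemannZeta ρ)⁻¹‖ ^ 2 := by
        rw [Finset.sum_comm]
        refine Finset.sum_congr rfl fun ρ _ ↦ ?_
        rw [← Finset.sum_filter, Finset.sum_const, nsmul_eq_mul]
    _ ≤ ∑ ρ ∈ Z, 7 * ‖(deriv riemannZeta ρ)⁻¹‖ ^ 2 :=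
        Finset.sum_le_sum fun ρ _ ↦ by gcongr; exact hcard ρ
    _ = 7 * ∑ ρ ∈ Z, ‖(deriv riemannZeta ρ)⁻¹‖ ^ 2 := by rw [Finset.mul_sum]
    _ ≤ 7 * D := by gcongr

/-- Partial summation, in the form of the convergence of a Dirichlet series at b: the partial sums
of the coefficients are O(n^(1+ε)) with 1 + ε < b. -/
lemma summable_windowSum
    (hJ : ∀ ε : ℝ, 0 < ε → ∃ C : ℝ, ∀ T : ℝ, 1 ≤ T → Jneg1 T ≤ ENNReal.ofReal (C * T ^ (1 + ε)))
    {b : ℝ} (hb : 1 < b) :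
    Summable fun n : ℕ ↦ ((n + 16 : ℕ) : ℝ) ^ (-b) * windowSum ((n + 16 : ℕ) : ℝ) := by
  set ε := (b - 1) / 2 with hε
  have hε0 : 0 < ε := by linarith
  obtain ⟨C, hC⟩ := hJ ε hε0
  set f : ℕ → ℂ := fun n ↦ if 16 ≤ n then (windowSum n : ℂ) else 0 with hf
  have hfn : ∀ n : ℕ, ‖f n‖ = if 16 ≤ n then windowSum n else 0 := by
    intro n
    simp only [hf]
    split_ifs
    · rw [Complex.norm_real, Real.norm_of_nonneg (windowSum_nonneg _)]
    · exact norm_zero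
  have hO : (fun n ↦ ∑ j ∈ Finset.Icc 1 n, ‖f j‖) =O[atTop] fun n : ℕ ↦ (n : ℝ) ^ (1 + ε) := by
    refine Asymptotics.IsBigO.of_bound (7 * (|C| * 4 ^ (1 + ε))) ?_
    filter_upwards [eventually_ge_atTop 1] with n hn
    have hn1 : (1 : ℝ) ≤ n := by exact_mod_cast hn
    have hD : C * ((n : ℝ) + 3) ^ (1 + ε) ≤ |C| * 4 ^ (1 + ε) * (n : ℝ) ^ (1 + ε) := by
      rw [mul_assoc, ← Real.mul_rpow (by norm_num) (by linarith)]
      gcongr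
      · exact le_abs_self C
      · linarith
    have h1 := sum_windowSum_le (n := n) (D := |C| * 4 ^ (1 + ε) * (n : ℝ) ^ (1 + ε))
      (by positivity)
      ((hC (n + 3) (by linarith)).trans (ENNReal.ofReal_le_ofReal hD))
      fun ρ h h' ↦ deriv_ne_zero_of_Jneg1_le hJ h h'
    rw [Real.norm_of_nonneg (Finset.sum_nonneg fun _ _ ↦ norm_nonneg _),
      Real.norm_of_nonneg (by positivity)]
    have h2 : ∑ j ∈ Finset.Icc 1 n, ‖f j‖ = ∑ j ∈ Finset.Icc 16 n, windowSum j := by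
      simp only [hfn]
      rw [← Finset.sum_filter]
      refine Finset.sum_congr ?_ fun _ _ ↦ rfl
      ext j
      simp only [Finset.mem_filter, Finset.mem_Icc]
      omega
    rw [h2]
    linarith
  have hs := LSeriesSummable_of_sum_norm_bigO hO (by linarith) (s := (b : ℂ)) (by simp; linarith)
  have hs' := (summable_nat_add_iff 16).mpr hs.norm
  refine hs'.congr fun n ↦ ?_
  rw [LSeries.term_of_ne_zero (by omega), norm_div, hfn, if_pos (by omega),
    Complex.norm_natCast_cpow_of_pos (by omega), Complex.ofReal_re, Real.rpow_neg (by positivity),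
    div_eq_inv_mul]

/-- A weighted mean square of `1 / ζ` to the right of the critical line. -/
lemma RiemannHypothesis.lintegral_inv_riemannZeta_weighted_le (hRH : RiemannHypothesis)
    (hJ : ∀ ε : ℝ, 0 < ε → ∃ C : ℝ, ∀ T : ℝ, 1 ≤ T → Jneg1 T ≤ ENNReal.ofReal (C * T ^ (1 + ε)))
    {a : ℝ} (ha : 1 < a) :
    ∃ C : ℝ, 0 < C ∧ ∀ δ : ℝ, 0 < δ → δ ≤ 1 →
      ∫⁻ t in Ioi (16 : ℝ), ENNReal.ofReal (t ^ (-a)) * ‖(riemannZeta (1 / 2 + δ + t * I))⁻¹‖ₑ ^ 2 ≤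
        ENNReal.ofReal (C / δ) := by
  -- A window at height τ costs τ^ε. The remaining exponent a - ε is still above 1, so the sum over
  -- windows converges.
  set ε := (a - 1) / 2 with hε
  have hε0 : 0 < ε := by linarith
  obtain ⟨C, hC, h⟩ := hRH.lintegral_inv_riemannZeta_window_le
    (fun ρ h h' ↦ deriv_ne_zero_of_Jneg1_le hJ h h') hε0
  set v : ℕ → ℝ := fun n ↦ ((n + 16 : ℕ) : ℝ) ^ (-(a - ε)) * (1 + windowSum ((n + 16 : ℕ) : ℝ))
    with hv
  have hb : 1 < a - ε := by linarith
  have hv0 : ∀ n, 0 ≤ v n := fun n ↦ mul_nonneg (by positivity)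
    (add_nonneg zero_le_one (windowSum_nonneg _))
  have hvs : Summable v := by
    have h1 : Summable fun n : ℕ ↦ ((n + 16 : ℕ) : ℝ) ^ (-(a - ε)) :=
      (summable_nat_add_iff 16).mpr (Real.summable_nat_rpow.mpr (by linarith))
    refine (h1.add (summable_windowSum hJ hb)).congr fun n ↦ ?_
    simp only [hv]; ring
  have hV : 0 ≤ ∑' n, v n := tsum_nonneg hv0
  refine ⟨C * ∑' n, v n + 1, by positivity, fun δ hδ hδ1 ↦ ?_⟩
  have hcover : Ioi (16 : ℝ) ⊆ ⋃ n : ℕ, Ioc ((n + 16 : ℕ) : ℝ) (((n + 16 : ℕ) : ℝ) + 1) := by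
    intro t ht
    rw [mem_Ioi] at ht
    rw [mem_iUnion]
    have h1 : 16 < ⌈t⌉₊ := Nat.lt_ceil.mpr (by exact_mod_cast ht)
    refine ⟨⌈t⌉₊ - 17, ?_, ?_⟩
    · rw [show ⌈t⌉₊ - 17 + 16 = ⌈t⌉₊ - 1 by omega]
      exact Nat.lt_ceil.mp (by omega)
    · have h2 := Nat.le_ceil t
      have h3 : ((⌈t⌉₊ - 17 + 16 : ℕ) : ℝ) + 1 = ⌈t⌉₊ := by
        rw [show ⌈t⌉₊ - 17 + 16 = ⌈t⌉₊ - 1 by omega, Nat.cast_sub (by omega)]; push_cast; ring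
      rw [h3]; exact h2
  have hterm : ∀ n : ℕ, ∫⁻ t in Ioc ((n + 16 : ℕ) : ℝ) (((n + 16 : ℕ) : ℝ) + 1),
      ENNReal.ofReal (t ^ (-a)) * ‖(riemannZeta (1 / 2 + δ + t * I))⁻¹‖ₑ ^ 2 ≤
        ENNReal.ofReal (C / δ * v n) := by
    intro n
    set τ : ℝ := ((n + 16 : ℕ) : ℝ) with hτ
    have hτ16 : 16 ≤ τ := by rw [hτ]; push_cast; linarith [(n.cast_nonneg : (0 : ℝ) ≤ n)]
    have hτ0 : 0 < τ := by linarith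
    calc ∫⁻ t in Ioc τ (τ + 1),
          ENNReal.ofReal (t ^ (-a)) * ‖(riemannZeta (1 / 2 + δ + t * I))⁻¹‖ₑ ^ 2
        ≤ ∫⁻ t in Ioc τ (τ + 1),
          ENNReal.ofReal (τ ^ (-a)) * ‖(riemannZeta (1 / 2 + δ + t * I))⁻¹‖ₑ ^ 2 := by
          refine setLIntegral_mono' measurableSet_Ioc fun t ht ↦ ?_
          gcongr ENNReal.ofReal ?_ * _
          exact Real.rpow_le_rpow_of_nonpos hτ0 ht.1.le (by linarith)
      _ = ENNReal.ofReal (τ ^ (-a)) *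
          ∫⁻ t in Ioc τ (τ + 1), ‖(riemannZeta (1 / 2 + δ + t * I))⁻¹‖ₑ ^ 2 :=
          lintegral_const_mul' _ _ ENNReal.ofReal_ne_top
      _ ≤ ENNReal.ofReal (τ ^ (-a)) * ENNReal.ofReal (C * τ ^ ε / δ * (1 + windowSum τ)) := by
          gcongr
          exact h τ hτ16 δ hδ hδ1
      _ = ENNReal.ofReal (C / δ * v n) := by
          rw [← ENNReal.ofReal_mul (by positivity)]
          congr 1
          simp only [hv]
          rw [← hτ, show -(a - ε) = -a + ε by ring, Real.rpow_add hτ0]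
          ring
  calc _ ≤ ∫⁻ t in ⋃ n : ℕ, Ioc ((n + 16 : ℕ) : ℝ) (((n + 16 : ℕ) : ℝ) + 1),
        ENNReal.ofReal (t ^ (-a)) * ‖(riemannZeta (1 / 2 + δ + t * I))⁻¹‖ₑ ^ 2 :=
        lintegral_mono_set hcover
    _ ≤ ∑' n : ℕ, ∫⁻ t in Ioc ((n + 16 : ℕ) : ℝ) (((n + 16 : ℕ) : ℝ) + 1),
        ENNReal.ofReal (t ^ (-a)) * ‖(riemannZeta (1 / 2 + δ + t * I))⁻¹‖ₑ ^ 2 :=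
        lintegral_iUnion_le _ _
    _ ≤ ∑' n : ℕ, ENNReal.ofReal (C / δ * v n) := ENNReal.tsum_le_tsum hterm
    _ = ENNReal.ofReal (C / δ * ∑' n, v n) := by
        rw [← tsum_mul_left, ENNReal.ofReal_tsum_of_nonneg
          (fun n ↦ mul_nonneg (by positivity) (hv0 n)) (hvs.mul_left _)]
    _ ≤ _ := by
        refine ENNReal.ofReal_le_ofReal ?_
        rw [div_mul_eq_mul_div]
        gcongr
        linarith

/-- This carries the simplicity of zeros over to the lower half-plane. -/
lemma norm_deriv_riemannZeta_conj (s : ℂ) :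
    ‖deriv riemannZeta (conj s)‖ = ‖deriv riemannZeta s‖ := by
  have h : (conj ∘ riemannZeta ∘ conj : ℂ → ℂ) = riemannZeta := by
    funext z
    simp only [Function.comp_apply, riemannZeta_conj, conj_conj]
  have h2 := congrFun (deriv_conj_conj (f := riemannZeta)) s
  rw [h] at h2
  rw [h2, Function.comp_apply, Function.comp_apply, Complex.norm_conj]

/-- The mean square of `1 / ζ` over a bounded part of a vertical line. -/
lemma RiemannHypothesis.lintegral_inv_riemannZeta_bounded_le (hRH : RiemannHypothesis)
    (hsimple : ∀ ρ, riemannZeta ρ = 0 → 0 < ρ.im → deriv riemannZeta ρ ≠ 0) :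
    ∃ C : ℝ, 0 < C ∧ ∀ δ : ℝ, 0 < δ → δ ≤ 1 →
      ∫⁻ t in Ioc (-16 : ℝ) 16, ‖(riemannZeta (1 / 2 + δ + t * I))⁻¹‖ₑ ^ 2 ≤
        ENNReal.ofReal (C / δ) := by
  classical
  -- The disc holds every zero of the critical line with |γ| ≤ 17. It also reaches trivial zeros,
  -- which the filter discards.
  set W : Finset ℂ := (finite_zeros_closedBall (1 / 2) 17).toFinset.filter fun ρ ↦ ρ.re = 1 / 2
    with hW
  have hmemW : ∀ ρ, ρ ∈ W ↔ (riemannZeta ρ = 0 ∧ ‖ρ - 1 / 2‖ ≤ 17) ∧ ρ.re = 1 / 2 := by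
    intro ρ; simp [hW]
  have him : ∀ ρ ∈ W, ρ.im ≠ 0 := by
    intro ρ hρ h
    have hρ' := (hmemW ρ).mp hρ
    have : ρ = 1 / 2 := Complex.ext (by simpa using hρ'.2) (by simpa using h)
    exact riemannZeta_one_half_ne_zero (this ▸ hρ'.1.1)
  have hne1 : ∀ ρ ∈ W, ρ ≠ 1 := fun ρ hρ h ↦ him ρ hρ (by rw [h]; simp)
  have hder : ∀ ρ ∈ W, deriv riemannZeta₁ ρ ≠ 0 := by
    intro ρ hρ
    have h0 := ((hmemW ρ).mp hρ).1.1
    rw [deriv_riemannZeta₁_of_zero (hne1 ρ hρ) h0]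
    refine mul_ne_zero (sub_ne_zero.mpr (hne1 ρ hρ)) ?_
    rcases lt_or_gt_of_ne (him ρ hρ) with h | h
    · rw [← norm_ne_zero_iff, ← norm_deriv_riemannZeta_conj, norm_ne_zero_iff]
      exact hsimple _ (by rw [riemannZeta_conj, h0, map_zero]) (by simpa using h)
    · exact hsimple ρ h0 h
  set U : Set ℂ := Ioo (1 / 4) 2 ×ℂ Ioo (-17) 17 with hU
  have hUo : IsOpen U := isOpen_Ioo.reProdIm isOpen_Ioo
  -- The rectangle contains the pole of ζ at 1, so `riemannZeta₁` is used instead.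
  obtain ⟨g, hg, hgf⟩ := exists_inv_sub_polarSum (f := riemannZeta₁) hUo W
    differentiable_riemannZeta₁.differentiableOn
    (by
      intro z hz h0
      rw [hU, Complex.mem_reProdIm] at hz
      have hz1 : z ≠ 1 := by rintro rfl; rw [riemannZeta₁_one] at h0; exact one_ne_zero h0
      rw [riemannZeta₁_eq_mul hz1] at h0
      have hζ := (mul_eq_zero.mp h0).resolve_left (sub_ne_zero.mpr hz1)
      have hre : z.re = 1 / 2 := by
        by_contra h
        exact hRH.riemannZeta_ne_zero (by linarith [hz.1.1]) h hζ
      refine (hmemW z).mpr ⟨⟨hζ, (Complex.norm_le_abs_re_add_abs_im _).trans ?_⟩, hre⟩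
      have : |z.im| ≤ 17 := abs_le.mpr ⟨hz.2.1.le, hz.2.2.le⟩
      simpa [hre] using this)
    (fun ρ hρ ↦ ⟨differentiable_riemannZeta₁ ρ, by
      rw [riemannZeta₁_eq_mul (hne1 ρ hρ), ((hmemW ρ).mp hρ).1.1, mul_zero], hder ρ hρ⟩)
  have hKc : IsCompact (Icc (1 / 2 : ℝ) (3 / 2) ×ℂ Icc (-16 : ℝ) 16) :=
    isCompact_Icc.reProdIm isCompact_Icc
  have hKU : Icc (1 / 2 : ℝ) (3 / 2) ×ℂ Icc (-16 : ℝ) 16 ⊆ U := by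
    intro z hz
    rw [Complex.mem_reProdIm] at hz
    rw [hU, Complex.mem_reProdIm]
    exact ⟨⟨by linarith [hz.1.1], by linarith [hz.1.2]⟩, by linarith [hz.2.1], by linarith [hz.2.2]⟩
  obtain ⟨M, hM⟩ := hKc.exists_bound_of_continuousOn (hg.continuousOn.mono hKU)
  set N : ℝ := (W.card : ℝ) with hN
  set q : ℂ → ℝ := fun ρ ↦ ‖(deriv riemannZeta₁ ρ)⁻¹‖ ^ 2 with hq
  have hQ0 : 0 ≤ ∑ ρ ∈ W, q ρ := Finset.sum_nonneg fun _ _ ↦ by positivity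
  have hN0 : 0 ≤ N := Nat.cast_nonneg _
  refine ⟨578 * (32 * M ^ 2 + N * ((∑ ρ ∈ W, q ρ) * Real.pi)) + 1, by positivity,
    fun δ hδ hδ1 ↦ ?_⟩
  set h : ℝ → ℝ := fun t ↦ 578 * M ^ 2 + 578 * N * ∑ ρ ∈ W, q ρ * (δ ^ 2 + (t - ρ.im) ^ 2)⁻¹
    with hh
  -- For δ = 1/2 and t = 0 the point is s = 1, where the value of `riemannZeta` is conventional;
  -- this null set is left out. The constant is 578 = 2 · 17².
  have hpt : ∀ t ∈ Ioc (-16 : ℝ) 16, t ≠ 0 →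
      ‖(riemannZeta (1 / 2 + δ + t * I))⁻¹‖ ^ 2 ≤ h t := by
    intro t ht ht0
    set s : ℂ := 1 / 2 + δ + t * I with hs
    have hsre : s.re = 1 / 2 + δ := by simp [hs]
    have hsim : s.im = t := by simp [hs]
    have hs1 : s ≠ 1 := by
      intro h
      rw [h] at hsim
      exact ht0 (by rw [← hsim]; simp)
    have hsW : s ∉ W := fun h ↦ by
      have := ((hmemW s).mp h).2
      rw [hsre] at this
      linarith
    have hsK : s ∈ Icc (1 / 2 : ℝ) (3 / 2) ×ℂ Icc (-16 : ℝ) 16 := by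
      rw [Complex.mem_reProdIm, hsre, hsim]
      exact ⟨⟨by linarith, by linarith⟩, ht.1.le, ht.2⟩
    have h1 : (riemannZeta s)⁻¹ = (s - 1) * (riemannZeta₁ s)⁻¹ := by
      rw [riemannZeta₁_eq_mul hs1, mul_inv, mul_inv_cancel_left₀ (sub_ne_zero.mpr hs1)]
    have h2 : ‖s - 1‖ ≤ 17 := by
      refine (Complex.norm_le_abs_re_add_abs_im _).trans ?_
      have h3 : |s.re - 1| ≤ 1 := by rw [hsre, abs_le]; constructor <;> linarith
      have h4 : |s.im| ≤ 16 := by rw [hsim, abs_le]; exact ⟨ht.1.le, ht.2⟩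
      rw [sub_re, sub_im, one_re, one_im, sub_zero]
      linarith
    have h5 : ‖(riemannZeta₁ s)⁻¹‖ ≤ M + ‖polarSum riemannZeta₁ W s‖ := by
      have := hgf s hsW
      rw [eq_sub_iff_add_eq] at this
      rw [← this]
      exact (norm_add_le _ _).trans (by gcongr; exact hM s hsK)
    have h6 := norm_sq_polarSum_le (f := riemannZeta₁) W (fun ρ hρ ↦ ((hmemW ρ).mp hρ).2)
      (δ := δ) (t := t)
    rw [h1, norm_mul]
    calc (‖s - 1‖ * ‖(riemannZeta₁ s)⁻¹‖) ^ 2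
        ≤ (17 * (M + ‖polarSum riemannZeta₁ W s‖)) ^ 2 := by gcongr
      _ ≤ 578 * M ^ 2 + 578 * ‖polarSum riemannZeta₁ W s‖ ^ 2 := by
          nlinarith [sq_nonneg (M - ‖polarSum riemannZeta₁ W s‖)]
      _ ≤ 578 * M ^ 2 + 578 * (N * ∑ ρ ∈ W, q ρ * (δ ^ 2 + (t - ρ.im) ^ 2)⁻¹) := by gcongr
      _ = h t := by rw [hh]; ring
  have hcont1 : ∀ ρ : ℂ, Continuous fun t : ℝ ↦ q ρ * (δ ^ 2 + (t - ρ.im) ^ 2)⁻¹ := fun ρ ↦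
    continuous_const.mul (Continuous.inv₀ (by fun_prop) fun t ↦ by positivity)
  have hcont2 : Continuous fun t : ℝ ↦ ∑ ρ ∈ W, q ρ * (δ ^ 2 + (t - ρ.im) ^ 2)⁻¹ :=
    continuous_finsetSum _ fun ρ _ ↦ hcont1 ρ
  have hcont : Continuous h := continuous_const.add (continuous_const.mul hcont2)
  have hint : ∫ t in Ioc (-16 : ℝ) 16, h t ≤
      32 * (578 * M ^ 2) + 578 * N * ((∑ ρ ∈ W, q ρ) * (Real.pi / δ)) := by
    rw [← intervalIntegral.integral_of_le (by norm_num), hh,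
      intervalIntegral.integral_add intervalIntegrable_const
        ((hcont2.intervalIntegrable _ _).const_mul _),
      intervalIntegral.integral_const, intervalIntegral.integral_const_mul,
      intervalIntegral.integral_finsetSum fun ρ _ ↦ (hcont1 ρ).intervalIntegrable _ _]
    simp only [intervalIntegral.integral_const_mul]
    refine add_le_add (le_of_eq (by norm_num)) ?_
    gcongr
    rw [Finset.sum_mul]
    refine Finset.sum_le_sum fun ρ _ ↦ ?_
    rw [hq]
    gcongr
    exact integral_inv_sq_add_sq_le hδ _ _ _
  calc ∫⁻ t in Ioc (-16 : ℝ) 16, ‖(riemannZeta (1 / 2 + δ + t * I))⁻¹‖ₑ ^ 2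
      ≤ ∫⁻ t in Ioc (-16 : ℝ) 16, ENNReal.ofReal (h t) := by
        refine lintegral_mono_ae ?_
        filter_upwards [ae_restrict_mem measurableSet_Ioc,
          compl_mem_ae_iff.mpr (measure_singleton (0 : ℝ))] with t ht ht0
        rw [← ofReal_norm, ← ENNReal.ofReal_pow (norm_nonneg _)]
        exact ENNReal.ofReal_le_ofReal (hpt t ht ht0)
    _ = ENNReal.ofReal (∫ t in Ioc (-16 : ℝ) 16, h t) := by
        rw [ofReal_integral_eq_lintegral_ofReal (hcont.integrableOn_Ioc)]
        refine Eventually.of_forall fun t ↦ add_nonneg (by positivity) (mul_nonneg (by positivity) ?_)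
        exact Finset.sum_nonneg fun ρ _ ↦ by positivity
    _ ≤ _ := by
        refine ENNReal.ofReal_le_ofReal (hint.trans ?_)
        rw [le_div_iff₀ hδ]
        have h7 : 32 * (578 * M ^ 2) * δ ≤ 32 * (578 * M ^ 2) * 1 := by gcongr
        have h8 : 578 * N * ((∑ ρ ∈ W, q ρ) * (Real.pi / δ)) * δ =
            578 * N * ((∑ ρ ∈ W, q ρ) * Real.pi) := by field_simp
        rw [add_mul, h8]
        linarith

/-- The weighted mean square of `1 / ζ` over a vertical line to the right of the critical line. -/
lemma RiemannHypothesis.lintegral_inv_riemannZeta_le (hRH : RiemannHypothesis)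
    (hJ : ∀ ε : ℝ, 0 < ε → ∃ C : ℝ, ∀ T : ℝ, 1 ≤ T → Jneg1 T ≤ ENNReal.ofReal (C * T ^ (1 + ε)))
    {a : ℝ} (ha : 1 < a) :
    ∃ C : ℝ, 0 < C ∧ ∀ δ : ℝ, 0 < δ → δ ≤ 1 →
      ∫⁻ t : ℝ, ENNReal.ofReal ((1 + |t|) ^ (-a)) * ‖(riemannZeta (1 / 2 + δ + t * I))⁻¹‖ₑ ^ 2 ≤
        ENNReal.ofReal (C / δ) := by
  obtain ⟨C₁, hC₁, h₁⟩ := hRH.lintegral_inv_riemannZeta_weighted_le hJ ha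
  obtain ⟨C₂, hC₂, h₂⟩ := hRH.lintegral_inv_riemannZeta_bounded_le
    (fun ρ h h' ↦ deriv_ne_zero_of_Jneg1_le hJ h h')
  refine ⟨2 * C₁ + C₂, by positivity, fun δ hδ hδ1 ↦ ?_⟩
  set F : ℝ → ℝ≥0∞ := fun t ↦ ENNReal.ofReal ((1 + |t|) ^ (-a)) *
    ‖(riemannZeta (1 / 2 + δ + t * I))⁻¹‖ₑ ^ 2 with hF
  have hneg : ∀ t, F (-t) = F t := by
    intro t
    simp only [hF, abs_neg]
    have : (1 / 2 + δ + (-t : ℝ) * I : ℂ) = conj (1 / 2 + δ + t * I : ℂ) := by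
      apply Complex.ext <;> simp
    rw [this, riemannZeta_conj, ← map_inv₀, RCLike.enorm_conj]
  have hpos : ∫⁻ t in Ioi (16 : ℝ), F t ≤ ENNReal.ofReal (C₁ / δ) := by
    refine le_trans (setLIntegral_mono' measurableSet_Ioi fun t ht ↦ ?_) (h₁ δ hδ hδ1)
    rw [mem_Ioi] at ht
    simp only [hF]
    gcongr ENNReal.ofReal ?_ * _
    refine Real.rpow_le_rpow_of_nonpos (by linarith) ?_ (by linarith)
    linarith [le_abs_self t]
  have hmid : ∫⁻ t in Ioc (-16 : ℝ) 16, F t ≤ ENNReal.ofReal (C₂ / δ) := by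
    refine le_trans (setLIntegral_mono' measurableSet_Ioc fun t ht ↦ ?_) (h₂ δ hδ hδ1)
    simp only [hF]
    refine mul_le_of_le_one_left zero_le (ENNReal.ofReal_le_one.mpr ?_)
    exact Real.rpow_le_one_of_one_le_of_nonpos (by linarith [abs_nonneg t]) (by linarith)
  have hnegint : ∫⁻ t in Iic (-16 : ℝ), F t = ∫⁻ t in Ioi (16 : ℝ), F t := by
    have hmp := (Measure.measurePreserving_neg (volume : Measure ℝ)).setLIntegral_comp_preimage_emb
      (MeasurableEquiv.neg ℝ).measurableEmbedding F (Iic (-16 : ℝ))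
    have hpre : (Neg.neg ⁻¹' Iic (-16) : Set ℝ) = Ici 16 := by ext t; simp
    rw [← hmp, hpre]
    simp only [hneg]
    exact setLIntegral_congr Ioi_ae_eq_Ici.symm
  have huniv : (univ : Set ℝ) = Iic (-16) ∪ Ioc (-16) 16 ∪ Ioi 16 := by
    rw [Iic_union_Ioc_eq_Iic (by norm_num), Iic_union_Ioi]
  rw [← setLIntegral_univ, huniv]
  calc _ ≤ (∫⁻ t in Iic (-16 : ℝ), F t) + (∫⁻ t in Ioc (-16 : ℝ) 16, F t) +
        ∫⁻ t in Ioi (16 : ℝ), F t :=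
        (lintegral_union_le _ _ _).trans (add_le_add_left (lintegral_union_le _ _ _) _)
    _ ≤ ENNReal.ofReal (C₁ / δ) + ENNReal.ofReal (C₂ / δ) + ENNReal.ofReal (C₁ / δ) := by
        rw [hnegint]; gcongr
    _ = _ := by
        rw [← ENNReal.ofReal_add (by positivity) (by positivity),
          ← ENNReal.ofReal_add (by positivity) (by positivity)]
        congr 1
        ring

/-! ### L² bounds from continued Laplace transforms -/

lemma lintegral_enorm_sq_eq_eLpNorm (f : ℝ → ℂ) :
    ∫⁻ x, ‖f x‖ₑ ^ 2 = eLpNorm f 2 volume ^ 2 := by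
  have h := eLpNorm_nnreal_pow_eq_lintegral (f := f) (p := 2) (μ := volume) two_ne_zero
  norm_num at h
  exact h.symm

/-- The `L²` Fourier transform of an integrable function is given by the Fourier integral. -/
lemma coeFn_fourier_toLp {g : ℝ → ℂ} (hg : Integrable g) (hg2 : MemLp g 2) :
    (𝓕 (hg2.toLp g) : Lp ℂ 2 (volume : Measure ℝ)) =ᵐ[volume] 𝓕 g := by
  set G : Lp ℂ 2 (volume : Measure ℝ) := 𝓕 (hg2.toLp g) with hG
  have hcont : Continuous (𝓕 g) :=
    VectorFourier.fourierIntegral_continuous Real.continuous_fourierChar (by fun_prop) hg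
  -- Both transforms are tested against smooth functions of compact support: the L² transform as a
  -- tempered distribution, the Fourier integral by moving the transform to the test function.
  refine ae_eq_of_integral_contDiff_smul_eq ((Lp.memLp G).locallyIntegrable (by norm_num))
    hcont.locallyIntegrable fun φ hφ hφc ↦ ?_
  have hφ' : ContDiff ℝ ((⊤ : ℕ∞) : WithTop ℕ∞) (fun x ↦ (φ x : ℂ)) :=
    Complex.ofRealCLM.contDiff.comp hφ
  have hφc' : HasCompactSupport (fun x ↦ (φ x : ℂ)) := hφc.comp_left (g := Complex.ofReal) rfl
  set ψ : SchwartzMap ℝ ℂ := hφc'.toSchwartzMap hφ' with hψ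
  have hψa : ∀ x, ψ x = φ x := fun x ↦ rfl
  have h1 := congrArg (fun D : TemperedDistribution ℝ ℂ ↦ D ψ)
    (Lp.fourier_toTemperedDistribution_eq (hg2.toLp g))
  simp only [TemperedDistribution.fourier_apply, Lp.toTemperedDistribution_apply] at h1
  have h2 : ∫ x, (𝓕 (ψ : ℝ → ℂ) x) • g x = ∫ x, ψ x • 𝓕 g x := by
    have := VectorFourier.integral_fourierIntegral_smul_eq_flip (L := innerₗ ℝ) (μ := volume)
      Real.continuous_fourierChar (by fun_prop) ψ.integrable hg
    rw [flip_innerₗ] at this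
    exact this
  have h3 : ∫ x, (𝓕 ψ) x • (hg2.toLp g) x = ∫ x, (𝓕 (ψ : ℝ → ℂ) x) • g x := by
    refine integral_congr_ae ?_
    filter_upwards [hg2.coeFn_toLp] with x hx
    rw [hx, SchwartzMap.fourier_coe]
  simp only [← Complex.coe_smul, ← hψa]
  rw [← h2, ← h3, h1]

/-- Plancherel's theorem for integrable square integrable functions. -/
lemma lintegral_fourierInv_sq {g : ℝ → ℂ} (hg : Integrable g) (hg2 : MemLp g 2) :
    ∫⁻ u, ‖𝓕⁻ g u‖ₑ ^ 2 = ∫⁻ ξ, ‖g ξ‖ₑ ^ 2 := by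
  have h1 : ∫⁻ u, ‖𝓕 g u‖ₑ ^ 2 = ∫⁻ ξ, ‖g ξ‖ₑ ^ 2 := by
    rw [lintegral_enorm_sq_eq_eLpNorm, lintegral_enorm_sq_eq_eLpNorm,
      ← eLpNorm_congr_ae (coeFn_fourier_toLp hg hg2), ← eLpNorm_congr_ae hg2.coeFn_toLp]
    congr 1
    have h2 := Lp.norm_fourier_eq (hg2.toLp g)
    rw [Lp.norm_def, Lp.norm_def] at h2
    exact (ENNReal.toReal_eq_toReal_iff' (Lp.eLpNorm_ne_top _) (Lp.eLpNorm_ne_top _)).mp h2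
  rw [← h1]
  have h4 : ∀ u, 𝓕⁻ g u = 𝓕 g (-u) := fun u ↦ Real.fourierInv_eq_fourier_neg g u
  simp only [h4]
  exact lintegral_neg_eq_self (fun u ↦ ‖𝓕 g u‖ₑ ^ 2)

lemma lintegral_comp_mul_left_le (f : ℝ → ℝ≥0∞) {a : ℝ} (ha : 1 ≤ a) :
    ∫⁻ x, f (a * x) ≤ ∫⁻ x, f x := by
  have ha0 : a ≠ 0 := by linarith
  have h := ((Homeomorph.mulLeft₀ a ha0).measurableEmbedding).lintegral_map (μ := volume) f
  simp only [Homeomorph.coe_mulLeft₀] at h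
  rw [← h, Real.map_volume_mul_left ha0, lintegral_smul_measure, smul_eq_mul]
  refine mul_le_of_le_one_left zero_le (ENNReal.ofReal_le_one.mpr ?_)
  rw [abs_of_nonneg (by positivity)]
  exact inv_le_one_of_one_le₀ ha

lemma integrable_vertical {G : ℂ → ℂ} {a M p : ℝ} (hp : 1 < p)
    (hG : ContinuousOn G {s | s.re = a}) (hb : ∀ s, s.re = a → ‖G s‖ ≤ M * (1 + |s.im|) ^ (-p)) :
    Integrable fun y : ℝ ↦ G (a + y * I) := by
  have h1 : Integrable fun y : ℝ ↦ M * (1 + ‖y‖) ^ (-p) :=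
    (integrable_one_add_norm (by simpa using hp)).const_mul M
  have hcont : Continuous fun y : ℝ ↦ G (a + y * I) := by
    refine hG.comp_continuous (by fun_prop) fun y ↦ ?_
    simp
  refine h1.mono' hcont.aestronglyMeasurable (Eventually.of_forall fun y ↦ ?_)
  have := hb (a + y * I) (by simp)
  simpa using this

/-- Moving a vertical line of integration. -/
lemma integral_vertical_eq {G : ℂ → ℂ} {a b M p : ℝ} (hab : a ≤ b) (hp : 1 < p)
    (hG : DifferentiableOn ℂ G {s | a ≤ s.re ∧ s.re ≤ b})
    (hb : ∀ s : ℂ, a ≤ s.re → s.re ≤ b → ‖G s‖ ≤ M * (1 + |s.im|) ^ (-p)) :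
    ∫ y : ℝ, G (a + y * I) = ∫ y : ℝ, G (b + y * I) := by
  have hIa : Integrable fun y : ℝ ↦ G (a + y * I) := integrable_vertical hp
    (hG.continuousOn.mono fun s hs ↦ ⟨hs.ge, (le_of_eq hs).trans hab⟩)
    fun s hs ↦ hb s hs.ge (hs.le.trans hab)
  have hIb : Integrable fun y : ℝ ↦ G (b + y * I) := integrable_vertical hp
    (hG.continuousOn.mono fun s hs ↦ ⟨hab.trans (le_of_eq hs.symm), le_of_eq hs⟩)
    fun s hs ↦ hb s (hab.trans hs.ge) hs.le
  have hneg : Tendsto (fun n : ℕ ↦ -(n : ℝ)) atTop atBot :=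
    tendsto_neg_atTop_atBot.comp tendsto_natCast_atTop_atTop
  have hta := intervalIntegral_tendsto_integral hIa hneg tendsto_natCast_atTop_atTop
  have htb := intervalIntegral_tendsto_integral hIb hneg tendsto_natCast_atTop_atTop
  have hrect : ∀ n : ℕ, (∫ y in (-(n : ℝ))..n, G (b + y * I)) - ∫ y in (-(n : ℝ))..n, G (a + y * I)
      = I * ((∫ x in a..b, G (x + (-n : ℝ) * I)) - ∫ x in a..b, G (x + (n : ℝ) * I)) := by
    intro n
    have h := Complex.integral_boundary_rect_eq_zero_of_differentiableOn G ⟨a, -n⟩ ⟨b, n⟩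
      (hG.mono fun s hs ↦ by
        rw [Complex.mem_reProdIm, uIcc_of_le hab] at hs
        exact hs.1)
    simp only [smul_eq_mul] at h
    linear_combination (-I) * h + ((∫ y in (-(n : ℝ))..n, G (b + y * I)) -
      ∫ y in (-(n : ℝ))..n, G (a + y * I)) * I_sq
  have hbound : ∀ (n : ℕ) (e : ℝ), |e| = n → ‖∫ x in a..b, G (x + e * I)‖ ≤
      M * (1 + (n : ℝ)) ^ (-p) * (b - a) := by
    intro n e he
    have := intervalIntegral.norm_integral_le_of_norm_le_const (a := a) (b := b)
      (f := fun x : ℝ ↦ G (x + e * I)) (C := M * (1 + (n : ℝ)) ^ (-p)) (by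
        intro x hx
        rw [uIoc_of_le hab] at hx
        have := hb (x + e * I) (by simpa using hx.1.le) (by simpa using hx.2)
        rw [← he]
        simpa using this)
    rwa [abs_of_nonneg (by linarith)] at this
  have hzero : Tendsto (fun n : ℕ ↦ (∫ y in (-(n : ℝ))..n, G (b + y * I)) -
      ∫ y in (-(n : ℝ))..n, G (a + y * I)) atTop (𝓝 0) := by
    have hlim : Tendsto (fun n : ℕ ↦ 2 * (M * (1 + (n : ℝ)) ^ (-p) * (b - a))) atTop (𝓝 0) := by
      have h1 : Tendsto (fun n : ℕ ↦ (1 + (n : ℝ)) ^ (-p)) atTop (𝓝 0) :=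
        (tendsto_rpow_neg_atTop (by linarith)).comp
          (tendsto_atTop_add_const_left _ _ tendsto_natCast_atTop_atTop)
      have h2 := ((h1.const_mul M).mul_const (b - a)).const_mul 2
      simpa using h2
    refine squeeze_zero_norm (fun n ↦ ?_) hlim
    rw [hrect, norm_mul, norm_I, one_mul]
    refine (norm_sub_le _ _).trans ?_
    have h1 := hbound n (-n) (by simp)
    have h2 := hbound n n (by simp)
    linarith
  have := tendsto_nhds_unique (htb.sub hta) hzero
  exact (sub_eq_zero.mp this).symm

/-- The mean of `exp (s * w)` over `0 < w < η`. -/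
def avgExp (η : ℝ) (s : ℂ) : ℂ := (η : ℂ)⁻¹ * ∫ w in (0 : ℝ)..η, cexp (s * w)

lemma avgExp_eq (η : ℝ) {s : ℂ} (hs : s ≠ 0) : avgExp η s = (η : ℂ)⁻¹ * ((cexp (s * η) - 1) / s) := by
  rw [avgExp, integral_exp_mul_complex hs]
  simp

lemma norm_avgExp_le {η : ℝ} (hη : 0 < η) {s : ℂ} (hs : 0 ≤ s.re) :
    ‖avgExp η s‖ ≤ Real.exp (s.re * η) := by
  have h := intervalIntegral.norm_integral_le_of_norm_le_const (a := 0) (b := η)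
    (f := fun w : ℝ ↦ cexp (s * w)) (C := Real.exp (s.re * η)) (by
      intro w hw
      rw [uIoc_of_le hη.le] at hw
      rw [Complex.norm_exp, Complex.re_mul_ofReal, Real.exp_le_exp]
      exact mul_le_mul_of_nonneg_left hw.2 hs)
  rw [sub_zero, abs_of_pos hη] at h
  rw [avgExp, norm_mul, norm_inv, Complex.norm_real, Real.norm_of_nonneg hη.le,
    inv_mul_le_iff₀ hη]
  linarith

/-- The purpose of averaging: a gain of 1/|s|, which makes a transform that decays like some
|t|^(-p), p > 0, integrable on vertical lines. -/
lemma norm_avgExp_le_div {η : ℝ} (hη : 0 < η) {s : ℂ} (hs : 0 < s.re) :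
    ‖avgExp η s‖ ≤ 2 * Real.exp (s.re * η) / η / ‖s‖ := by
  have hs0 : s ≠ 0 := fun h ↦ by rw [h] at hs; simp at hs
  rw [avgExp_eq η hs0, norm_mul, norm_inv, norm_div, Complex.norm_real, Real.norm_of_nonneg hη.le]
  have h1 : ‖cexp (s * η) - 1‖ ≤ 2 * Real.exp (s.re * η) := by
    refine (norm_sub_le _ _).trans ?_
    rw [Complex.norm_exp, Complex.re_mul_ofReal, norm_one]
    have := Real.one_le_exp (show 0 ≤ s.re * η by positivity)
    linarith
  calc η⁻¹ * (‖cexp (s * η) - 1‖ / ‖s‖) ≤ η⁻¹ * (2 * Real.exp (s.re * η) / ‖s‖) := by gcongr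
    _ = _ := by ring

lemma differentiableOn_avgExp (η : ℝ) : DifferentiableOn ℂ (avgExp η) {s | 0 < s.re} := by
  have h : DifferentiableOn ℂ (fun s : ℂ ↦ (η : ℂ)⁻¹ * ((cexp (s * η) - 1) / s)) {s | 0 < s.re} := by
    refine DifferentiableOn.const_mul (DifferentiableOn.div (by fun_prop) (by fun_prop) ?_) _
    intro s hs h
    rw [h] at hs
    simp at hs
  exact h.congr fun s hs ↦ avgExp_eq η fun h ↦ by rw [h] at hs; simp at hs

lemma one_add_abs_im_le {σ : ℝ} (hσ : 0 < σ) {s : ℂ} (hs : σ ≤ s.re) :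
    1 + |s.im| ≤ (σ⁻¹ + 1) * ‖s‖ := by
  have h1 := Complex.abs_im_le_norm s
  have h2 : σ ≤ ‖s‖ := hs.trans ((le_abs_self _).trans (Complex.abs_re_le_norm s))
  have h3 : 1 ≤ σ⁻¹ * ‖s‖ := by
    rw [← div_eq_inv_mul, le_div_iff₀ hσ]; linarith
  linarith

lemma norm_mul_avgExp_le {F : ℂ → ℂ} {σ M p η : ℝ} (hσ : 0 < σ) (hη : 0 < η) {s : ℂ}
    (hs : σ ≤ s.re) (hs2 : s.re ≤ 2) (hF : ‖F s‖ ≤ M * (1 + |s.im|) ^ (-p)) :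
    ‖F s * avgExp η s‖ ≤
      M * (2 * Real.exp (2 * η) / η * (σ⁻¹ + 1)) * (1 + |s.im|) ^ (-(p + 1)) := by
  have hpos : 0 < 1 + |s.im| := by positivity
  have hsn : 0 < ‖s‖ := (hσ.trans_le hs).trans_le ((le_abs_self _).trans (Complex.abs_re_le_norm s))
  have h1 := norm_avgExp_le_div hη (hσ.trans_le hs)
  have h2 : 2 * Real.exp (s.re * η) / η / ‖s‖ ≤
      2 * Real.exp (2 * η) / η * (σ⁻¹ + 1) * (1 + |s.im|)⁻¹ := by
    have h3 : ‖s‖⁻¹ ≤ (σ⁻¹ + 1) * (1 + |s.im|)⁻¹ := by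
      rw [← div_eq_mul_inv, le_div_iff₀ hpos, ← div_eq_inv_mul, div_le_iff₀ hsn]
      exact one_add_abs_im_le hσ hs
    rw [div_eq_mul_inv _ ‖s‖, mul_assoc _ (σ⁻¹ + 1)]
    gcongr
  have hr : (1 + |s.im|) ^ (-(p + 1)) = (1 + |s.im|) ^ (-p) * (1 + |s.im|)⁻¹ := by
    rw [neg_add, Real.rpow_add hpos, Real.rpow_neg_one]
  rw [norm_mul, hr]
  calc ‖F s‖ * ‖avgExp η s‖ ≤ (M * (1 + |s.im|) ^ (-p)) *
        (2 * Real.exp (2 * η) / η * (σ⁻¹ + 1) * (1 + |s.im|)⁻¹) := by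
        gcongr
        · exact (norm_nonneg _).trans hF
        · exact h1.trans h2
    _ = _ := by ring

lemma real_inner_eq_mul (a b : ℝ) : inner ℝ a b = a * b := by simp [mul_comm]

lemma integrable_exp_mul_of_re {h : ℝ → ℂ} (hm : Measurable h)
    (hint : Integrable fun v : ℝ ↦ h v * cexp (-2 * v)) (t : ℝ) :
    Integrable fun v : ℝ ↦ h v * cexp (-(2 + t * I) * v) := by
  refine hint.norm.mono' (by fun_prop) (Eventually.of_forall fun v ↦ le_of_eq ?_)
  rw [norm_mul, norm_mul, Complex.norm_exp, Complex.norm_exp]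
  congr 2
  simp

/-- Fubini is available because translating by w only multiplies the integral by the modulus of
exp((2 + it)w), which is bounded for 0 < w ≤ η. -/
lemma integrable_prod_translate {h : ℝ → ℂ} (hm : Measurable h)
    (hint : Integrable fun v : ℝ ↦ h v * cexp (-2 * v)) (t η : ℝ) :
    Integrable (fun q : ℝ × ℝ ↦ h (q.1 + q.2) * cexp (-(2 + t * I) * q.1))
      (volume.prod (volume.restrict (Ioc 0 η))) := by
  have hI := integrable_exp_mul_of_re hm hint t
  have heq : ∀ w u : ℝ, h (u + w) * cexp (-(2 + t * I) * u) =
      cexp ((2 + t * I) * w) * (h (u + w) * cexp (-(2 + t * I) * (u + w : ℝ))) := by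
    intro w u
    rw [mul_left_comm, ← Complex.exp_add]
    congr 2
    push_cast; ring
  rw [integrable_prod_iff' (by fun_prop)]
  constructor
  · refine Eventually.of_forall fun w ↦ ?_
    simp only [heq w]
    exact (hI.comp_add_right w).const_mul _
  · simp only [heq, norm_mul (cexp _)]
    have : ∀ w : ℝ, ∫ u : ℝ, ‖cexp ((2 + t * I) * w)‖ *
        ‖h (u + w) * cexp (-(2 + t * I) * (u + w : ℝ))‖ =
        ‖cexp ((2 + t * I) * w)‖ * ∫ u : ℝ, ‖h u * cexp (-(2 + t * I) * u)‖ := by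
      intro w
      rw [integral_const_mul]
      congr 1
      exact integral_add_right_eq_self (fun u : ℝ ↦ ‖h u * cexp (-(2 + t * I) * u)‖) w
    simp only [this]
    refine Continuous.integrableOn_Ioc ?_
    fun_prop

/-- The Laplace transform of a moving average. -/
lemma integral_average_mul_exp {h : ℝ → ℂ} (hm : Measurable h)
    (hint : Integrable fun v : ℝ ↦ h v * cexp (-2 * v)) (t : ℝ) {η : ℝ} (hη : 0 < η) :
    ∫ u : ℝ, ((η : ℂ)⁻¹ * ∫ w in (0 : ℝ)..η, h (u + w)) * cexp (-(2 + t * I) * u) =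
      (∫ v : ℝ, h v * cexp (-(2 + t * I) * v)) * avgExp η (2 + t * I) := by
  have hP := integrable_prod_translate hm hint t η
  have h1 : ∀ u : ℝ, ((η : ℂ)⁻¹ * ∫ w in (0 : ℝ)..η, h (u + w)) * cexp (-(2 + t * I) * u) =
      (η : ℂ)⁻¹ * ∫ w in Ioc 0 η, h (u + w) * cexp (-(2 + t * I) * u) := by
    intro u
    rw [intervalIntegral.integral_of_le hη.le, integral_mul_const, mul_assoc]
  simp only [h1]
  rw [integral_const_mul, integral_integral_swap hP, avgExp, intervalIntegral.integral_of_le hη.le,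
    mul_left_comm]
  congr 1
  rw [← integral_const_mul]
  refine integral_congr_ae (Eventually.of_forall fun w ↦ ?_)
  have heq : ∀ u : ℝ, h (u + w) * cexp (-(2 + t * I) * u) =
      h (u + w) * cexp (-(2 + t * I) * (u + w : ℝ)) * cexp ((2 + t * I) * w) := by
    intro u
    rw [mul_assoc, ← Complex.exp_add]
    congr 2
    push_cast; ring
  simp only [heq]
  rw [integral_mul_const, integral_add_right_eq_self (fun u : ℝ ↦ h u * cexp (-(2 + t * I) * u)) w]

lemma locallyIntegrable_of_integrable_mul_exp {h : ℝ → ℂ}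
    (hint : Integrable fun v : ℝ ↦ h v * cexp (-2 * v)) : LocallyIntegrable h := by
  rw [locallyIntegrable_iff]
  intro K hK
  have h1 : IntegrableOn (fun v : ℝ ↦ h v * cexp (-2 * v) * cexp (2 * v)) K :=
    hint.integrableOn.mul_continuousOn (by fun_prop) hK
  refine h1.congr (Eventually.of_forall fun v ↦ ?_)
  simp only
  rw [mul_assoc, ← Complex.exp_add]
  simp

lemma average_eq_sub_primitive {h : ℝ → ℂ} (hloc : LocallyIntegrable h) (η u : ℝ) :
    ∫ w in (0 : ℝ)..η, h (u + w) =
      (∫ t in (0 : ℝ)..(u + η), h t) - ∫ t in (0 : ℝ)..u, h t := by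
  have hg : ∀ x y : ℝ, IntervalIntegrable h volume x y := fun x y ↦
    intervalIntegrable_iff.mpr
      ((hloc.integrableOn_isCompact isCompact_uIcc).mono_set uIoc_subset_uIcc)
  rw [intervalIntegral.integral_comp_add_left, add_zero,
    intervalIntegral.integral_interval_sub_left (hg _ _) (hg _ _)]

lemma continuous_average {h : ℝ → ℂ} (hloc : LocallyIntegrable h) (η : ℝ) :
    Continuous fun u : ℝ ↦ (η : ℂ)⁻¹ * ∫ w in (0 : ℝ)..η, h (u + w) := by
  have hg : ∀ x y : ℝ, IntervalIntegrable h volume x y := fun x y ↦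
    intervalIntegrable_iff.mpr
      ((hloc.integrableOn_isCompact isCompact_uIcc).mono_set uIoc_subset_uIcc)
  have hc : Continuous fun x : ℝ ↦ ∫ t in (0 : ℝ)..x, h t :=
    intervalIntegral.continuous_primitive hg 0
  simp only [average_eq_sub_primitive hloc]
  exact continuous_const.mul ((hc.comp (by fun_prop)).sub hc)

/-- Mean square bound for a moving average, from its Laplace transform continued to the left. -/
lemma lintegral_average_sq_le {h : ℝ → ℂ} (hm : Measurable h)
    (hint : Integrable fun v : ℝ ↦ h v * cexp (-2 * v)) {F : ℂ → ℂ} {σ M p : ℝ} (hσ : 0 < σ)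
    (hσ2 : σ ≤ 2) (hp : 0 < p) (hF : DifferentiableOn ℂ F {s | σ ≤ s.re ∧ s.re ≤ 2})
    (hFb : ∀ s : ℂ, σ ≤ s.re → s.re ≤ 2 → ‖F s‖ ≤ M * (1 + |s.im|) ^ (-p))
    (hlap : ∀ t : ℝ, ∫ v : ℝ, h v * cexp (-(2 + t * I) * v) = F (2 + t * I)) {η : ℝ}
    (hη : 0 < η) :
    ∫⁻ u : ℝ, ‖((η : ℂ)⁻¹ * ∫ w in (0 : ℝ)..η, h (u + w)) * cexp (-σ * u)‖ₑ ^ 2 ≤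
      ENNReal.ofReal (Real.exp (2 * σ * η)) * ∫⁻ t : ℝ, ‖F (σ + t * I)‖ₑ ^ 2 := by
  set K : ℝ → ℂ := fun u ↦ (η : ℂ)⁻¹ * ∫ w in (0 : ℝ)..η, h (u + w) with hK
  have hKc : Continuous K :=
    continuous_average (locallyIntegrable_of_integrable_mul_exp hint) η
  set M' := M * (2 * Real.exp (2 * η) / η * (σ⁻¹ + 1)) with hM'
  -- F itself need not be integrable on vertical lines. With the extra decay of G, Fourier inversion
  -- and the shift of the line converge absolutely.
  set G : ℂ → ℂ := fun s ↦ F s * avgExp η s with hG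
  have hGb : ∀ s : ℂ, σ ≤ s.re → s.re ≤ 2 → ‖G s‖ ≤ M' * (1 + |s.im|) ^ (-(p + 1)) :=
    fun s h1 h2 ↦ norm_mul_avgExp_le hσ hη h1 h2 (hFb s h1 h2)
  have hGd : DifferentiableOn ℂ G {s | σ ≤ s.re ∧ s.re ≤ 2} :=
    hF.mul ((differentiableOn_avgExp η).mono fun s hs ↦ hσ.trans_le hs.1)
  have hp1 : 1 < p + 1 := by linarith
  have h2π : (2 * Real.pi) ≠ 0 := by positivity
  have hGint : ∀ a : ℝ, σ ≤ a → a ≤ 2 → Integrable fun ξ : ℝ ↦ G (a + (2 * Real.pi * ξ : ℝ) * I) := by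
    intro a ha1 ha2
    have := integrable_vertical (G := G) (a := a) hp1
      (hGd.continuousOn.mono fun s hs ↦ ⟨ha1.trans (le_of_eq hs.symm), (le_of_eq hs).trans ha2⟩)
      fun s hs ↦ hGb s (ha1.trans hs.ge) (hs.le.trans ha2)
    exact this.comp_mul_left' h2π
  -- the moving average, normalised on the line `Re s = 2`
  set k : ℝ → ℂ := fun u ↦ K u * cexp (-2 * u) with hk
  have hkc : Continuous k := hKc.mul (by fun_prop)
  have hkint : Integrable k := by
    have h1 := ((integrable_prod_translate hm hint 0 η).integral_prod_left).const_mul (η : ℂ)⁻¹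
    refine h1.congr (Eventually.of_forall fun u ↦ ?_)
    simp only [hk, hK]
    rw [intervalIntegral.integral_of_le hη.le, integral_mul_const, mul_assoc]
    simp
  have hkF : ∀ ξ : ℝ, 𝓕 k ξ = G (2 + (2 * Real.pi * ξ : ℝ) * I) := by
    intro ξ
    rw [Real.fourier_real_eq_integral_exp_smul, hG]
    simp only
    rw [← hlap, ← integral_average_mul_exp hm hint _ hη]
    refine integral_congr_ae (Eventually.of_forall fun u ↦ ?_)
    simp only [hk, smul_eq_mul]
    rw [mul_left_comm, ← Complex.exp_add]
    congr 2
    push_cast; ring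
  have hkFint : Integrable (𝓕 k) := by
    refine (hGint 2 hσ2 le_rfl).congr (Eventually.of_forall fun ξ ↦ ?_)
    simp [hkF]
  have hinv : ∀ u, K u = cexp (2 * u) *
      ∫ ξ : ℝ, cexp ((2 * Real.pi * (ξ * u) : ℝ) * I) * G (2 + (2 * Real.pi * ξ : ℝ) * I) := by
    intro u
    have h1 := congrFun (hkc.fourierInv_fourier_eq hkint hkFint) u
    rw [Real.fourierInv_eq'] at h1
    simp only [hkF, smul_eq_mul, real_inner_eq_mul] at h1
    simp only [hk] at h1
    rw [h1, mul_comm (cexp _), mul_assoc, ← Complex.exp_add]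
    simp
  -- move the line of integration
  have hshift : ∀ u, K u = cexp (σ * u) *
      ∫ ξ : ℝ, cexp ((2 * Real.pi * (ξ * u) : ℝ) * I) * G (σ + (2 * Real.pi * ξ : ℝ) * I) := by
    intro u
    have hline : ∀ a : ℝ, cexp (a * u) *
        ∫ ξ : ℝ, cexp ((2 * Real.pi * (ξ * u) : ℝ) * I) * G (a + (2 * Real.pi * ξ : ℝ) * I) =
        |(2 * Real.pi)⁻¹| • ∫ y : ℝ, G (a + y * I) * cexp ((a + y * I) * u) := by
      intro a
      rw [← Measure.integral_comp_mul_left (fun y : ℝ ↦ G (a + y * I) * cexp ((a + y * I) * u)),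
        ← integral_const_mul]
      refine integral_congr_ae (Eventually.of_forall fun ξ ↦ ?_)
      simp only
      rw [← mul_assoc, ← Complex.exp_add, mul_comm]
      congr 2
      push_cast; ring
    have h1 := integral_vertical_eq (G := fun s ↦ G s * cexp (s * u)) (a := σ) (b := 2)
      (M := M' * Real.exp (2 * |u|)) hσ2 hp1
      (hGd.mul (by fun_prop)) (by
        intro s hs1 hs2
        rw [norm_mul, Complex.norm_exp, Complex.re_mul_ofReal]
        have h3 : Real.exp (s.re * u) ≤ Real.exp (2 * |u|) := by
          rw [Real.exp_le_exp]
          calc s.re * u ≤ s.re * |u| := 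
              mul_le_mul_of_nonneg_left (le_abs_self u) (by linarith)
            _ ≤ 2 * |u| := by gcongr
        calc ‖G s‖ * Real.exp (s.re * u) ≤ (M' * (1 + |s.im|) ^ (-(p + 1))) * Real.exp (2 * |u|) :=
              mul_le_mul (hGb s hs1 hs2) h3 (Real.exp_nonneg _)
                ((norm_nonneg _).trans (hGb s hs1 hs2))
          _ = _ := by ring)
    have h2 := hline 2
    push_cast at h2 h1
    rw [hinv u, hline σ, h1, ← h2]
    push_cast
    rfl
  -- Plancherel on the line `Re s = σ`
  set g : ℝ → ℂ := fun ξ ↦ G (σ + (2 * Real.pi * ξ : ℝ) * I) with hg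
  have hgint : Integrable g := hGint σ le_rfl hσ2
  have hM'0 : 0 ≤ M' := by
    have := (norm_nonneg _).trans (hGb σ (by simp) (by simpa using hσ2))
    simpa using this
  have hgb : ∀ ξ, ‖g ξ‖ ≤ M' := by
    intro ξ
    refine (hGb _ (by simp) (by simpa using hσ2)).trans ?_
    refine mul_le_of_le_one_right hM'0 (Real.rpow_le_one_of_one_le_of_nonpos ?_ (by linarith))
    linarith [abs_nonneg (σ + (2 * Real.pi * ξ : ℝ) * I : ℂ).im]
  have hg2 : MemLp g 2 := by
    rw [memLp_two_iff_integrable_sq_norm hgint.aestronglyMeasurable]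
    refine (hgint.norm.const_mul M').mono' (hgint.aestronglyMeasurable.norm.pow 2)
      (Eventually.of_forall fun ξ ↦ ?_)
    rw [Real.norm_of_nonneg (by positivity), sq]
    gcongr
    exact hgb ξ
  have hKg : ∀ u, K u * cexp (-σ * u) = 𝓕⁻ g u := by
    intro u
    rw [hshift u, Real.fourierInv_eq', mul_right_comm, ← Complex.exp_add]
    simp only [smul_eq_mul, real_inner_eq_mul, hg]
    simp
  calc ∫⁻ u : ℝ, ‖K u * cexp (-σ * u)‖ₑ ^ 2 = ∫⁻ ξ, ‖g ξ‖ₑ ^ 2 := by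
        simp only [hKg]
        exact lintegral_fourierInv_sq hgint hg2
    _ ≤ ∫⁻ ξ : ℝ, ENNReal.ofReal (Real.exp (2 * σ * η)) *
          ‖F (σ + (2 * Real.pi * ξ : ℝ) * I)‖ₑ ^ 2 := by
        refine lintegral_mono fun ξ ↦ ?_
        rw [hg, hG]
        simp only
        rw [enorm_mul, mul_pow, mul_comm]
        gcongr
        rw [← ofReal_norm, ← ENNReal.ofReal_pow (norm_nonneg _)]
        refine ENNReal.ofReal_le_ofReal ?_
        have h1 := norm_avgExp_le hη (s := σ + (2 * Real.pi * ξ : ℝ) * I) (by simpa using hσ.le)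
        have h2 : (σ + (2 * Real.pi * ξ : ℝ) * I : ℂ).re = σ := by simp
        rw [h2] at h1
        calc _ ≤ Real.exp (σ * η) ^ 2 := by gcongr
          _ = _ := by rw [← Real.exp_nat_mul]; push_cast; ring_nf
    _ = ENNReal.ofReal (Real.exp (2 * σ * η)) *
          ∫⁻ ξ : ℝ, ‖F (σ + (2 * Real.pi * ξ : ℝ) * I)‖ₑ ^ 2 :=
        lintegral_const_mul' _ _ ENNReal.ofReal_ne_top
    -- The substitution t = 2πξ gains a factor 1/(2π), which is discarded.
    _ ≤ _ := by
        refine mul_le_mul' le_rfl ?_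
        exact lintegral_comp_mul_left_le (fun t : ℝ ↦ ‖F (σ + t * I)‖ₑ ^ 2)
          (a := 2 * Real.pi) (by linarith [Real.pi_gt_three])

/-- Mean square bound for a function, from its Laplace transform continued to the left. -/
theorem lintegral_sq_le_of_laplace {h : ℝ → ℂ} (hm : Measurable h)
    (hint : Integrable fun v : ℝ ↦ h v * cexp (-2 * v)) {F : ℂ → ℂ} {σ M p : ℝ} (hσ : 0 < σ)
    (hσ2 : σ ≤ 2) (hp : 0 < p) (hF : DifferentiableOn ℂ F {s | σ ≤ s.re ∧ s.re ≤ 2})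
    (hFb : ∀ s : ℂ, σ ≤ s.re → s.re ≤ 2 → ‖F s‖ ≤ M * (1 + |s.im|) ^ (-p))
    (hlap : ∀ t : ℝ, ∫ v : ℝ, h v * cexp (-(2 + t * I) * v) = F (2 + t * I)) :
    ∫⁻ u : ℝ, ‖h u * cexp (-σ * u)‖ₑ ^ 2 ≤ ∫⁻ t : ℝ, ‖F (σ + t * I)‖ₑ ^ 2 := by
  have hloc := locallyIntegrable_of_integrable_mul_exp hint
  set B := ∫⁻ t : ℝ, ‖F (σ + t * I)‖ₑ ^ 2 with hB
  set η : ℕ → ℝ := fun n ↦ 1 / ((n : ℝ) + 1) with hη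
  have hη0 : ∀ n, 0 < η n := fun n ↦ by simp only [hη]; positivity
  have hηt : Tendsto η atTop (𝓝 0) := tendsto_one_div_add_atTop_nhds_zero_nat
  have hηt' : Tendsto η atTop (𝓝[>] 0) :=
    tendsto_nhdsWithin_iff.mpr ⟨hηt, Eventually.of_forall hη0⟩
  set f : ℕ → ℝ → ℝ≥0∞ := fun n u ↦
    ‖((η n : ℂ)⁻¹ * ∫ w in (0 : ℝ)..(η n), h (u + w)) * cexp (-σ * u)‖ₑ ^ 2 with hf
  have hfm : ∀ n, Measurable (f n) := by
    intro n
    have h1 : Continuous fun u : ℝ ↦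
        ((η n : ℂ)⁻¹ * ∫ w in (0 : ℝ)..(η n), h (u + w)) * cexp (-σ * u) :=
      (continuous_average hloc (η n)).mul (by fun_prop)
    exact (h1.measurable.enorm).pow_const 2
  -- By Lebesgue differentiation the averages tend to h almost everywhere; Fatou's lemma then
  -- removes the averaging.
  have hae : ∀ᵐ u : ℝ, liminf (fun n ↦ f n u) atTop = ‖h u * cexp (-σ * u)‖ₑ ^ 2 := by
    filter_upwards [_root_.LocallyIntegrable.ae_hasDerivAt_integral hloc] with u hu
    refine Tendsto.liminf_eq ?_
    have h1 := (hu 0).tendsto_slope_zero_right.comp hηt'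
    have h2 : Tendsto (fun n ↦ ((η n : ℂ)⁻¹ * ∫ w in (0 : ℝ)..(η n), h (u + w)) * cexp (-σ * u))
        atTop (𝓝 (h u * cexp (-σ * u))) := by
      refine Tendsto.mul_const _ (h1.congr fun n ↦ ?_)
      simp only [Function.comp_apply]
      rw [average_eq_sub_primitive hloc, ← Complex.ofReal_inv, Complex.real_smul]
    exact ((ENNReal.continuous_pow 2).tendsto _).comp ((continuous_enorm.tendsto _).comp h2)
  calc ∫⁻ u : ℝ, ‖h u * cexp (-σ * u)‖ₑ ^ 2 = ∫⁻ u : ℝ, liminf (fun n ↦ f n u) atTop :=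
        lintegral_congr_ae (hae.mono fun u hu ↦ hu.symm)
    _ ≤ liminf (fun n ↦ ∫⁻ u, f n u) atTop := lintegral_liminf_le hfm
    _ ≤ liminf (fun n ↦ ENNReal.ofReal (Real.exp (2 * σ * η n)) * B) atTop := by
        refine liminf_le_liminf (Eventually.of_forall fun n ↦ ?_)
        exact lintegral_average_sq_le hm hint hσ hσ2 hp hF hFb hlap (hη0 n)
    _ = B := by
        refine Tendsto.liminf_eq ?_
        have h1 : Tendsto (fun n ↦ Real.exp (2 * σ * η n)) atTop (𝓝 1) := by
          have := (Real.continuous_exp.tendsto _).comp (hηt.const_mul (2 * σ))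
          simpa [Function.comp_def] using this
        have h2 := ENNReal.Tendsto.mul_const (b := B) (ENNReal.tendsto_ofReal h1)
          (Or.inl (by simp))
        simpa using h2

/-! ### The bound for J_{-1} implies the mean square bound -/

/-- The functional equation leads to Re s ≥ 5/8, where ζ is O(|t|^ε) under RH. Small heights are
covered by compactness. -/
lemma RiemannHypothesis.norm_riemannZeta_le_of_re_le (hRH : RiemannHypothesis) {a ε : ℝ}
    (ha : 0 ≤ a) (ha2 : a ≤ 3 / 8) (hε : 0 < ε) :
    ∃ C : ℝ, 0 < C ∧ ∀ s : ℂ, a ≤ s.re → s.re ≤ 3 / 8 →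
      ‖riemannZeta s‖ ≤ C * (1 + |s.im|) ^ (1 / 2 - a + ε) := by
  obtain ⟨C₁, hC₁, h₁⟩ := hRH.norm_riemannZeta_le_rpow (show (0 : ℝ) < 1 / 8 by norm_num) hε
  obtain ⟨C₂, hC₂, h₂⟩ := exists_norm_riemannZeta_one_sub_bounds
  have hKc : IsCompact (Icc a (3 / 8) ×ℂ Icc (-3) 3) := isCompact_Icc.reProdIm isCompact_Icc
  have hcont : ContinuousOn riemannZeta (Icc a (3 / 8) ×ℂ Icc (-3) 3) := by
    intro s hs
    refine (differentiableAt_riemannZeta ?_).continuousAt.continuousWithinAt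
    rintro rfl
    rw [Complex.mem_reProdIm] at hs
    have := hs.1.2
    norm_num at this
  obtain ⟨M, hM⟩ := hKc.exists_bound_of_continuousOn hcont
  refine ⟨C₂ * C₁ + |M|, by positivity, fun s hs1 hs2 ↦ ?_⟩
  have hbase : 1 ≤ 1 + |s.im| := by linarith [abs_nonneg s.im]
  rcases le_or_gt 3 |s.im| with h3 | h3
  · have hpos : 0 < |s.im| := by linarith
    have h4 := (h₁ (1 - s) (by simp; linarith) (by simpa using h3)).1
    have h5 := (h₂ s (by linarith) (by linarith) (by linarith)).1
    have h6 : |(1 - s).im| = |s.im| := by simp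
    rw [h6] at h4
    calc ‖riemannZeta s‖ ≤ C₂ * |s.im| ^ (1 / 2 - s.re) * (C₁ * |s.im| ^ ε) := h5.trans (by gcongr)
      _ = C₂ * C₁ * |s.im| ^ (1 / 2 - s.re + ε) := by rw [Real.rpow_add hpos]; ring
      _ ≤ C₂ * C₁ * (1 + |s.im|) ^ (1 / 2 - a + ε) := by
          gcongr C₂ * C₁ * ?_
          calc |s.im| ^ (1 / 2 - s.re + ε) ≤ (1 + |s.im|) ^ (1 / 2 - s.re + ε) :=
                Real.rpow_le_rpow hpos.le (by linarith) (by linarith)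
            _ ≤ _ := Real.rpow_le_rpow_of_exponent_le hbase (by linarith)
      _ ≤ _ := by gcongr; linarith [abs_nonneg M]
  · have h4 : ‖riemannZeta s‖ ≤ M := hM s (by
      rw [Complex.mem_reProdIm]
      rw [abs_lt] at h3
      exact ⟨⟨hs1, hs2⟩, h3.1.le, h3.2.le⟩)
    have h5 : 1 ≤ (1 + |s.im|) ^ (1 / 2 - a + ε) := Real.one_le_rpow hbase (by linarith)
    calc ‖riemannZeta s‖ ≤ |M| * 1 := by rw [mul_one]; exact h4.trans (le_abs_self M)
      _ ≤ _ := by gcongr; linarith [mul_pos hC₂ hC₁]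

/-- The continuation of the Mellin transform of `M_k`. -/
def errTransform (k : ℕ) (s : ℂ) : ℂ :=
  riemannZeta s / (s * riemannZeta (k * s)) - 1 / (riemannZeta k * (s - 1))

lemma one_half_add_div_le {k : ℕ} (hk : 2 ≤ k) {δ : ℝ} (hδ : δ ≤ 1 / 4) :
    (1 / 2 + δ) / k ≤ 3 / 8 := by
  have hk2 : (2 : ℝ) ≤ k := by exact_mod_cast hk
  rw [div_le_iff₀ (by linarith)]
  linarith

/-- The mean square of the continued Mellin transform of `M_k` near its critical line. -/
lemma RiemannHypothesis.lintegral_errTransform_le (hRH : RiemannHypothesis)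
    (hJ : ∀ ε : ℝ, 0 < ε → ∃ C : ℝ, ∀ T : ℝ, 1 ≤ T → Jneg1 T ≤ ENNReal.ofReal (C * T ^ (1 + ε)))
    {k : ℕ} (hk : 2 ≤ k) :
    ∃ C : ℝ, 0 < C ∧ ∀ δ : ℝ, 0 < δ → δ ≤ 1 / 4 →
      ∫⁻ t : ℝ, ‖errTransform k (((1 / 2 + δ) / k : ℝ) + t * I)‖ₑ ^ 2 ≤ ENNReal.ofReal (C / δ) := by
  have hk2 : (2 : ℝ) ≤ k := by exact_mod_cast hk
  have hk0 : (0 : ℝ) < k := by linarith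
  set κ : ℝ := 1 / (2 * k) with hκ
  have hκ0 : 0 < κ := by positivity
  have hκ1 : κ ≤ 3 / 8 := by rw [hκ, div_le_iff₀ (by linarith)]; linarith
  have hκk : (1 / 2 : ℝ) / k = κ := by rw [hκ]; field_simp
  -- With the loss κ/2 one gets |ζ(s)/s|² = O((1 + |t|)^(-(1+κ))) for κ ≤ Re s ≤ 3/8. The exponent
  -- exceeds 1, as the weighted mean square of 1/ζ requires.
  obtain ⟨C₁, hC₁, h₁⟩ := hRH.norm_riemannZeta_le_of_re_le hκ0.le hκ1 (half_pos hκ0)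
  obtain ⟨C₂, hC₂, h₂⟩ := hRH.lintegral_inv_riemannZeta_le hJ (show 1 < 1 + κ by linarith)
  have hζk : riemannZeta k ≠ 0 := riemannZeta_ne_zero_of_one_le_re (by simp; linarith)
  set c := ‖(riemannZeta k)⁻¹‖ with hc
  set D := 2 * (C₁ * (κ⁻¹ + 1)) ^ 2 * (k : ℝ) ^ (1 + κ) with hD
  set D' := 2 * c ^ 2 with hD'
  have hD0 : 0 ≤ D := by positivity
  have hD'0 : 0 ≤ D' := by positivity
  have hint : Integrable fun t : ℝ ↦ D' * ((5 / 8) ^ 2 + t ^ 2)⁻¹ := by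
    refine Integrable.const_mul ?_ _
    have h3 := (integrable_inv_one_add_sq.comp_div (show (5 / 8 : ℝ) ≠ 0 by norm_num)).const_mul
      ((5 / 8 : ℝ) ^ 2)⁻¹
    refine h3.congr (Eventually.of_forall fun t ↦ ?_)
    simp only
    rw [← mul_inv]
    congr 1
    field_simp
  set J := ∫ t : ℝ, D' * ((5 / 8) ^ 2 + t ^ 2)⁻¹ with hJdef
  have hJ0 : 0 ≤ J := integral_nonneg fun t ↦ by positivity
  refine ⟨D * C₂ + J + 1, by positivity, fun δ hδ hδ4 ↦ ?_⟩
  set σ : ℝ := (1 / 2 + δ) / k with hσ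
  have hσ1 : κ ≤ σ := by rw [hσ, ← hκk]; gcongr; linarith
  have hσ2 : σ ≤ 3 / 8 := one_half_add_div_le hk hδ4
  have hpt : ∀ t : ℝ, ‖errTransform k (σ + t * I)‖ ^ 2 ≤
      D * ((1 + |k * t|) ^ (-(1 + κ)) * ‖(riemannZeta (1 / 2 + δ + (k * t : ℝ) * I))⁻¹‖ ^ 2) +
        D' * ((5 / 8) ^ 2 + t ^ 2)⁻¹ := by
    intro t
    set s : ℂ := σ + t * I with hs
    have hsre : s.re = σ := by simp [hs]
    have hsim : s.im = t := by simp [hs]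
    have hks : (k : ℂ) * s = 1 / 2 + δ + (k * t : ℝ) * I := by
      have hkc : (k : ℂ) ≠ 0 := by exact_mod_cast hk0.ne'
      rw [hs, hσ]
      push_cast
      field_simp
    have hbase : 0 < 1 + |t| := by positivity
    have hs0 : 0 < ‖s‖ := by
      have := (le_abs_self _).trans (Complex.abs_re_le_norm s)
      rw [hsre] at this
      linarith
    have h3 := h₁ s (hsre ▸ hσ1) (hsre ▸ hσ2)
    have h4 := one_add_abs_im_le hκ0 (hsre ▸ hσ1 : κ ≤ s.re)
    rw [hsim] at h3 h4
    have h5 : ‖riemannZeta s / s‖ ≤ C₁ * (κ⁻¹ + 1) * (1 + |t|) ^ (-(1 + κ) / 2) := by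
      rw [norm_div, div_le_iff₀ hs0]
      have h6 : (1 + |t|) ^ (1 / 2 - κ + κ / 2) = (1 + |t|) ^ (-(1 + κ) / 2) * (1 + |t|) := by
        rw [← Real.rpow_add_one hbase.ne']; congr 1; ring
      rw [h6] at h3
      calc ‖riemannZeta s‖ ≤ C₁ * ((1 + |t|) ^ (-(1 + κ) / 2) * (1 + |t|)) := h3
        _ ≤ C₁ * ((1 + |t|) ^ (-(1 + κ) / 2) * ((κ⁻¹ + 1) * ‖s‖)) := by gcongr
        _ = _ := by ring
    have h7 : ((1 + |t|) ^ (-(1 + κ) / 2)) ^ 2 ≤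
        (k : ℝ) ^ (1 + κ) * (1 + |k * t|) ^ (-(1 + κ)) := by
      rw [← Real.rpow_natCast, ← Real.rpow_mul hbase.le, show -(1 + κ) / 2 * ((2 : ℕ) : ℝ) =
        -(1 + κ) by push_cast; ring, Real.rpow_neg hbase.le, Real.rpow_neg (by positivity),
        ← div_eq_mul_inv, ← Real.div_rpow hk0.le (by positivity), ← Real.inv_rpow hbase.le]
      refine Real.rpow_le_rpow (by positivity) ?_ (by linarith)
      rw [le_div_iff₀ (by positivity), ← div_eq_inv_mul, div_le_iff₀ hbase, abs_mul,
        abs_of_pos hk0]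
      nlinarith [abs_nonneg t]
    have h8 : ‖(s - 1)⁻¹‖ ^ 2 ≤ ((5 / 8) ^ 2 + t ^ 2)⁻¹ := by
      rw [norm_inv, inv_pow]
      gcongr
      rw [← Complex.normSq_eq_norm_sq, Complex.normSq_apply, sub_re, sub_im, one_re, one_im, hsre,
        hsim]
      nlinarith
    have h9 : errTransform k s = riemannZeta s / s * (riemannZeta (k * s))⁻¹ -
        (riemannZeta k)⁻¹ * (s - 1)⁻¹ := by
      rw [errTransform, ← div_div, div_eq_mul_inv _ (riemannZeta (k * s)), one_div, mul_inv]
    rw [h9, hks]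
    set w := (riemannZeta (1 / 2 + δ + (k * t : ℝ) * I))⁻¹ with hw
    calc ‖riemannZeta s / s * w - (riemannZeta k)⁻¹ * (s - 1)⁻¹‖ ^ 2
        ≤ (‖riemannZeta s / s‖ * ‖w‖ + c * ‖(s - 1)⁻¹‖) ^ 2 := by
          gcongr
          refine (norm_sub_le _ _).trans ?_
          rw [norm_mul, norm_mul]
      _ ≤ 2 * (‖riemannZeta s / s‖ ^ 2 * ‖w‖ ^ 2) + 2 * (c ^ 2 * ‖(s - 1)⁻¹‖ ^ 2) := by
          nlinarith [sq_nonneg (‖riemannZeta s / s‖ * ‖w‖ - c * ‖(s - 1)⁻¹‖)]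
      _ ≤ 2 * ((C₁ * (κ⁻¹ + 1)) ^ 2 * ((k : ℝ) ^ (1 + κ) * (1 + |k * t|) ^ (-(1 + κ))) * ‖w‖ ^ 2) +
          2 * (c ^ 2 * ((5 / 8) ^ 2 + t ^ 2)⁻¹) := by
          gcongr
          calc ‖riemannZeta s / s‖ ^ 2 ≤ (C₁ * (κ⁻¹ + 1) * (1 + |t|) ^ (-(1 + κ) / 2)) ^ 2 := by gcongr
            _ = (C₁ * (κ⁻¹ + 1)) ^ 2 * ((1 + |t|) ^ (-(1 + κ) / 2)) ^ 2 := by rw [mul_pow]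
            _ ≤ _ := by gcongr
      _ = _ := by rw [hD, hD']; ring
  set f : ℝ → ℝ≥0∞ := fun u ↦ ENNReal.ofReal ((1 + |u|) ^ (-(1 + κ))) *
    ‖(riemannZeta (1 / 2 + δ + u * I))⁻¹‖ₑ ^ 2 with hf
  have hmeas : Measurable fun t : ℝ ↦ ENNReal.ofReal (D' * ((5 / 8) ^ 2 + t ^ 2)⁻¹) := by fun_prop
  calc ∫⁻ t : ℝ, ‖errTransform k (σ + t * I)‖ₑ ^ 2
      ≤ ∫⁻ t : ℝ, (ENNReal.ofReal D * f (k * t) +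
          ENNReal.ofReal (D' * ((5 / 8) ^ 2 + t ^ 2)⁻¹)) := by
        refine lintegral_mono fun t ↦ ?_
        rw [← ofReal_norm, ← ENNReal.ofReal_pow (norm_nonneg _)]
        refine (ENNReal.ofReal_le_ofReal (hpt t)).trans (le_of_eq ?_)
        rw [ENNReal.ofReal_add (by positivity) (by positivity), ENNReal.ofReal_mul hD0,
          ENNReal.ofReal_mul (p := (1 + |k * t|) ^ (-(1 + κ))) (by positivity),
          ENNReal.ofReal_pow (norm_nonneg _), ofReal_norm]
    _ = ENNReal.ofReal D * (∫⁻ t : ℝ, f (k * t)) + ENNReal.ofReal J := by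
        rw [lintegral_add_right _ hmeas, lintegral_const_mul' _ _ ENNReal.ofReal_ne_top, hJdef,
          ofReal_integral_eq_lintegral_ofReal hint (Eventually.of_forall fun t ↦ by positivity)]
    _ ≤ ENNReal.ofReal D * ENNReal.ofReal (C₂ / δ) + ENNReal.ofReal J := by
        gcongr ENNReal.ofReal D * ?_ + _
        exact (lintegral_comp_mul_left_le f (by linarith)).trans (h₂ δ hδ (by linarith))
    _ = ENNReal.ofReal (D * (C₂ / δ) + J) := by
        rw [← ENNReal.ofReal_mul hD0, ← ENNReal.ofReal_add (by positivity) hJ0]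
    _ ≤ _ := by
        refine ENNReal.ofReal_le_ofReal ?_
        rw [le_div_iff₀ hδ, add_mul, mul_assoc, div_mul_cancel₀ _ hδ.ne']
        nlinarith

/-- An upper bound for zeta across the critical line. -/
lemma RiemannHypothesis.norm_riemannZeta_le_critical (hRH : RiemannHypothesis) :
    ∃ C : ℝ, 0 < C ∧ ∀ s : ℂ, 3 / 8 ≤ s.re → s.re ≤ 5 / 8 → 16 ≤ s.im →
      ‖riemannZeta s‖ ≤ C * s.im ^ (1 / 2 : ℝ) := by
  obtain ⟨C₁, hC₁, h₁⟩ := hRH.norm_riemannZeta_le_rpow (show (0 : ℝ) < 1 / 8 by norm_num)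
    (show (0 : ℝ) < 1 / 8 by norm_num)
  obtain ⟨C₂, hC₂, h₂⟩ := hRH.norm_riemannZeta_le_of_re_le (a := 3 / 8) (ε := 1 / 8) (by norm_num)
    le_rfl (by norm_num)
  set D := 8 + C₁ + C₂ with hD
  refine ⟨D * 4, by positivity, fun s hs1 hs2 hs ↦ ?_⟩
  set τ := s.im with hτ
  have hτ0 : 0 < τ := by linarith
  -- The vertical sides give O(τ^(1/4)) and the horizontal sides have the trivial linear bound, so K
  -- = log(2τ). The interpolation costs (2τ)^(1/64).
  have hmain := norm_le_of_rectangle (g := riemannZeta) (η := 1 / 8) (y₁ := τ - 1) (y₂ := τ + 1)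
    (V := D * (2 * τ) ^ (1 / 4 : ℝ)) (K := Real.log (2 * τ)) (s := s) (by norm_num)
    (Real.log_nonneg (by linarith)) (by linarith) ?_ ?_ ?_
    (by rw [abs_le]; constructor <;> linarith) (by linarith) (by linarith)
  · refine hmain.trans ?_
    have h3 : Real.exp (Real.log (2 * τ) * (1 / 8) ^ 2) ≤ (2 * τ) ^ (1 / 4 : ℝ) := by
      rw [← Real.rpow_def_of_pos (by linarith)]
      exact Real.rpow_le_rpow_of_exponent_le (by linarith) (by norm_num)
    have h4 : (2 * τ) ^ (1 / 4 : ℝ) * (2 * τ) ^ (1 / 4 : ℝ) ≤ 4 * τ ^ (1 / 2 : ℝ) := by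
      rw [← Real.rpow_add (by linarith), show (1 / 4 + 1 / 4 : ℝ) = 1 / 2 by norm_num,
        Real.mul_rpow (by norm_num) hτ0.le]
      gcongr
      calc (2 : ℝ) ^ (1 / 2 : ℝ) ≤ 2 ^ (1 : ℝ) :=
            Real.rpow_le_rpow_of_exponent_le (by norm_num) (by norm_num)
        _ ≤ 4 := by norm_num
    calc D * (2 * τ) ^ (1 / 4 : ℝ) * Real.exp (Real.log (2 * τ) * (1 / 8) ^ 2)
        ≤ D * (2 * τ) ^ (1 / 4 : ℝ) * (2 * τ) ^ (1 / 4 : ℝ) := by gcongr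
      _ = D * ((2 * τ) ^ (1 / 4 : ℝ) * (2 * τ) ^ (1 / 4 : ℝ)) := by ring
      _ ≤ D * (4 * τ ^ (1 / 2 : ℝ)) := by gcongr
      _ = _ := by ring
  · intro z hz
    refine (differentiableAt_riemannZeta ?_).differentiableWithinAt
    rintro rfl
    have := hz.1
    simp at this
    linarith
  · intro z hz hz1 hz2
    have hzim : |z.im| = z.im := abs_of_nonneg (by linarith)
    rcases (abs_eq (by norm_num)).mp hz with h | h
    · refine ((h₁ z (by linarith) (by rw [hzim]; linarith)).1).trans ?_
      rw [hzim]
      calc C₁ * z.im ^ (1 / 8 : ℝ) ≤ C₁ * (2 * τ) ^ (1 / 8 : ℝ) := by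
            gcongr <;> linarith
        _ ≤ D * (2 * τ) ^ (1 / 4 : ℝ) := by
            gcongr
            · linarith
            · linarith
            · norm_num
    · refine (h₂ z (by linarith) (by linarith)).trans ?_
      rw [hzim, show (1 / 2 - 3 / 8 + 1 / 8 : ℝ) = 1 / 4 by norm_num]
      exact mul_le_mul (by linarith) (Real.rpow_le_rpow (by linarith) (by linarith) (by norm_num))
        (Real.rpow_nonneg (by linarith) _) (by linarith)
  · intro z hz hzim
    rw [abs_le] at hz
    rw [Real.exp_log (by linarith)]
    have h1 : τ - 1 ≤ z.im ∧ z.im ≤ τ + 1 := by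
      rcases hzim with h | h <;> rw [h] <;> constructor <;> linarith
    have h5 := norm_riemannZeta_le (s := z) (by linarith) (by rw [abs_of_nonneg] <;> linarith)
    have h6 : ‖z‖ ≤ 2 * τ - 2 := by
      refine (Complex.norm_le_abs_re_add_abs_im z).trans ?_
      rw [abs_of_nonneg (by linarith), abs_of_nonneg (by linarith)]
      linarith
    have h7 : ‖z‖ / z.re ≤ (2 * τ - 2) / (3 / 8) := by gcongr <;> linarith
    have h8 : 1 ≤ (2 * τ) ^ (1 / 4 : ℝ) := Real.one_le_rpow (by linarith) (by norm_num)
    calc ‖riemannZeta z‖ ≤ 8 * 1 * (2 * τ) := by linarith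
      _ ≤ D * (2 * τ) ^ (1 / 4 : ℝ) * (2 * τ) := by gcongr; linarith

lemma RiemannHypothesis.norm_riemannZeta_le_strip (hRH : RiemannHypothesis) :
    ∃ C : ℝ, 0 < C ∧ ∀ s : ℂ, 0 ≤ s.re → 16 ≤ |s.im| →
      ‖riemannZeta s‖ ≤ C * (1 + |s.im|) ^ (3 / 4 : ℝ) := by
  obtain ⟨C₁, hC₁, h₁⟩ := hRH.norm_riemannZeta_le_rpow (show (0 : ℝ) < 1 / 8 by norm_num)
    (show (0 : ℝ) < 1 / 8 by norm_num)
  obtain ⟨C₂, hC₂, h₂⟩ := hRH.norm_riemannZeta_le_of_re_le (a := 0) (ε := 1 / 4) le_rfl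
    (by norm_num) (by norm_num)
  obtain ⟨C₃, hC₃, h₃⟩ := hRH.norm_riemannZeta_le_critical
  refine ⟨C₁ + C₂ + C₃, by positivity, fun s hs him ↦ ?_⟩
  have hcmp : ∀ c a : ℝ, 0 < c → c ≤ C₁ + C₂ + C₃ → 0 ≤ a → a ≤ 3 / 4 → c * |s.im| ^ a ≤
      (C₁ + C₂ + C₃) * (1 + |s.im|) ^ (3 / 4 : ℝ) := by
    intro c a hc hcC ha0 ha
    have : |s.im| ^ a ≤ (1 + |s.im|) ^ (3 / 4 : ℝ) :=
      (Real.rpow_le_rpow (abs_nonneg _) (by linarith) ha0).trans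
        (Real.rpow_le_rpow_of_exponent_le (by linarith) ha)
    gcongr
  rcases le_or_gt s.re (3 / 8) with hre | hre
  · refine (h₂ s hs hre).trans ?_
    rw [show (1 / 2 - 0 + 1 / 4 : ℝ) = 3 / 4 by norm_num]
    gcongr
    linarith
  rcases le_or_gt s.re (5 / 8) with hre' | hre'
  · have key : ‖riemannZeta s‖ ≤ C₃ * |s.im| ^ (1 / 2 : ℝ) := by
      rcases le_total 0 s.im with h0 | h0
      · rw [abs_of_nonneg h0] at him ⊢
        exact h₃ s hre.le hre' him
      · rw [abs_of_nonpos h0] at him ⊢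
        have := h₃ (conj s) (by simpa using hre.le) (by simpa using hre') (by simpa using him)
        rwa [riemannZeta_conj, Complex.norm_conj, conj_im] at this
    exact key.trans (hcmp _ _ hC₃ (by linarith) (by norm_num) (by norm_num))
  · exact ((h₁ s (by linarith) (by linarith)).1).trans
      (hcmp _ _ hC₁ (by linarith) (by norm_num) (by norm_num))

lemma RiemannHypothesis.riemannZeta₁_ne_zero (hRH : RiemannHypothesis) {s : ℂ}
    (hs : 1 / 2 < s.re) : riemannZeta₁ s ≠ 0 := by
  by_cases h : s = 1
  · rw [h, riemannZeta₁_one]; exact one_ne_zero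
  · rw [riemannZeta₁_eq_mul h]
    exact mul_ne_zero (sub_ne_zero.mpr h) (hRH.riemannZeta_ne_zero (by linarith) hs.ne')

/-- The Mellin transform of `M_k` has a holomorphic continuation to the right of its critical
line. -/
lemma RiemannHypothesis.exists_errTransform_extension (hRH : RiemannHypothesis) {k : ℕ}
    (hk : 2 ≤ k) :
    ∃ g : ℂ → ℂ, DifferentiableOn ℂ g {s | 1 / 2 / (k : ℝ) < s.re} ∧
      ∀ s, s ≠ 1 → (k : ℂ) * s ≠ 1 → g s = errTransform k s := by
  have hk2 : (2 : ℝ) ≤ k := by exact_mod_cast hk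
  have hk0 : (0 : ℝ) < k := by linarith
  have hζk : riemannZeta k ≠ 0 := riemannZeta_ne_zero_of_one_le_re (by simp; linarith)
  have hk1 : (k : ℂ) ≠ 1 := by exact_mod_cast (by omega : k ≠ 1)
  set U : Set ℂ := {s | 1 / 2 / (k : ℝ) < s.re} with hU
  have hUo : IsOpen U := isOpen_lt continuous_const Complex.continuous_re
  have hUk : ∀ s ∈ U, 1 / 2 < ((k : ℂ) * s).re := by
    intro s hs
    rw [re_natCast_mul]
    have hs' : 1 / 2 / (k : ℝ) < s.re := hs
    rw [div_lt_iff₀ hk0] at hs'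
    linarith
  have hU0 : ∀ s ∈ U, s ≠ 0 := by
    rintro s hs rfl
    have := hUk 0 hs
    norm_num at this
  have hUζ : ∀ s ∈ U, riemannZeta₁ (k * s) ≠ 0 := fun s hs ↦ hRH.riemannZeta₁_ne_zero (hUk s hs)
  have h1U : (1 : ℂ) ∈ U := by
    change 1 / 2 / (k : ℝ) < (1 : ℂ).re
    rw [div_lt_iff₀ hk0, one_re]
    linarith
  -- With `riemannZeta₁` in the denominator q is holomorphic at s = 1/k as well, where 1/ζ(ks) has a
  -- zero. The literal formula uses a conventional value of ζ there.
  set q : ℂ → ℂ := fun s ↦ (k * s - 1) / (s * riemannZeta₁ (k * s)) with hq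
  have hqd : DifferentiableOn ℂ q U := by
    refine DifferentiableOn.div (by fun_prop) (DifferentiableOn.mul (by fun_prop) ?_)
      fun s hs ↦ mul_ne_zero (hU0 s hs) (hUζ s hs)
    exact (differentiable_riemannZeta₁.comp (by fun_prop)).differentiableOn
  have hq1 : q 1 = (riemannZeta k)⁻¹ := by
    simp only [hq, mul_one, one_mul]
    rw [riemannZeta₁_eq_mul hk1]
    field_simp [sub_ne_zero.mpr hk1]
  obtain ⟨g, hg, hgf⟩ := exists_differentiableOn_of_removable hUo {1}
    (f := fun s ↦ riemannZeta s * q s - (riemannZeta k)⁻¹ * (s - 1)⁻¹) (by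
      refine DifferentiableOn.sub (DifferentiableOn.mul ?_ (hqd.mono sdiff_subset)) ?_
      · intro s hs
        exact (differentiableAt_riemannZeta fun h ↦ hs.2 (by simp [h])).differentiableWithinAt
      · refine DifferentiableOn.const_mul (DifferentiableOn.inv (by fun_prop) ?_) _
        intro s hs h
        exact hs.2 (by simp [sub_eq_zero.mp h])) (by
      intro ρ hρ
      rw [Finset.mem_singleton] at hρ
      subst hρ
      have hqc : Tendsto q (𝓝[≠] 1) (𝓝 (q 1)) :=
        ((hqd.differentiableAt (hUo.mem_nhds h1U)).continuousAt.tendsto).mono_left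
          nhdsWithin_le_nhds
      -- The residues at 1 cancel: ζ has residue 1 and q(1) = 1/ζ(k).
      have h2 := (riemannZeta_residue_one.mul hqc).sub_const ((riemannZeta k)⁻¹)
      rw [one_mul, hq1, sub_self] at h2
      refine h2.congr' ?_
      filter_upwards [self_mem_nhdsWithin] with s hs
      have : s - 1 ≠ 0 := sub_ne_zero.mpr hs
      rw [mul_sub, ← mul_assoc, mul_left_comm (s - 1) (riemannZeta k)⁻¹, mul_inv_cancel₀ this,
        mul_one])
  refine ⟨g, hg, fun s hs hks ↦ ?_⟩
  rw [hgf s (by simpa using hs), errTransform]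
  simp only [hq]
  rw [riemannZeta₁_eq_mul hks]
  have h3 : (k : ℂ) * s - 1 ≠ 0 := sub_ne_zero.mpr hks
  rw [one_div, mul_inv]
  congr 1
  rw [mul_left_comm s, ← div_div, div_self h3, one_div, ← div_eq_mul_inv]

/-- The exponents are 3/4 from ζ(s), -1 from 1/s and 1/8 from 1/ζ(ks). Any negative total would
serve, and M may depend on δ, since M does not enter the final mean square bound. -/
lemma RiemannHypothesis.norm_errTransform_le (hRH : RiemannHypothesis) {k : ℕ}
    (hk : 2 ≤ k) {δ : ℝ} (hδ : 0 < δ) :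
    ∃ M : ℝ, ∀ s : ℂ, (1 / 2 + δ) / k ≤ s.re → 16 ≤ |s.im| →
      ‖errTransform k s‖ ≤ M * (1 + |s.im|) ^ (-(1 / 8) : ℝ) := by
  have hk2 : (2 : ℝ) ≤ k := by exact_mod_cast hk
  have hk0 : (0 : ℝ) < k := by linarith
  set σ : ℝ := (1 / 2 + δ) / k with hσ
  have hσ0 : 0 < σ := by positivity
  obtain ⟨C₁, hC₁, h₁⟩ := hRH.norm_riemannZeta_le_strip
  obtain ⟨C₂, hC₂, h₂⟩ := hRH.norm_riemannZeta_le_rpow hδ (show (0 : ℝ) < 1 / 8 by norm_num)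
  set c := ‖(riemannZeta k)⁻¹‖ with hc
  refine ⟨C₁ * (σ⁻¹ + 1) * (C₂ * k) + 2 * c, fun s hs him ↦ ?_⟩
  set x := 1 + |s.im| with hx
  have hx1 : 1 ≤ x := by rw [hx]; linarith
  have hx0 : 0 < x := by linarith
  have hs0 : 0 < ‖s‖ := (hσ0.trans_le hs).trans_le ((le_abs_self _).trans (Complex.abs_re_le_norm s))
  have hinv : ‖s‖⁻¹ ≤ (σ⁻¹ + 1) * x⁻¹ := by
    rw [← div_eq_mul_inv, le_div_iff₀ hx0, ← div_eq_inv_mul, div_le_iff₀ hs0]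
    exact one_add_abs_im_le hσ0 hs
  have hkim : |((k : ℂ) * s).im| = k * |s.im| := by
    rw [← Complex.ofReal_natCast, Complex.im_ofReal_mul, abs_mul, abs_of_pos hk0]
  have h3 := (h₂ (k * s) (by rw [re_natCast_mul]; rw [hσ, div_le_iff₀ hk0] at hs; linarith)
    (by rw [hkim]; nlinarith)).2
  rw [hkim] at h3
  have h4 : (k * |s.im|) ^ (1 / 8 : ℝ) ≤ k * x ^ (1 / 8 : ℝ) := by
    rw [Real.mul_rpow hk0.le (abs_nonneg _)]
    have h5 : (k : ℝ) ^ (1 / 8 : ℝ) ≤ k := by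
      calc (k : ℝ) ^ (1 / 8 : ℝ) ≤ (k : ℝ) ^ (1 : ℝ) :=
            Real.rpow_le_rpow_of_exponent_le (by linarith) (by norm_num)
        _ = k := Real.rpow_one _
    have h6 : |s.im| ^ (1 / 8 : ℝ) ≤ x ^ (1 / 8 : ℝ) :=
      Real.rpow_le_rpow (abs_nonneg _) (by linarith) (by norm_num)
    gcongr
  have h7 : ‖(s - 1)⁻¹‖ ≤ 2 * x ^ (-(1 / 8) : ℝ) := by
    have h8 : |s.im| ≤ ‖s - 1‖ := by simpa using Complex.abs_im_le_norm (s - 1)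
    have h9 : x⁻¹ ≤ x ^ (-(1 / 8) : ℝ) := by
      rw [← Real.rpow_neg_one]
      exact Real.rpow_le_rpow_of_exponent_le hx1 (by norm_num)
    calc ‖(s - 1)⁻¹‖ = ‖s - 1‖⁻¹ := norm_inv _
      _ ≤ (x / 2)⁻¹ := by gcongr; rw [hx]; linarith
      _ = 2 * x⁻¹ := by rw [inv_div, div_eq_mul_inv]
      _ ≤ _ := by gcongr
  have h10 : x ^ (3 / 4 : ℝ) * x⁻¹ * x ^ (1 / 8 : ℝ) = x ^ (-(1 / 8) : ℝ) := by
    rw [← Real.rpow_neg_one, ← Real.rpow_add hx0, ← Real.rpow_add hx0]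
    norm_num
  have h11 : errTransform k s = riemannZeta s * s⁻¹ * (riemannZeta (k * s))⁻¹ -
      (riemannZeta k)⁻¹ * (s - 1)⁻¹ := by
    rw [errTransform, ← div_div, div_eq_mul_inv _ (riemannZeta (k * s)), one_div, mul_inv,
      div_eq_mul_inv]
  rw [h11]
  calc ‖riemannZeta s * s⁻¹ * (riemannZeta (k * s))⁻¹ - (riemannZeta k)⁻¹ * (s - 1)⁻¹‖
      ≤ ‖riemannZeta s‖ * ‖s‖⁻¹ * ‖(riemannZeta (k * s))⁻¹‖ + c * ‖(s - 1)⁻¹‖ := by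
        refine (norm_sub_le _ _).trans ?_
        rw [norm_mul, norm_mul, norm_mul, norm_inv s]
    _ ≤ (C₁ * x ^ (3 / 4 : ℝ)) * ((σ⁻¹ + 1) * x⁻¹) * (C₂ * (k * x ^ (1 / 8 : ℝ))) +
        c * (2 * x ^ (-(1 / 8) : ℝ)) := by
        gcongr
        · exact h₁ s (hσ0.le.trans hs) him
        · exact h3.trans (by gcongr)
    _ = C₁ * (σ⁻¹ + 1) * (C₂ * k) * (x ^ (3 / 4 : ℝ) * x⁻¹ * x ^ (1 / 8 : ℝ)) +
        2 * c * x ^ (-(1 / 8) : ℝ) := by ring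
    _ = _ := by rw [h10]; ring

/-- The error term `M_k` on a logarithmic scale. -/
def logErr (k : ℕ) (u : ℝ) : ℂ := (Ioi (0 : ℝ)).indicator (fun u ↦ (errM k (Real.exp u) : ℂ)) u

lemma measurable_logErr (k : ℕ) : Measurable (logErr k) :=
  Measurable.indicator (by
    have := (measurable_errM k).comp Real.measurable_exp
    exact Complex.measurable_ofReal.comp this) measurableSet_Ioi

lemma image_exp_Ioi : Real.exp '' Ioi 0 = Ioi 1 := by
  ext x
  constructor
  · rintro ⟨u, hu, rfl⟩
    exact Real.one_lt_exp_iff.mpr hu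
  · intro hx
    exact ⟨Real.log x, Real.log_pos hx, Real.exp_log (zero_lt_one.trans hx)⟩

lemma image_exp_Ioc (X : ℝ) (hX : 0 < X) : Real.exp '' Ioc 0 (Real.log X) = Ioc 1 X := by
  ext x
  constructor
  · rintro ⟨u, hu, rfl⟩
    exact ⟨Real.one_lt_exp_iff.mpr hu.1, (Real.le_log_iff_exp_le hX).mp hu.2⟩
  · intro hx
    have hx0 : 0 < x := zero_lt_one.trans hx.1
    exact ⟨Real.log x, ⟨Real.log_pos hx.1, Real.log_le_log hx0 hx.2⟩, Real.exp_log hx0⟩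

lemma integral_logErr_mul_exp (k : ℕ) (s : ℂ) :
    ∫ v : ℝ, logErr k v * cexp (-s * v) = tailMellin (errM k) s := by
  rw [tailMellin, ← image_exp_Ioi, integral_image_eq_integral_abs_deriv_smul measurableSet_Ioi
    (fun u _ ↦ (Real.hasDerivAt_exp u).hasDerivWithinAt) Real.exp_injective.injOn,
    ← integral_indicator measurableSet_Ioi]
  refine integral_congr_ae (Eventually.of_forall fun u ↦ ?_)
  simp only [logErr, indicator]
  split_ifs
  · rw [abs_of_pos (Real.exp_pos u), Complex.real_smul, Complex.cpow_def_of_ne_zero (by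
      exact_mod_cast (Real.exp_pos u).ne'), ← Complex.ofReal_log (Real.exp_pos u).le,
      Real.log_exp, mul_left_comm, Complex.ofReal_exp, ← Complex.exp_add]
    congr 2
    ring
  · exact zero_mul _

lemma integrable_logErr_mul_exp (k : ℕ) :
    Integrable fun v : ℝ ↦ logErr k v * cexp (-2 * v) := by
  have h1 : Integrable ((Ioi (0 : ℝ)).indicator fun v : ℝ ↦ errMConst k * Real.exp (-v)) :=
    (integrable_indicator_iff measurableSet_Ioi).mpr
      ((exp_neg_integrableOn_Ioi 0 one_pos).congr_fun (fun v _ ↦ by simp) measurableSet_Ioi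
        |>.const_mul _)
  refine h1.mono' ((measurable_logErr k).mul (by fun_prop)).aestronglyMeasurable
    (Eventually.of_forall fun v ↦ ?_)
  simp only [logErr, indicator]
  split_ifs
  · have h2 := abs_errM_le k (Real.exp_pos v).le
    rw [norm_mul, Complex.norm_real, Real.norm_eq_abs, Complex.norm_exp]
    have h3 : ((-2 : ℂ) * v).re = -2 * v := by simp
    rw [h3]
    calc |errM k (Real.exp v)| * Real.exp (-2 * v)
        ≤ errMConst k * Real.exp v * Real.exp (-2 * v) := by gcongr
      _ = errMConst k * Real.exp (-v) := by rw [mul_assoc, ← Real.exp_add]; ring_nf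
  · simp

/-- The mean square of `M_k` with a convergence factor. -/
lemma RiemannHypothesis.lintegral_logErr_sq_le (hRH : RiemannHypothesis)
    (hJ : ∀ ε : ℝ, 0 < ε → ∃ C : ℝ, ∀ T : ℝ, 1 ≤ T → Jneg1 T ≤ ENNReal.ofReal (C * T ^ (1 + ε)))
    {k : ℕ} (hk : 2 ≤ k) :
    ∃ C : ℝ, 0 < C ∧ ∀ δ : ℝ, 0 < δ → δ ≤ 1 / 4 →
      ∫⁻ u : ℝ, ‖logErr k u * cexp (-((1 / 2 + δ) / k : ℝ) * u)‖ₑ ^ 2 ≤ ENNReal.ofReal (C / δ) := by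
  obtain ⟨C, hC, h⟩ := hRH.lintegral_errTransform_le hJ hk
  refine ⟨C, hC, fun δ hδ hδ4 ↦ ?_⟩
  have hk2 : (2 : ℝ) ≤ k := by exact_mod_cast hk
  have hk0 : (0 : ℝ) < k := by linarith
  obtain ⟨g, hgd, hgf⟩ := hRH.exists_errTransform_extension hk
  obtain ⟨M, hM⟩ := hRH.norm_errTransform_le hk hδ
  set σ : ℝ := (1 / 2 + δ) / k with hσ
  have hσ0 : 0 < σ := by positivity
  have hσ8 : σ ≤ 3 / 8 := one_half_add_div_le hk hδ4
  have hσU : ∀ s : ℂ, σ ≤ s.re → 1 / 2 / (k : ℝ) < s.re := by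
    intro s hs
    refine lt_of_lt_of_le ?_ hs
    rw [hσ]
    gcongr
    linarith
  have hgim : ∀ s : ℂ, s.im ≠ 0 → g s = errTransform k s := by
    intro s hs
    refine hgf s (fun h ↦ hs (by rw [h, one_im])) fun h ↦ hs ?_
    have := congrArg Complex.im h
    rw [← Complex.ofReal_natCast, Complex.im_ofReal_mul, one_im, mul_eq_zero] at this
    exact this.resolve_left hk0.ne'
  have hKc : IsCompact (Icc σ 2 ×ℂ Icc (-16) 16) := isCompact_Icc.reProdIm isCompact_Icc
  obtain ⟨M₀, hM₀⟩ := hKc.exists_bound_of_continuousOn (hgd.continuousOn.mono fun s hs ↦ by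
    rw [Complex.mem_reProdIm] at hs
    exact hσU s hs.1.1)
  have hbound : ∀ s : ℂ, σ ≤ s.re → s.re ≤ 2 →
      ‖g s‖ ≤ (|M| + 17 * |M₀|) * (1 + |s.im|) ^ (-(1 / 8) : ℝ) := by
    intro s hs1 hs2
    have hx : 0 < 1 + |s.im| := by positivity
    rcases le_or_gt 16 |s.im| with him | him
    · rw [hgim s (abs_pos.mp (by linarith))]
      refine (hM s hs1 him).trans ?_
      gcongr
      linarith [le_abs_self M, abs_nonneg M₀]
    · have h1 := hM₀ s (by
        rw [Complex.mem_reProdIm]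
        rw [abs_lt] at him
        exact ⟨⟨hs1, hs2⟩, him.1.le, him.2.le⟩)
      have h2 : 1 ≤ 17 * (1 + |s.im|) ^ (-(1 / 8) : ℝ) := by
        calc (1 : ℝ) = 17 * (17 : ℝ)⁻¹ := by norm_num
          _ ≤ 17 * (1 + |s.im|)⁻¹ := by gcongr; linarith
          _ = 17 * (1 + |s.im|) ^ (-1 : ℝ) := by rw [Real.rpow_neg_one]
          _ ≤ _ := by
            gcongr 17 * ?_
            exact Real.rpow_le_rpow_of_exponent_le (by linarith [abs_nonneg s.im]) (by norm_num)
      calc ‖g s‖ ≤ |M₀| * 1 := by rw [mul_one]; exact h1.trans (le_abs_self _)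
        _ ≤ |M₀| * (17 * (1 + |s.im|) ^ (-(1 / 8) : ℝ)) := by gcongr
        _ = (0 + 17 * |M₀|) * (1 + |s.im|) ^ (-(1 / 8) : ℝ) := by ring
        _ ≤ _ := by gcongr; exact abs_nonneg M
  -- The decay bound depends on δ through its constants but is only used qualitatively: the
  -- conclusion involves the mean square on the line alone.
  have hmain := lintegral_sq_le_of_laplace (measurable_logErr k) (integrable_logErr_mul_exp k)
    (F := g) (p := 1 / 8) hσ0 (by linarith) (by norm_num)
    (hgd.mono fun s hs ↦ hσU s hs.1) hbound (by
      intro t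
      rw [integral_logErr_mul_exp, tailMellin_errM (by omega) (by simp)]
      refine (hgf _ (fun h ↦ ?_) fun h ↦ ?_).symm
      · have := congrArg Complex.re h
        norm_num at this
      · have := congrArg Complex.re h
        rw [re_natCast_mul] at this
        norm_num at this
        linarith)
  refine (hmain.trans (le_of_eq ?_)).trans (h δ hδ hδ4)
  refine lintegral_congr fun t ↦ ?_
  rw [hgf (σ + t * I) (fun h ↦ ?_) fun h ↦ ?_]
  · have := congrArg Complex.re h
    simp at this
    linarith
  · have := congrArg Complex.re h
    rw [re_natCast_mul] at this
    simp [hσ] at this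
    field_simp at this
    linarith

lemma integral_normErr_eq (k : ℕ) {X : ℝ} (hX : 1 ≤ X) :
    ENNReal.ofReal (∫ x in (1 : ℝ)..X, normErr k x ^ 2 / x) =
      ∫⁻ u in Ioc 0 (Real.log X), ENNReal.ofReal (normErr k (Real.exp u) ^ 2) := by
  have hint := intervalIntegrable_normErr k hX
  rw [intervalIntegrable_iff_integrableOn_Ioc_of_le hX] at hint
  rw [intervalIntegral.integral_of_le hX, ofReal_integral_eq_lintegral_ofReal hint,
    ← image_exp_Ioc X (by linarith), lintegral_image_eq_lintegral_abs_deriv_mul measurableSet_Ioc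
    (fun u _ ↦ (Real.hasDerivAt_exp u).hasDerivWithinAt) Real.exp_injective.injOn]
  · refine lintegral_congr fun u ↦ ?_
    rw [← ENNReal.ofReal_mul (abs_nonneg _), abs_of_pos (Real.exp_pos u),
      mul_div_cancel₀ _ (Real.exp_pos u).ne']
  · filter_upwards [ae_restrict_mem measurableSet_Ioc] with x hx
    have : 0 < x := zero_lt_one.trans hx.1
    positivity

lemma normErr_exp_sq (k : ℕ) (hk : k ≠ 0) {u : ℝ} (hu : 0 < u) (δ : ℝ) :
    ENNReal.ofReal (normErr k (Real.exp u) ^ 2) = ENNReal.ofReal (Real.exp (2 * δ / k * u)) *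
      ‖logErr k u * cexp (-((1 / 2 + δ) / k : ℝ) * u)‖ₑ ^ 2 := by
  have hk0 : (k : ℝ) ≠ 0 := by exact_mod_cast hk
  rw [← ofReal_norm, ← ENNReal.ofReal_pow (norm_nonneg _), ← ENNReal.ofReal_mul (by positivity)]
  congr 1
  have h1 : (-((1 / 2 + δ) / k : ℝ) * u : ℂ).re = -((1 / 2 + δ) / k) * u := by
    rw [← Complex.ofReal_neg, ← Complex.ofReal_mul, Complex.ofReal_re]
  rw [logErr, indicator_of_mem (mem_Ioi.mpr hu), norm_mul, Complex.norm_real, Complex.norm_exp, h1, normErr,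
    ← Real.exp_mul, mul_pow, div_pow, Real.norm_eq_abs, sq_abs, div_eq_mul_inv, ← Real.exp_nat_mul,
    ← Real.exp_nat_mul, ← Real.exp_neg, mul_left_comm (Real.exp (2 * δ / k * u)), ← Real.exp_add]
  congr 2
  push_cast
  field_simp
  ring

/-- The mean square bound for `M_k` follows from the bound for `J₋₁`. -/
theorem mean_square_le_of_Jneg1_le (hRH : RiemannHypothesis)
    (hJ : ∀ ε : ℝ, 0 < ε → ∃ C : ℝ, ∀ T : ℝ, 1 ≤ T → Jneg1 T ≤ ENNReal.ofReal (C * T ^ (1 + ε)))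
    {k : ℕ} (hk : 2 ≤ k) :
    ∃ C : ℝ, ∀ X : ℝ, 1 ≤ X →
      ∫ x in (1 : ℝ)..X, (errM k x / x ^ (1 / (2 * (k : ℝ)))) ^ 2 / x ≤ C * Real.log X := by
  obtain ⟨C, hC, h⟩ := hRH.lintegral_logErr_sq_le hJ hk
  have hk2 : (2 : ℝ) ≤ k := by exact_mod_cast hk
  -- The first term serves log X ≥ 1. The second serves X ≤ 3, where X - 1 ≤ 3 log X and the
  -- integrand is at most 3 `errMConst k` ^ 2.
  refine ⟨Real.exp 1 * (4 * C) + 9 * errMConst k ^ 2, fun X hX ↦ ?_⟩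
  change ∫ x in (1 : ℝ)..X, normErr k x ^ 2 / x ≤ _
  have hL0 : 0 ≤ Real.log X := Real.log_nonneg hX
  rcases le_or_gt 1 (Real.log X) with hL | hL
  · set L := Real.log X with hLdef
    -- For u ≤ log X the factor exp(2δu/k) stays below e, so removing the convergence factor costs
    -- only a constant, and C/δ = 4 C log X. The condition δ ≤ 1/4 is log X ≥ 1.
    set δ := 1 / (4 * L) with hδ
    have hδ0 : 0 < δ := by positivity
    have hδ4 : δ ≤ 1 / 4 := by
      rw [hδ, div_le_div_iff₀ (by linarith) (by norm_num)]; linarith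
    have h1 : ENNReal.ofReal (∫ x in (1 : ℝ)..X, normErr k x ^ 2 / x) ≤
        ENNReal.ofReal (Real.exp 1 * (4 * C) * L) := by
      rw [integral_normErr_eq k hX]
      calc ∫⁻ u in Ioc 0 L, ENNReal.ofReal (normErr k (Real.exp u) ^ 2)
          ≤ ∫⁻ u in Ioc 0 L, ENNReal.ofReal (Real.exp 1) *
            ‖logErr k u * cexp (-((1 / 2 + δ) / k : ℝ) * u)‖ₑ ^ 2 := by
            refine setLIntegral_mono' measurableSet_Ioc fun u hu ↦ ?_
            rw [normErr_exp_sq k (by omega) hu.1 δ]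
            gcongr ENNReal.ofReal ?_ * _
            rw [Real.exp_le_exp]
            calc 2 * δ / k * u ≤ 2 * δ / 2 * L := by
                  gcongr
                  exacts [hu.1.le, hu.2]
              _ = 1 / 4 := by rw [hδ]; field_simp
              _ ≤ 1 := by norm_num
        _ ≤ ∫⁻ u : ℝ, ENNReal.ofReal (Real.exp 1) *
            ‖logErr k u * cexp (-((1 / 2 + δ) / k : ℝ) * u)‖ₑ ^ 2 := setLIntegral_le_lintegral _ _
        _ = ENNReal.ofReal (Real.exp 1) *
            ∫⁻ u : ℝ, ‖logErr k u * cexp (-((1 / 2 + δ) / k : ℝ) * u)‖ₑ ^ 2 :=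
            lintegral_const_mul' _ _ ENNReal.ofReal_ne_top
        _ ≤ ENNReal.ofReal (Real.exp 1) * ENNReal.ofReal (C / δ) :=
            mul_le_mul' le_rfl (h δ hδ0 hδ4)
        _ = ENNReal.ofReal (Real.exp 1 * (4 * C) * L) := by
            rw [← ENNReal.ofReal_mul (Real.exp_nonneg _)]
            congr 1
            rw [hδ]
            field_simp
    have h2 := (ENNReal.ofReal_le_ofReal_iff (by positivity)).mp h1
    refine h2.trans ?_
    gcongr
    linarith [sq_nonneg (errMConst k)]
  · have hX3 : X ≤ 3 := by
      rw [Real.log_lt_iff_lt_exp (by linarith)] at hL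
      linarith [Real.exp_one_lt_d9]
    have h1 := intervalIntegral.integral_mono_on hX (intervalIntegrable_normErr k hX)
      (g := fun _ ↦ errMConst k ^ 2 * 3) intervalIntegrable_const
      fun x hx ↦ normErr_sq_div_le k hx.1 (hx.2.trans hX3)
    rw [intervalIntegral.integral_const, smul_eq_mul] at h1
    have h2 : X - 1 ≤ 3 * Real.log X := by
      have h3 := Real.one_sub_inv_le_log_of_pos (by linarith : 0 < X)
      have h4 : X * (1 - X⁻¹) = X - 1 := by field_simp
      nlinarith
    calc _ ≤ (X - 1) * (errMConst k ^ 2 * 3) := h1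
      _ ≤ (3 * Real.log X) * (errMConst k ^ 2 * 3) := by gcongr
      _ = (0 + 9 * errMConst k ^ 2) * Real.log X := by ring
      _ ≤ _ := by gcongr; positivity

end

theorem theorem1 (hRH : RiemannHypothesis) :
    (∀ ε : ℝ, 0 < ε → ∃ C : ℝ, ∀ T : ℝ, 1 ≤ T →
        Jneg1 T ≤ ENNReal.ofReal (C * T ^ (1 + ε))) ↔
    (∀ k : ℕ, 2 ≤ k → ∃ C : ℝ, ∀ X : ℝ, 1 ≤ X →
        ∫ x in (1 : ℝ)..X, (errM k x / x ^ (1 / (2 * (k : ℝ)))) ^ 2 / x ≤ C * Real.log X) := by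
  exact ⟨fun h _ hk ↦ mean_square_le_of_Jneg1_le hRH h hk,
    fun h _ hε ↦ Jneg1_le_of_mean_square hRH h hε⟩
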